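/- Let $M$ be a smooth manifold of dimension $n$ and let $p\colon Z\to M$ be a smooth $n$-torus bundle with zero section $s$, i.e. a smooth bundle of Lie groups with fibre $\mathbb R^n/\mathbb Z^n$: it has smooth local trivializations $p^{-1}(U)\cong U\times \mathbb R^n/\mathbb Z^n$ which take $s$ to $0$ and whose transition maps are group automorphisms of $\mathbb R^n/\mathbb Z^n$ on each fibre. Put $T_{Z/M}=\ker(dp)$ and $V=s^*T_{Z/M}$. Let $\nabla$ be the Gauss--Manin connection on $V$, that is, the flat connection for which the local sections of the lattices $H_1(Z_m,\mathbb Z)\subset V_m$ are flat. Let $\mathcal S$ be the sheaf of flat sections of $V$, and $\mathcal S^\vee=\mathrm{Hom}(\mathcal S,\mathbb R)$ the sheaf of flat sections of $V^\vee$. Let $j\colon p^*V\to T_Z$ be the inclusion with image $T_{Z/M}$ given by translation in the fibres, and let $D\colon T_Z\to p^*V$, $\alpha\colon p^*T_M\to T_Z$ be the splitting of $$0\to p^*V\xrightarrow{\ j\ } T_Z\xrightarrow{\ dp\ } p^*T_M\to 0$$ determined by $\nabla$: for a local flat frame $(e_i)$ of $V$ with corresponding fibre coordinates $\xi_i$ on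 $Z$ (defined up to constants), $D=\sum_i p^*e_i\otimes d\xi_i$, and $\alpha$ is the right inverse of $dp$ with image $\ker D$. On $W\oplus W^\vee$ use the pairing $\langle v+f,w+g\rangle=-\tfrac12(f(w)+g(v))$. A generalized almost complex structure on a real vector bundle $W$ is a smooth orthogonal automorphism $\mathcal J$ of $W\oplus W^\vee$ with $\mathcal J^2=-1$. Let $\underline{\mathcal J}$ be a generalized almost complex structure on $V\oplus T_M$ which is adapted, i.e. $\underline{\mathcal J}(V\oplus V^\vee)=T_M\oplus T_M^\vee$, and let $$\mathcal J=F^{-1}\circ p^*\underline{\mathcal J}\circ F,\qquad F=(D,dp)\oplus(j,\alpha)^\vee\colon\ T_Z\oplus T_Z^\vee\ \xrightarrow{\ \cong\ }\ p^*\bigl((V\oplus T_M)\oplus (V\oplus T_M)^\vee\bigr),$$ be the associated semi-flat generalized almost complex structure on $Z$. Let $$[X+\xi,Y+\eta]=[X,Y]+\mathcal L_X\eta-\mathcal L_Y\xi+\tfrac12 d(\iota_Y\xi-\iota_X\eta)$$ be the Courant bracket. Then $\mathcal J$ is integrable (the sheaf of smooth sections of its $+i$-eigenbundle in $(T_Z\oplus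 T_Z^\vee)\otimes\mathbb C$ is closed under the complex bilinear extension of the Courant bracket) if and only if $$\bigl[\underline{\mathcal J}(\mathcal S\oplus\mathcal S^\vee),\underline{\mathcal J}(\mathcal S\oplus\mathcal S^\vee)\bigr]=0,$$ i.e. over every open subset of $M$ all pairwise Courant brackets of sections $\underline{\mathcal J}(a)$, $\underline{\mathcal J}(b)$ of $T_M\oplus T_M^\vee$, with $a,b$ sections of $\mathcal S\oplus\mathcal S^\vee$, vanish. -/

import Mathlib

open Set Bundle Topology
open scoped Manifold ContDiff

noncomputable section

/-! ### Generalized complex linear algebra -/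

section Linear

variable {W : Type*} [AddCommGroup W] [Module ℝ W] [TopologicalSpace W]

/-- The pairing `⟨v + f, w + g⟩ = -(f w + g v) / 2` on `W ⊕ W^∨`. -/
def genPairing (a b : W × (W →L[ℝ] ℝ)) : ℝ :=
  -(1 / 2) * (a.2 b.1 + b.2 a.1)

/-- A generalized complex structure on a real vector space `W`: an endomorphism `J` of `W ⊕ W^∨`
which preserves the pairing and satisfies `J² = -1`. -/
def IsGenComplexLinear (J : (W × (W →L[ℝ] ℝ)) →ₗ[ℝ] (W × (W →L[ℝ] ℝ))) : Prop :=
  (∀ a, J (J a) = -a) ∧ ∀ a b, genPairing (J a) (J b) = genPairing a b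

end Linear

/-! ### The Courant bracket and integrability on a manifold -/

section Courant

variable {E : Type*} [NormedAddCommGroup E] [NormedSpace ℝ E]
  {M : Type*} [TopologicalSpace M] [ChartedSpace E M] [IsManifold 𝓘(ℝ, E) ∞ M]

variable (E) in
/-- The fibre `T_x ⊕ T_x^∨`. -/
abbrev GenTangent (x : M) : Type _ :=
  TangentSpace 𝓘(ℝ, E) x × (TangentSpace 𝓘(ℝ, E) x →L[ℝ] ℝ)

/-- The vector field `X` is smooth on `U`. -/
def SmoothVectorFieldOn (U : Set M) (X : ∀ x : M, TangentSpace 𝓘(ℝ, E) x) : Prop :=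
  ContMDiffOn 𝓘(ℝ, E) 𝓘(ℝ, E).tangent ∞ (fun x => (⟨x, X x⟩ : TangentBundle 𝓘(ℝ, E) M)) U

/-- The 1-form `η` is smooth on `U`, as a section of the bundle `Hom(T_M, ℝ)`. -/
def SmoothOneFormOn (U : Set M) (η : ∀ x : M, TangentSpace 𝓘(ℝ, E) x →L[ℝ] ℝ) : Prop :=
  ContMDiffOn 𝓘(ℝ, E) (𝓘(ℝ, E).prod 𝓘(ℝ, E →L[ℝ] ℝ)) ∞
    (fun x => (⟨x, η x⟩ : TotalSpace (E →L[ℝ] ℝ)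
      (fun x : M => TangentSpace 𝓘(ℝ, E) x →L[ℝ] Trivial M ℝ x))) U

/-- Smooth local sections of `T_M ⊕ T_M^∨` over `U`. -/
def SmoothGenSectionOn (U : Set M) (a : ∀ x : M, GenTangent E x) : Prop :=
  SmoothVectorFieldOn U (fun x => (a x).1) ∧ SmoothOneFormOn U (fun x => (a x).2)

/-- The differential of a real function, as a 1-form. -/
def dFun (f : M → ℝ) (x : M) : TangentSpace 𝓘(ℝ, E) x →L[ℝ] ℝ :=
  mfderiv 𝓘(ℝ, E) 𝓘(ℝ, ℝ) f x

/-- The 1-form `η` written in the chart at `x`. -/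
def oneFormInChart (η : ∀ x : M, TangentSpace 𝓘(ℝ, E) x →L[ℝ] ℝ) (x : M) (u : E) : E →L[ℝ] ℝ :=
  (η ((extChartAt 𝓘(ℝ, E) x).symm u)).comp
    (mfderiv 𝓘(ℝ, E) 𝓘(ℝ, E) (extChartAt 𝓘(ℝ, E) x).symm u)

/-- The contraction `ι_X dη`, computed in the chart at `x`, where
`dη(v, w) = (D_v η)(w) - (D_w η)(v)`. -/
def contractExtDeriv (X : ∀ x : M, TangentSpace 𝓘(ℝ, E) x)
    (η : ∀ x : M, TangentSpace 𝓘(ℝ, E) x →L[ℝ] ℝ) (x : M) : TangentSpace 𝓘(ℝ, E) x →L[ℝ] ℝ :=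
  let A : E →L[ℝ] E →L[ℝ] ℝ := fderiv ℝ (oneFormInChart η x) (extChartAt 𝓘(ℝ, E) x x)
  let φ : TangentSpace 𝓘(ℝ, E) x →L[ℝ] E :=
    mfderiv 𝓘(ℝ, E) 𝓘(ℝ, E) (extChartAt 𝓘(ℝ, E) x) x
  (A (φ (X x)) - A.flip (φ (X x))).comp φ

/-- The Lie derivative of a 1-form, `𝓛_X η = ι_X dη + d(ι_X η)`. -/
def lieDerivOneForm (X : ∀ x : M, TangentSpace 𝓘(ℝ, E) x)
    (η : ∀ x : M, TangentSpace 𝓘(ℝ, E) x →L[ℝ] ℝ) (x : M) : TangentSpace 𝓘(ℝ, E) x →L[ℝ] ℝ :=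
  contractExtDeriv X η x + dFun (fun y => η y (X y)) x

/-- The Courant bracket
`[X + ξ, Y + η] = [X, Y] + 𝓛_X η - 𝓛_Y ξ + (1/2) d(ι_Y ξ - ι_X η)`. -/
def courantBracket (a b : ∀ x : M, GenTangent E x) (x : M) : GenTangent E x :=
  (VectorField.mlieBracket 𝓘(ℝ, E) (fun y => (a y).1) (fun y => (b y).1) x,
    lieDerivOneForm (fun y => (a y).1) (fun y => (b y).2) x
      - lieDerivOneForm (fun y => (b y).1) (fun y => (a y).2) x
      + (1 / 2 : ℝ) • dFun (fun y => (a y).2 (b y).1 - (b y).2 (a y).1) x)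

variable (E M) in
/-- A section `re + i im` of the complexified bundle `(T_M ⊕ T_M^∨) ⊗ ℂ`. -/
structure ComplexGenSection where
  re : ∀ x : M, GenTangent E x
  im : ∀ x : M, GenTangent E x

/-- The complex bilinear extension of the Courant bracket. -/
def complexCourantBracket (a b : ComplexGenSection E M) : ComplexGenSection E M where
  re x := courantBracket a.re b.re x - courantBracket a.im b.im x
  im x := courantBracket a.re b.im x + courantBracket a.im b.re x

/-- The value at `x` of `a = re + i im` lies in the `+i`-eigenspace of (the complex linear
extension of) `J`, that is, `J re + i J im = i (re + i im)`. -/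
def InPlusEigenbundle (J : ∀ x : M, GenTangent E x →ₗ[ℝ] GenTangent E x)
    (a : ComplexGenSection E M) (x : M) : Prop :=
  J x (a.re x) = -a.im x ∧ J x (a.im x) = a.re x

/-- Smooth local sections over `U` of the `+i`-eigenbundle of `J`. -/
def IsSectionOfPlusEigenbundle (J : ∀ x : M, GenTangent E x →ₗ[ℝ] GenTangent E x)
    (U : Set M) (a : ComplexGenSection E M) : Prop :=
  SmoothGenSectionOn U a.re ∧ SmoothGenSectionOn U a.im ∧ ∀ x ∈ U, InPlusEigenbundle J a x

/-- Integrability: the sheaf of smooth sections of the `+i`-eigenbundle is closed under the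
Courant bracket (the bracket of smooth sections is automatically smooth). -/
def IsIntegrableGen (J : ∀ x : M, GenTangent E x →ₗ[ℝ] GenTangent E x) : Prop :=
  ∀ U : Set M, IsOpen U → ∀ a b : ComplexGenSection E M,
    IsSectionOfPlusEigenbundle J U a → IsSectionOfPlusEigenbundle J U b →
      ∀ x ∈ U, InPlusEigenbundle J (complexCourantBracket a b) x

end Courant

/-! ### Torus bundles with zero section -/

/-- The standard torus `ℝⁿ / ℤⁿ`. -/
abbrev StdTorus (n : ℕ) : Type := Fin n → UnitAddCircle

/-- The projection `ℝⁿ → ℝⁿ / ℤⁿ`. -/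
def torusMk {n : ℕ} (ξ : Fin n → ℝ) : StdTorus n := fun i => (ξ i : UnitAddCircle)

/-- Some point of `ℝⁿ` above a point of the torus. -/
def torusLift {n : ℕ} (t : StdTorus n) : Fin n → ℝ := fun i => Quotient.out (t i)

/-- A smooth `n`-torus bundle `Z → M` with zero section, i.e. a smooth bundle of Lie groups modelled
on `ℝⁿ / ℤⁿ`: its local trivializations `p⁻¹(U) ≅ U × ℝⁿ/ℤⁿ` are diffeomorphisms (which is
expressed through the smooth covering `U × ℝⁿ → U × ℝⁿ/ℤⁿ`), they take the zero section to `0`, and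
the transition maps are group automorphisms on each fibre. -/
structure TorusBundle (n : ℕ) (E : Type*) [NormedAddCommGroup E] [NormedSpace ℝ E]
    (F : Type*) [NormedAddCommGroup F] [NormedSpace ℝ F]
    (M : Type*) [TopologicalSpace M] [ChartedSpace E M]
    (Z : Type*) [TopologicalSpace Z] [ChartedSpace F Z] where
  /-- the projection `p : Z → M` -/
  proj : Z → M
  /-- the zero section `s : M → Z` -/
  zero : M → Z
  contMDiff_proj : ContMDiff 𝓘(ℝ, F) 𝓘(ℝ, E) ∞ proj
  contMDiff_zero : ContMDiff 𝓘(ℝ, E) 𝓘(ℝ, F) ∞ zero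
  proj_zero : ∀ m, proj (zero m) = m
  atlas : Set (Trivialization (StdTorus n) proj)
  exists_mem_atlas : ∀ m : M, ∃ e ∈ atlas, m ∈ e.baseSet
  isLocalDiffeomorphOn : ∀ e ∈ atlas,
    IsLocalDiffeomorphOn (𝓘(ℝ, E).prod 𝓘(ℝ, Fin n → ℝ)) 𝓘(ℝ, F) ∞
      (fun x : M × (Fin n → ℝ) => e.toOpenPartialHomeomorph.symm (x.1, torusMk x.2))
      (e.baseSet ×ˢ univ)
  triv_zero : ∀ e ∈ atlas, ∀ m ∈ e.baseSet, e (zero m) = (m, 0)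
  transition_add : ∀ e ∈ atlas, ∀ e' ∈ atlas, ∀ m ∈ e.baseSet ∩ e'.baseSet, ∀ t t' : StdTorus n,
    (e' (e.toOpenPartialHomeomorph.symm (m, t + t'))).2 =
      (e' (e.toOpenPartialHomeomorph.symm (m, t))).2 +
        (e' (e.toOpenPartialHomeomorph.symm (m, t'))).2

namespace TorusBundle

variable {n : ℕ} {E : Type*} [NormedAddCommGroup E] [NormedSpace ℝ E]
  {F : Type*} [NormedAddCommGroup F] [NormedSpace ℝ F]
  {M : Type*} [TopologicalSpace M] [ChartedSpace E M]
  {Z : Type*} [TopologicalSpace Z] [ChartedSpace F Z]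
  (B : TorusBundle n E F M Z)

/-- A local trivialization around `m`. -/
def trivAt (m : M) : Trivialization (StdTorus n) B.proj := (B.exists_mem_atlas m).choose

lemma trivAt_mem_atlas (m : M) : B.trivAt m ∈ B.atlas := (B.exists_mem_atlas m).choose_spec.1

lemma mem_baseSet_trivAt (m : M) : m ∈ (B.trivAt m).baseSet :=
  (B.exists_mem_atlas m).choose_spec.2

/-- The parametrization `(m, ξ) ↦ e⁻¹(m, ξ mod ℤⁿ)` of `p⁻¹(U)` by `U × ℝⁿ` given by a local
trivialization. -/
def param (e : Trivialization (StdTorus n) B.proj) (x : M × (Fin n → ℝ)) : Z :=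
  e.toOpenPartialHomeomorph.symm (x.1, torusMk x.2)

/-- The differential of `param` at `(m, ξ)`. -/
def dParam (e : Trivialization (StdTorus n) B.proj) (m : M) (ξ : Fin n → ℝ) :
    TangentSpace 𝓘(ℝ, E) m × (Fin n → ℝ) →L[ℝ] TangentSpace 𝓘(ℝ, F) (B.param e (m, ξ)) :=
  mfderiv (𝓘(ℝ, E).prod 𝓘(ℝ, Fin n → ℝ)) 𝓘(ℝ, F) (B.param e) (m, ξ)

/-- The vertical tangent space `(T_{Z/M})_z = ker dp_z`. -/
abbrev vert (z : Z) : Submodule ℝ (TangentSpace 𝓘(ℝ, F) z) :=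
  LinearMap.ker (mfderiv 𝓘(ℝ, F) 𝓘(ℝ, E) B.proj z).toLinearMap

/-- The fibre at `m` of `V = s^* T_{Z/M}`. -/
abbrev V (m : M) : Submodule ℝ (TangentSpace 𝓘(ℝ, F) (B.zero m)) := B.vert (B.zero m)

lemma param_zero {e : Trivialization (StdTorus n) B.proj} (he : e ∈ B.atlas) {m : M}
    (hm : m ∈ e.baseSet) : B.param e (m, 0) = B.zero m := by
  have h1 : B.zero m ∈ e.source := by
    rw [e.mem_source, B.proj_zero]; exact hm
  have h2 : e.toOpenPartialHomeomorph (B.zero m) = (m, 0) := B.triv_zero e he m hm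
  have h3 : (torusMk (0 : Fin n → ℝ)) = 0 := by
    funext i; simp [torusMk]
  unfold param
  simp only [h3]
  rw [← h2]
  exact e.toOpenPartialHomeomorph.left_inv h1

lemma proj_param {e : Trivialization (StdTorus n) B.proj} {m : M}
    (hm : m ∈ e.baseSet) (ξ : Fin n → ℝ) : B.proj (B.param e (m, ξ)) = m :=
  e.proj_symm_apply' hm

lemma mfderiv_proj_dParam {e : Trivialization (StdTorus n) B.proj} (he : e ∈ B.atlas) {m : M}
    (hm : m ∈ e.baseSet) (ξ η : Fin n → ℝ) :
    mfderiv 𝓘(ℝ, F) 𝓘(ℝ, E) B.proj (B.param e (m, ξ)) (B.dParam e m ξ (0, η)) = 0 := by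
  have hΦ : MDifferentiableAt (𝓘(ℝ, E).prod 𝓘(ℝ, Fin n → ℝ)) 𝓘(ℝ, F) (B.param e) (m, ξ) :=
    (B.isLocalDiffeomorphOn e he ⟨(m, ξ), hm, mem_univ _⟩).mdifferentiableAt (by simp)
  have hp : MDifferentiableAt 𝓘(ℝ, F) 𝓘(ℝ, E) B.proj (B.param e (m, ξ)) :=
    B.contMDiff_proj.mdifferentiableAt (by simp)
  have hc := mfderiv_comp (m, ξ) hp hΦ
  have he' : (B.proj ∘ B.param e) =ᶠ[𝓝 (m, ξ)] Prod.fst := by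
    filter_upwards [(e.open_baseSet.prod isOpen_univ).mem_nhds
      (show (m, ξ) ∈ e.baseSet ×ˢ univ from ⟨hm, mem_univ _⟩)] with x hx
    exact B.proj_param hx.1 x.2
  rw [he'.mfderiv_eq, mfderiv_fst] at hc
  exact (DFunLike.congr_fun hc ((0, η) : E × (Fin n → ℝ))).symm

/-- The frame of `V` at `m` given by the trivialization around `m`: it sends the standard basis of
`ℝⁿ` to the tangent vectors `∂/∂ξ_i` of the fibre at the origin. The image of `ℤⁿ` is the lattice
`Λ_m = H₁(Z_m, ℤ)` in `V_m`. -/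
def frame (m : M) : (Fin n → ℝ) →L[ℝ] B.V m :=
  (((B.dParam (B.trivAt m) m 0).comp (ContinuousLinearMap.inr ℝ _ _) :
    (Fin n → ℝ) →L[ℝ] TangentSpace 𝓘(ℝ, F) (B.zero m))).codRestrict (B.V m) (fun η => by
      have h := B.mfderiv_proj_dParam (B.trivAt_mem_atlas m) (B.mem_baseSet_trivAt m) 0 η
      rw [B.param_zero (B.trivAt_mem_atlas m) (B.mem_baseSet_trivAt m)] at h
      exact h)

variable [IsManifold 𝓘(ℝ, E) ∞ M] [IsManifold 𝓘(ℝ, F) ∞ Z]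

/-- The section `σ` of `V` is smooth on `U` (as a map to `T_Z`, of which `V` is the pullback of a
subbundle along `s`). -/
def SmoothVOn (U : Set M) (σ : ∀ m, B.V m) : Prop :=
  ContMDiffOn 𝓘(ℝ, E) 𝓘(ℝ, F).tangent ∞
    (fun m => (⟨B.zero m, (σ m : TangentSpace 𝓘(ℝ, F) (B.zero m))⟩ : TangentBundle 𝓘(ℝ, F) Z)) U

/-- The section `θ` of `V^∨` is smooth on `U`: its pairing with every smooth local section of `V` is
a smooth function. -/
def SmoothVDualOn (U : Set M) (θ : ∀ m, B.V m →L[ℝ] ℝ) : Prop :=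
  ∀ U' ⊆ U, IsOpen U' → ∀ σ : ∀ m, B.V m, B.SmoothVOn U' σ →
    ContMDiffOn 𝓘(ℝ, E) 𝓘(ℝ, ℝ) ∞ (fun m => θ m (σ m)) U'

/-- The components of `u ∈ V_m` in the frame given by the trivialization `e` over a neighbourhood
of `m`. -/
def coord (e : Trivialization (StdTorus n) B.proj) (m : M) (u : B.V m) : Fin n → ℝ :=
  ((B.dParam e m 0).inverse (u : TangentSpace 𝓘(ℝ, F) (B.zero m))).2

/-- The Gauss–Manin connection `∇` on `V`. The frames of `V` over open sets `U` given by the local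
trivializations are `ℤ`-bases of the local system `H₁(Z_m, ℤ)` of lattices (they are related by
locally constant matrices in `GL(n, ℤ)`), and `∇` is `1 ⊗ d` in such a frame. -/
def gaussManin (σ : ∀ m, B.V m) (m : M) : TangentSpace 𝓘(ℝ, E) m →L[ℝ] B.V m :=
  (B.frame m).comp
    (mfderiv 𝓘(ℝ, E) 𝓘(ℝ, Fin n → ℝ) (fun m' => B.coord (B.trivAt m) m' (σ m')) m :
      TangentSpace 𝓘(ℝ, E) m →L[ℝ] (Fin n → ℝ))

/-- The sheaf `𝓢` of flat sections: smooth sections `σ` of `V` over `U` with `∇σ = 0`. -/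
def IsFlatOn (U : Set M) (σ : ∀ m, B.V m) : Prop :=
  B.SmoothVOn U σ ∧ ∀ m ∈ U, B.gaussManin σ m = 0

/-- The dual local system `𝓢^∨ = Hom(𝓢, ℝ)`: sections `θ` of `V^∨` over `U` whose pairing with every
local flat section of `V` is locally constant. -/
def IsFlatDualOn (U : Set M) (θ : ∀ m, B.V m →L[ℝ] ℝ) : Prop :=
  ∀ U' ⊆ U, IsOpen U' → ∀ σ : ∀ m, B.V m, B.IsFlatOn U' σ →
    ∀ m ∈ U', ∀ᶠ m' in 𝓝 m, θ m' (σ m') = θ m (σ m)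

/-! #### The splitting of the tangent sequence of `Z` -/

/-- The vertical coordinates `ξ` of a point `z`, in the trivialization around `p z`. -/
def vertCoord (z : Z) : Fin n → ℝ := torusLift (B.trivAt (B.proj z) z).2

/-- The differential at `z` of the parametrization by `U × ℝⁿ` around `p z`. -/
def dParamAt (z : Z) :
    TangentSpace 𝓘(ℝ, E) (B.proj z) × (Fin n → ℝ) →L[ℝ] TangentSpace 𝓘(ℝ, F) z :=
  B.dParam (B.trivAt (B.proj z)) (B.proj z) (B.vertCoord z)

/-- The map `j : p^* V → T_Z`, i.e. the identification of `V_{p z}` with the vertical tangent space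
at `z` by translation in the fibre. -/
def incl (z : Z) : B.V (B.proj z) →L[ℝ] TangentSpace 𝓘(ℝ, F) z :=
  ((B.dParamAt z).comp (ContinuousLinearMap.inr ℝ _ _)).comp (B.frame (B.proj z)).inverse

/-- The splitting `D : T_Z → p^* V` of the tangent sequence given by the Gauss–Manin connection: the
map `D = ∑ f_i ⊗ dξ_i`, where `f_i` is a flat frame of `V` and `ξ_i` are the corresponding vertical
coordinates. -/
def vertProj (z : Z) : TangentSpace 𝓘(ℝ, F) z →L[ℝ] B.V (B.proj z) :=
  (B.frame (B.proj z)).comp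
    ((ContinuousLinearMap.snd ℝ _ _).comp (B.dParamAt z).inverse)

/-- The horizontal lift `α : p^* T_M → T_Z`, the splitting of `dp` with image `ker D`:
`α(∂/∂x_i) = ∂/∂y_i` in the coordinates `(y_i, ξ_i)` with `y_i = x_i ∘ p`. -/
def horLift (z : Z) : TangentSpace 𝓘(ℝ, E) (B.proj z) →L[ℝ] TangentSpace 𝓘(ℝ, F) z :=
  (B.dParamAt z).comp (ContinuousLinearMap.inl ℝ _ _)

/-- The fibre at `m` of the vector bundle `V ⊕ T_M`. -/
abbrev VT (m : M) : Type _ := B.V m × TangentSpace 𝓘(ℝ, E) m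

/-- The fibre at `m` of `(V ⊕ T_M) ⊕ (V ⊕ T_M)^∨`. -/
abbrev GenVT (m : M) : Type _ := B.VT m × (B.VT m →L[ℝ] ℝ)

/-- `(j, α) : p^* V ⊕ p^* T_M → T_Z`. -/
def split (z : Z) : B.VT (B.proj z) →L[ℝ] TangentSpace 𝓘(ℝ, F) z :=
  (B.incl z).coprod (B.horLift z)

/-- `(D, dp) : T_Z → p^* V ⊕ p^* T_M`. -/
def unsplit (z : Z) : TangentSpace 𝓘(ℝ, F) z →L[ℝ] B.VT (B.proj z) :=
  (B.vertProj z).prod (mfderiv 𝓘(ℝ, F) 𝓘(ℝ, E) B.proj z)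

/-- The isomorphism `F = (D, dp) ⊕ (j, α)^∨` from `T_Z ⊕ T_Z^∨` to
`p^* ((V ⊕ T_M) ⊕ (V ⊕ T_M)^∨)`. -/
def toBase (z : Z) : GenTangent F z →ₗ[ℝ] B.GenVT (B.proj z) where
  toFun a := (B.unsplit z a.1, a.2.comp (B.split z))
  map_add' a b := by ext <;> simp
  map_smul' c a := by ext <;> simp

/-- The inverse `F⁻¹ = (j, α) ⊕ (D, dp)^∨`. -/
def fromBase (z : Z) : B.GenVT (B.proj z) →ₗ[ℝ] GenTangent F z where
  toFun a := (B.split z a.1, a.2.comp (B.unsplit z))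
  map_add' a b := by ext <;> simp
  map_smul' c a := by ext <;> simp

/-! #### Semi-flat generalized almost complex structures -/

/-- The subspace `V ⊕ V^∨` of `(V ⊕ T_M) ⊕ (V ⊕ T_M)^∨` at `m`. -/
def genV (m : M) : Submodule ℝ (B.GenVT m) where
  carrier := {a | a.1.2 = 0 ∧ ∀ v, a.2 (0, v) = 0}
  add_mem' ha hb := by simp_all
  zero_mem' := by simp
  smul_mem' c a ha := by simp_all

/-- The subspace `T_M ⊕ T_M^∨` of `(V ⊕ T_M) ⊕ (V ⊕ T_M)^∨` at `m`. -/
def genT (m : M) : Submodule ℝ (B.GenVT m) where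
  carrier := {a | a.1.1 = 0 ∧ ∀ u, a.2 (u, 0) = 0}
  add_mem' ha hb := by simp_all
  zero_mem' := by simp
  smul_mem' c a ha := by simp_all

/-- The inclusion `V ⊕ V^∨ → (V ⊕ T_M) ⊕ (V ⊕ T_M)^∨`. -/
def ofV (m : M) (u : B.V m) (θ : B.V m →L[ℝ] ℝ) : B.GenVT m :=
  ((u, 0), θ.comp (ContinuousLinearMap.fst ℝ _ _))

/-- The projection `(V ⊕ T_M) ⊕ (V ⊕ T_M)^∨ → T_M ⊕ T_M^∨`. -/
def toT (m : M) (a : B.GenVT m) : GenTangent E m :=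
  (a.1.2, a.2.comp (ContinuousLinearMap.inr ℝ _ _))

/-- Smooth local sections over `U` of `(V ⊕ T_M) ⊕ (V ⊕ T_M)^∨`. -/
def SmoothGenVTOn (U : Set M) (a : ∀ m, B.GenVT m) : Prop :=
  B.SmoothVOn U (fun m => (a m).1.1) ∧
  B.SmoothVDualOn U (fun m => (a m).2.comp (ContinuousLinearMap.inl ℝ _ _)) ∧
  SmoothGenSectionOn U (fun m => B.toT m (a m))

/-- An adapted generalized almost complex structure on the vector bundle `V ⊕ T_M`: a smooth bundle
automorphism (i.e. smooth sections are taken to smooth sections) `J` of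
`(V ⊕ T_M) ⊕ (V ⊕ T_M)^∨` which is orthogonal, has square `-1`, and satisfies
`J (V ⊕ V^∨) = T_M ⊕ T_M^∨`. -/
structure AdaptedGACS where
  J : ∀ m, B.GenVT m →ₗ[ℝ] B.GenVT m
  smooth : ∀ U : Set M, IsOpen U → ∀ a : ∀ m, B.GenVT m,
    B.SmoothGenVTOn U a → B.SmoothGenVTOn U (fun m => J m (a m))
  isGenComplex : ∀ m, IsGenComplexLinear (J m)
  adapted : ∀ m, (B.genV m).map (J m) = B.genT m

variable {B}

/-- The semi-flat generalized almost complex structure `F⁻¹ ∘ p^* J ∘ F` on `Z`. -/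
def AdaptedGACS.semiFlat (J : B.AdaptedGACS) (z : Z) : GenTangent F z →ₗ[ℝ] GenTangent F z :=
  B.fromBase z ∘ₗ J.J (B.proj z) ∘ₗ B.toBase z

/-- The section `J (σ + θ)` of `T_M ⊕ T_M^∨`, for a section `σ + θ` of `V ⊕ V^∨`. -/
def AdaptedGACS.image (J : B.AdaptedGACS) (σ : ∀ m, B.V m) (θ : ∀ m, B.V m →L[ℝ] ℝ) (m : M) :
    GenTangent E m :=
  B.toT m (J.J m (B.ofV m (σ m) (θ m)))

/-- `[J (𝓢 ⊕ 𝓢^∨), J (𝓢 ⊕ 𝓢^∨)] = 0`: over every open set, all Courant brackets of images under `J`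
of sections of `𝓢 ⊕ 𝓢^∨` vanish. -/
def AdaptedGACS.BracketsVanish (J : B.AdaptedGACS) : Prop :=
  ∀ U : Set M, IsOpen U →
    ∀ (σ σ' : ∀ m, B.V m) (θ θ' : ∀ m, B.V m →L[ℝ] ℝ),
      B.IsFlatOn U σ → B.IsFlatDualOn U θ → B.IsFlatOn U σ' → B.IsFlatDualOn U θ' →
        ∀ m ∈ U, courantBracket (J.image σ θ) (J.image σ' θ') m = 0

end TorusBundle

end

/-! Over a chart of `M` inside a trivializing open set, `Z` is locally the vector space `E × ℝⁿ`.
The Gauss–Manin splitting becomes the product splitting, and the semi-flat structure becomes a field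
`coordJ` of endomorphisms depending only on the base coordinate. Put `S = ℝⁿ ⊕ (ℝⁿ)^∨`, let `ι` be
its inclusion as the vertical part, and let `K = coordK` be the restriction of `coordJ` to it.
Adaptedness says that `K` maps `S` onto the horizontal part `E ⊕ E^∨`. Hence the `+i`-eigenbundle
`L` is the graph of `-iK` over the complexification of `S`.

For constant `c`, `d` in `S`, the brackets of `ι c` with `ι d` and with `K d` vanish: a constant
vertical field or form does not see objects pulled back from the base. So `[ι c - iK c, ι d - iK d]
= -[K c, K d]`, a real horizontal section. Since `J² = -1`, the only real vector in `L` is `0`, and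
integrability forces `[K c, K d] = 0`. Conversely, `L` is isotropic, so the Leibniz terms for
varying coefficients stay in `L`; the bracket of two sections of `L` is then a section of `L` minus
a combination of the brackets `[K c, K d]`. This is `jetBracket_eigen`, transferred to sections by
`exists_bracket_eq`.

Three facts link this model to the geometry. The Courant bracket is natural under local
diffeomorphisms (`pullGen_courantBracket`). Changes of trivialization are locally constant linear
maps in the fibre (`exists_transition`), so that flat sections are exactly those with locally
constant components, and the splitting can be computed in any trivialization. Finally, `K c` is the
pullback of the section `J c` of `T_M ⊕ T_M^∨` (`coordK_eq`), so that `[K c, K d]` is the bracket on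
`M` occurring in the theorem (`jetBracket_coordK`). -/

noncomputable section

/-! ### Local diffeomorphisms and smoothness of sections -/

section LocalDiffeo

variable {EX : Type*} [NormedAddCommGroup EX] [NormedSpace ℝ EX]
  {X : Type*} [TopologicalSpace X] {HX : Type*} [TopologicalSpace HX] [ChartedSpace HX X]
  {IX : ModelWithCorners ℝ EX HX}
  {EY : Type*} [NormedAddCommGroup EY] [NormedSpace ℝ EY]
  {Y : Type*} [TopologicalSpace Y] {HY : Type*} [TopologicalSpace HY] [ChartedSpace HY Y]
  {IY : ModelWithCorners ℝ EY HY}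

lemma IsLocalDiffeomorphAt.exists_isOpen {f : X → Y} {x : X}
    (hf : IsLocalDiffeomorphAt IX IY ∞ f x) :
    ∃ s, IsOpen s ∧ x ∈ s ∧ ∀ y ∈ s, IsLocalDiffeomorphAt IX IY ∞ f y := by
  obtain ⟨Φ, hx, he⟩ := hf
  exact ⟨Φ.source, Φ.open_source, hx, fun y hy => ⟨Φ, hy, he⟩⟩

lemma IsLocalDiffeomorphAt.eventually {f : X → Y} {x : X}
    (hf : IsLocalDiffeomorphAt IX IY ∞ f x) :
    ∀ᶠ y in 𝓝 x, IsLocalDiffeomorphAt IX IY ∞ f y := by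
  obtain ⟨s, hs, hx, h⟩ := hf.exists_isOpen
  filter_upwards [hs.mem_nhds hx] with y hy using h y hy

lemma IsLocalDiffeomorphAt.isInvertible {f : X → Y} {x : X}
    (hf : IsLocalDiffeomorphAt IX IY ∞ f x) : (mfderiv IX IY f x).IsInvertible :=
  ⟨hf.mfderivToContinuousLinearEquiv (by simp), rfl⟩

lemma IsLocalDiffeomorphAt.eventually_localInverse_mem {f : X → Y} {x : X}
    (hf : IsLocalDiffeomorphAt IX IY ∞ f x) {p : X → Prop} (hp : ∀ᶠ y in 𝓝 x, p y) :
    ∀ᶠ z in 𝓝 (f x), f (hf.localInverse z) = z ∧ p (hf.localInverse z) := by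
  have h1 := hf.localInverse_eventuallyEq_right
  have h2 : ContinuousAt hf.localInverse (f x) := hf.localInverse_contMDiffAt.continuousAt
  have h3 : hf.localInverse (f x) = x := hf.localInverse_left_inv hf.localInverse_mem_target
  have h4 : Filter.Tendsto hf.localInverse (𝓝 (f x)) (𝓝 x) := by
    have := h2.tendsto
    rwa [h3] at this
  filter_upwards [h1, h4.eventually hp] with z hz hz' using ⟨hz, hz'⟩

variable [IsManifold IX 1 X] [IsManifold IY 1 Y]

lemma contMDiffAt_tangentMap {f : X → Y} {s : Set X} (hs : IsOpen s)
    (hf : ContMDiffOn IX IY ∞ f s) {p : TangentBundle IX X} (hp : p.1 ∈ s) :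
    ContMDiffAt IX.tangent IY.tangent ∞ (tangentMap IX IY f) p := by
  have h := hf.contMDiffOn_tangentMapWithin (m := ∞) (by simp) hs.uniqueMDiffOn
  have hn : (TotalSpace.proj ⁻¹' s : Set (TangentBundle IX X)) ∈ 𝓝 p :=
    (hs.preimage (FiberBundle.continuous_proj EX (TangentSpace IX))).mem_nhds hp
  refine (h.contMDiffAt hn).congr_of_eventuallyEq ?_
  filter_upwards [hn] with q hq
  rw [tangentMapWithin_eq_tangentMap (hs.uniqueMDiffOn _ hq)]
  exact ((hf _ hq).mdifferentiableWithinAt (by simp)).mdifferentiableAt (hs.mem_nhds hq)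

lemma IsLocalDiffeomorphAt.contMDiffAt_tangentMap {f : X → Y} {p : TangentBundle IX X}
    (hf : IsLocalDiffeomorphAt IX IY ∞ f p.1) :
    ContMDiffAt IX.tangent IY.tangent ∞ (tangentMap IX IY f) p := by
  obtain ⟨s, hs, hx, h⟩ := hf.exists_isOpen
  exact _root_.contMDiffAt_tangentMap hs (fun y hy => (h y hy).contMDiffAt.contMDiffWithinAt) hx

end LocalDiffeo

section Sections

variable {G : Type*} [NormedAddCommGroup G] [NormedSpace ℝ G]
  {F : Type*} [NormedAddCommGroup F] [NormedSpace ℝ F]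
  {N : Type*} [TopologicalSpace N] [ChartedSpace F N] [IsManifold 𝓘(ℝ, F) ∞ N]

instance isManifold_one_of_infty : IsManifold 𝓘(ℝ, F) 1 N := IsManifold.of_le (n := ∞) (by simp)

/-- Smoothness at a point of a section of `T_N ⊕ T_N^∨`. -/
def SmoothGenSectionAt (a : ∀ x : N, GenTangent F x) (x : N) : Prop :=
  ContMDiffAt 𝓘(ℝ, F) 𝓘(ℝ, F).tangent ∞
    (fun x => (⟨x, (a x).1⟩ : TangentBundle 𝓘(ℝ, F) N)) x ∧
  ContMDiffAt 𝓘(ℝ, F) (𝓘(ℝ, F).prod 𝓘(ℝ, F →L[ℝ] ℝ)) ∞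
    (fun x => (⟨x, (a x).2⟩ : TotalSpace (F →L[ℝ] ℝ)
      (fun x : N => TangentSpace 𝓘(ℝ, F) x →L[ℝ] Trivial N ℝ x))) x

lemma SmoothGenSectionOn.at {U : Set N} {a : ∀ x : N, GenTangent F x}
    (h : SmoothGenSectionOn U a) (hU : IsOpen U) {x : N} (hx : x ∈ U) : SmoothGenSectionAt a x :=
  ⟨h.1.contMDiffAt (hU.mem_nhds hx), h.2.contMDiffAt (hU.mem_nhds hx)⟩

lemma smoothGenSectionOn_of_forall {U : Set N} {a : ∀ x : N, GenTangent F x}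
    (h : ∀ x ∈ U, SmoothGenSectionAt a x) : SmoothGenSectionOn U a :=
  ⟨fun x hx => (h x hx).1.contMDiffWithinAt, fun x hx => (h x hx).2.contMDiffWithinAt⟩

/-- The pullback of a section of `T_N ⊕ T_N^∨` along a local diffeomorphism from a vector space. -/
def pullGen (f : G → N) (a : ∀ z : N, GenTangent F z) (x : G) : G × (G →L[ℝ] ℝ) :=
  ((mfderiv 𝓘(ℝ, G) 𝓘(ℝ, F) f x).inverse (a (f x)).1,
    (a (f x)).2.comp (mfderiv 𝓘(ℝ, G) 𝓘(ℝ, F) f x))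

lemma contMDiffAt_tangent_const (w : G) (x : G) :
    ContMDiffAt 𝓘(ℝ, G) 𝓘(ℝ, G).tangent ∞ (fun x : G => (⟨x, w⟩ : TangentBundle 𝓘(ℝ, G) G)) x :=
  contMDiffAt_vectorSpace_iff_contDiffAt.2 contDiffAt_const

omit [IsManifold 𝓘(ℝ, F) ∞ N] in
lemma contMDiffAt_trivial_snd {E' : Type*} [NormedAddCommGroup E'] [NormedSpace ℝ E']
    {P : Type*} [TopologicalSpace P] [ChartedSpace E' P] {b : P → N} {g : P → ℝ} {x : P}
    (h : ContMDiffAt 𝓘(ℝ, E') (𝓘(ℝ, F).prod 𝓘(ℝ, ℝ)) ∞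
      (fun x => TotalSpace.mk' ℝ (E := Trivial N ℝ) (b x) (g x)) x) :
    ContMDiffAt 𝓘(ℝ, E') 𝓘(ℝ, ℝ) ∞ g x :=
  (contMDiffAt_totalSpace.1 h).2

/-- The value of a smooth one-form on a smooth vector field along a map is smooth. -/
lemma SmoothGenSectionAt.contMDiffAt_apply {a : ∀ z : N, GenTangent F z}
    {E' : Type*} [NormedAddCommGroup E'] [NormedSpace ℝ E']
    {P : Type*} [TopologicalSpace P] [ChartedSpace E' P] {b : P → N}
    {v : ∀ x, TangentSpace 𝓘(ℝ, F) (b x)} {x : P} (ha : SmoothGenSectionAt a (b x))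
    (hv : ContMDiffAt 𝓘(ℝ, E') 𝓘(ℝ, F).tangent ∞
      (fun x => (⟨b x, v x⟩ : TangentBundle 𝓘(ℝ, F) N)) x) :
    ContMDiffAt 𝓘(ℝ, E') 𝓘(ℝ, ℝ) ∞ (fun x => (a (b x)).2 (v x)) x := by
  have hb : ContMDiffAt 𝓘(ℝ, E') 𝓘(ℝ, F) ∞ b x := (contMDiffAt_totalSpace.1 hv).1
  have h2 := ha.2.comp x hb
  exact contMDiffAt_trivial_snd (ContMDiffAt.clm_bundle_apply (F₁ := F) (F₂ := ℝ)
    (E₁ := fun x : N => TangentSpace 𝓘(ℝ, F) x) (E₂ := Trivial N ℝ) h2 hv)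

variable [FiniteDimensional ℝ G] [FiniteDimensional ℝ F]

/-- In finite dimension the space of linear maps is a finite product of copies of the target, by
evaluation on a basis; smoothness of forms and of `coordK` is thus tested one vector at a time. -/
lemma contMDiffAt_clm_of_apply {F' : Type*} [NormedAddCommGroup F'] [NormedSpace ℝ F']
    {EP : Type*} [NormedAddCommGroup EP] [NormedSpace ℝ EP]
    {P : Type*} [TopologicalSpace P] [ChartedSpace EP P] {f : P → G →L[ℝ] F'} {x : P}
    (h : ∀ w, ContMDiffAt 𝓘(ℝ, EP) 𝓘(ℝ, F') ∞ (fun y => f y w) x) :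
    ContMDiffAt 𝓘(ℝ, EP) 𝓘(ℝ, G →L[ℝ] F') ∞ f x := by
  let d := Module.finrank ℝ G
  let e₁ : G ≃L[ℝ] Fin d → ℝ := ContinuousLinearEquiv.ofFinrankEq (by simp [d])
  let e₂ := (e₁.arrowCongr (1 : F' ≃L[ℝ] F')).trans
    (ContinuousLinearEquiv.piRing (𝕜 := ℝ) (E := F') (Fin d))
  have h' : ContMDiffAt 𝓘(ℝ, EP) 𝓘(ℝ, Fin d → F') ∞ (fun y => e₂ (f y)) x :=
    contMDiffAt_pi_space.2 fun i => h _
  have h2 : ContMDiffAt 𝓘(ℝ, EP) 𝓘(ℝ, G →L[ℝ] F') ∞ (fun y => e₂.symm (e₂ (f y))) x :=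
    e₂.symm.contDiff.contMDiff.contMDiffAt.comp x h'
  simpa using h2

lemma contDiffAt_clm_of_apply {F' : Type*} [NormedAddCommGroup F'] [NormedSpace ℝ F']
    {D : Type*} [NormedAddCommGroup D] [NormedSpace ℝ D] {f : D → G →L[ℝ] F'} {x : D}
    (h : ∀ w, ContDiffAt ℝ ∞ (fun y => f y w) x) : ContDiffAt ℝ ∞ f x :=
  (contMDiffAt_clm_of_apply fun w => (h w).contMDiffAt).contDiffAt

omit [FiniteDimensional ℝ F] in
lemma contDiffAt_pullGen {f : G → N} {x : G}
    (hf : IsLocalDiffeomorphAt 𝓘(ℝ, G) 𝓘(ℝ, F) ∞ f x) {a : ∀ z : N, GenTangent F z}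
    (ha : SmoothGenSectionAt a (f x)) : ContDiffAt ℝ ∞ (pullGen f a) x := by
  refine ContDiffAt.prodMk ?_ ?_
  · exact contMDiffAt_vectorSpace_iff_contDiffAt.1
      (ContMDiffAt.mpullback_vectorField_preimage (I := 𝓘(ℝ, G)) (I' := 𝓘(ℝ, F)) (n := ∞) (m := ∞)
        (V := fun z => (a z).1) ha.1 hf.contMDiffAt hf.isInvertible (by simp))
  · refine contDiffAt_clm_of_apply fun w => ?_
    have h1 : ContMDiffAt 𝓘(ℝ, G) 𝓘(ℝ, F).tangent ∞
        (fun x : G => tangentMap 𝓘(ℝ, G) 𝓘(ℝ, F) f ⟨x, w⟩) x :=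
      ContMDiffAt.comp x (hf.contMDiffAt_tangentMap (p := ⟨x, w⟩)) (contMDiffAt_tangent_const w x)
    exact (ha.contMDiffAt_apply (b := f) h1).contDiffAt

-- Working in the total space instead of with derivatives at a point avoids transporting tangent
-- vectors along `f (f⁻¹ z) = z`.
omit [FiniteDimensional ℝ G] [FiniteDimensional ℝ F] [IsManifold 𝓘(ℝ, F) ∞ N] in
lemma IsLocalDiffeomorphAt.tangentMap_tangentMap_localInverse {f : G → N} {x : G}
    (hf : IsLocalDiffeomorphAt 𝓘(ℝ, G) 𝓘(ℝ, F) ∞ f x) {p : TangentBundle 𝓘(ℝ, F) N}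
    (hp : p.1 ∈ hf.localInverse.source) :
    tangentMap 𝓘(ℝ, G) 𝓘(ℝ, F) f (tangentMap 𝓘(ℝ, F) 𝓘(ℝ, G) hf.localInverse p) = p := by
  have hn : hf.localInverse.source ∈ 𝓝 p.1 := hf.localInverse.open_source.mem_nhds hp
  have h1 : MDifferentiableAt 𝓘(ℝ, F) 𝓘(ℝ, G) hf.localInverse p.1 :=
    (hf.localInverse_contMDiffOn.contMDiffAt hn).mdifferentiableAt (by simp)
  have h2 : MDifferentiableAt 𝓘(ℝ, G) 𝓘(ℝ, F) f (hf.localInverse p.1) := by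
    have : IsLocalDiffeomorphAt 𝓘(ℝ, G) 𝓘(ℝ, F) ∞ f (hf.localInverse p.1) :=
      ⟨_, (Classical.choose hf).symm.map_source hp, (Classical.choose_spec hf).2⟩
    exact this.mdifferentiableAt (by simp)
  rw [← tangentMap_comp_at p h2 h1]
  have h3 : (f ∘ hf.localInverse) =ᶠ[𝓝 p.1] id := by
    filter_upwards [hn] with z hz using hf.localInverse_right_inv hz
  have h4 := h3.mfderiv_eq (I := 𝓘(ℝ, F)) (I' := 𝓘(ℝ, F))
  obtain ⟨z, v⟩ := p
  have h5 : (f ∘ hf.localInverse) z = z := h3.self_of_nhds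
  refine Bundle.TotalSpace.ext h5 ?_
  refine heq_of_eq ?_
  change mfderiv 𝓘(ℝ, F) 𝓘(ℝ, F) (f ∘ hf.localInverse) z v = v
  rw [h4, mfderiv_id]
  rfl

-- Converse of `contDiffAt_pullGen`: the section is recovered by pushing its pullback forward along
-- the local inverse. It serves to build smooth sections on `Z` from coordinate formulas.
omit [FiniteDimensional ℝ G] in
lemma smoothGenSectionAt_of_contDiffAt_pullGen {f : G → N} {x : G}
    (hf : IsLocalDiffeomorphAt 𝓘(ℝ, G) 𝓘(ℝ, F) ∞ f x) {a : ∀ z : N, GenTangent F z}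
    (ha : ContDiffAt ℝ ∞ (pullGen f a) x) : SmoothGenSectionAt a (f x) := by
  have hx : hf.localInverse (f x) = x := hf.localInverse_left_inv hf.localInverse_mem_target
  have hP : ContMDiffAt 𝓘(ℝ, F) 𝓘(ℝ, G × (G →L[ℝ] ℝ)) ∞
      (fun z => pullGen f a (hf.localInverse z)) (f x) := by
    refine ContMDiffAt.comp (I' := 𝓘(ℝ, G)) (g := pullGen f a) (f x) ?_ hf.localInverse_contMDiffAt
    rw [hx]; exact ha.contMDiffAt
  have hev := hf.eventually_localInverse_mem hf.eventually
  have hsrc := hf.localInverse.open_source.mem_nhds hf.localInverse_mem_source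
  constructor
  · have h1 : ContMDiffAt 𝓘(ℝ, F) 𝓘(ℝ, G).tangent ∞
        (fun z => (⟨hf.localInverse z, (pullGen f a (hf.localInverse z)).1⟩ :
          TangentBundle 𝓘(ℝ, G) G)) (f x) := by
      have : ContMDiffAt 𝓘(ℝ, G) 𝓘(ℝ, G).tangent ∞
        (fun y => (⟨y, (pullGen f a y).1⟩ : TangentBundle 𝓘(ℝ, G) G)) (hf.localInverse (f x)) := by
        rw [hx]
        exact contMDiffAt_vectorSpace_iff_contDiffAt.2 ha.fst
      exact ContMDiffAt.comp (f x) this hf.localInverse_contMDiffAt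
    have h2 : ContMDiffAt 𝓘(ℝ, G).tangent 𝓘(ℝ, F).tangent ∞ (tangentMap 𝓘(ℝ, G) 𝓘(ℝ, F) f)
        (⟨hf.localInverse (f x), (pullGen f a (hf.localInverse (f x))).1⟩ :
          TangentBundle 𝓘(ℝ, G) G) := by
      refine IsLocalDiffeomorphAt.contMDiffAt_tangentMap ?_
      change IsLocalDiffeomorphAt 𝓘(ℝ, G) 𝓘(ℝ, F) ∞ f (hf.localInverse (f x))
      rwa [hx]
    refine (ContMDiffAt.comp (f x) h2 h1).congr_of_eventuallyEq ?_
    filter_upwards [hev] with z hz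
    obtain ⟨hz1, hz2⟩ := hz
    refine Bundle.TotalSpace.ext hz1.symm ?_
    change HEq (a z).1 (mfderiv 𝓘(ℝ, G) 𝓘(ℝ, F) f (hf.localInverse z)
      ((mfderiv 𝓘(ℝ, G) 𝓘(ℝ, F) f (hf.localInverse z)).inverse (a (f (hf.localInverse z))).1))
    rw [hz2.isInvertible.self_apply_inverse]
    rw [hz1]
  · refine (contMDiffAt_hom_bundle _).2 ⟨contMDiffAt_id, ?_⟩
    refine contMDiffAt_clm_of_apply fun w => ?_
    let e := trivializationAt F (TangentSpace 𝓘(ℝ, F) : N → Type _) (f x)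
    have hbase : e.baseSet ∈ 𝓝 (f x) :=
      e.open_baseSet.mem_nhds (mem_baseSet_trivializationAt _ _ _)
    -- The form is tested against the local frame field with constant component `w` in the
    -- trivialization of the tangent bundle at `f x`.
    have hv : ContMDiffAt 𝓘(ℝ, F) 𝓘(ℝ, F).tangent ∞
        (fun z => (⟨z, e.symm z w⟩ : TangentBundle 𝓘(ℝ, F) N)) (f x) := by
      have h1 : ContMDiffAt (𝓘(ℝ, F).prod 𝓘(ℝ, F)) (𝓘(ℝ, F).prod 𝓘(ℝ, F)) ∞
          e.toOpenPartialHomeomorph.symm (f x, w) :=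
        e.contMDiffOn_symm.contMDiffAt (e.open_target.mem_nhds
          (e.mem_target.2 (mem_baseSet_trivializationAt _ _ _)))
      have h2 := ContMDiffAt.comp (f x) h1
        (contMDiffAt_id.prodMk (contMDiffAt_const (I := 𝓘(ℝ, F)) (c := w)))
      refine h2.congr_of_eventuallyEq ?_
      filter_upwards [hbase] with z hz
      exact e.mk_symm hz w
    have hd : ContMDiffAt 𝓘(ℝ, F) 𝓘(ℝ, G) ∞
        (fun z => (tangentMap 𝓘(ℝ, F) 𝓘(ℝ, G) hf.localInverse ⟨z, e.symm z w⟩).2) (f x) := by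
      have h1 := ContMDiffAt.comp (f x) (hf.localInverse_isLocalDiffeomorphAt.contMDiffAt_tangentMap
        (p := ⟨f x, e.symm (f x) w⟩)) hv
      exact (contMDiff_snd_tangentBundle_modelSpace G 𝓘(ℝ, G)).contMDiffAt.comp (f x) h1
    have h3 : ContMDiffAt 𝓘(ℝ, F) 𝓘(ℝ, ℝ) ∞ (fun z => (pullGen f a (hf.localInverse z)).2
        (tangentMap 𝓘(ℝ, F) 𝓘(ℝ, G) hf.localInverse ⟨z, e.symm z w⟩).2) (f x) :=
      (contDiff_snd.contMDiff.contMDiffAt.comp (f x) hP).clm_apply hd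
    refine h3.congr_of_eventuallyEq ?_
    filter_upwards [hbase, hsrc] with z hz hz2
    have h4 := hf.tangentMap_tangentMap_localInverse (p := ⟨z, e.symm z w⟩) hz2
    have h5 := congrArg (fun p : TangentBundle 𝓘(ℝ, F) N => (a p.1).2 p.2) h4
    rw [ContinuousLinearMap.inCoordinates_eq hz (by simp)]
    refine Eq.trans ?_ h5.symm
    simp
    rfl

end Sections

/-! ### Naturality of the Courant bracket -/

section JetBracket

variable {G : Type*} [NormedAddCommGroup G] [NormedSpace ℝ G]

/-- The Courant bracket on a vector space, as a function of the values `h`, `h'` and the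
derivatives `A`, `A'` of the two sections. -/
def jetBracket (h h' : G × (G →L[ℝ] ℝ)) (A A' : G →L[ℝ] G × (G →L[ℝ] ℝ)) : G × (G →L[ℝ] ℝ) :=
  ((A' h.1).1 - (A h'.1).1,
    (A' h.1).2 - (A h'.1).2 + (1 / 2 : ℝ) •
      (((ContinuousLinearMap.snd ℝ _ _).comp A).flip h'.1
        + h'.2.comp ((ContinuousLinearMap.fst ℝ _ _).comp A)
        - h.2.comp ((ContinuousLinearMap.fst ℝ _ _).comp A')
        - ((ContinuousLinearMap.snd ℝ _ _).comp A').flip h.1))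

lemma jetBracket_snd_apply (h h' : G × (G →L[ℝ] ℝ)) (A A' : G →L[ℝ] G × (G →L[ℝ] ℝ)) (w : G) :
    (jetBracket h h' A A').2 w = (A' h.1).2 w - (A h'.1).2 w + (1 / 2 : ℝ) *
      ((A w).2 h'.1 + h'.2 (A w).1 - h.2 (A' w).1 - (A' w).2 h.1) := rfl

end JetBracket

section Naturality

lemma two_le_infty : minSmoothness ℝ 2 ≤ (∞ : WithTop ℕ∞) := by
  rw [minSmoothness_of_isRCLikeNormedField]
  exact WithTop.coe_le_coe.2 (le_top : (2 : ℕ∞) ≤ ⊤)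

variable {G : Type*} [NormedAddCommGroup G] [NormedSpace ℝ G]
  {F : Type*} [NormedAddCommGroup F] [NormedSpace ℝ F]
  {N : Type*} [TopologicalSpace N] [ChartedSpace F N] [IsManifold 𝓘(ℝ, F) ∞ N]

lemma isLocalDiffeomorphAt_extChartAt_symm {z : N} {u : F} (hu : u ∈ (extChartAt 𝓘(ℝ, F) z).target) :
    IsLocalDiffeomorphAt 𝓘(ℝ, F) 𝓘(ℝ, F) ∞ (extChartAt 𝓘(ℝ, F) z).symm u :=
  ⟨{ toPartialEquiv := (extChartAt 𝓘(ℝ, F) z).symm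
     open_source := isOpen_extChartAt_target z
     open_target := isOpen_extChartAt_source z
     contMDiffOn_toFun := contMDiffOn_extChartAt_symm z
     contMDiffOn_invFun := by
      simpa [extChartAt_source] using contMDiffOn_extChartAt (I := 𝓘(ℝ, F)) (x := z) (n := ∞) },
    hu, fun _ _ => rfl⟩

omit [IsManifold 𝓘(ℝ, F) ∞ N] in
lemma mfderiv_pullGen_fst {f : G → N} {x : G}
    (hf : IsLocalDiffeomorphAt 𝓘(ℝ, G) 𝓘(ℝ, F) ∞ f x) (a : ∀ z : N, GenTangent F z) :
    mfderiv 𝓘(ℝ, G) 𝓘(ℝ, F) f x (pullGen f a x).1 = (a (f x)).1 :=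
  hf.isInvertible.self_apply_inverse _

omit [IsManifold 𝓘(ℝ, F) ∞ N] in
lemma pullGen_snd_apply_fst {f : G → N} {x : G}
    (hf : IsLocalDiffeomorphAt 𝓘(ℝ, G) 𝓘(ℝ, F) ∞ f x) (a b : ∀ z : N, GenTangent F z) :
    (pullGen f b x).2 (pullGen f a x).1 = (b (f x)).2 (a (f x)).1 :=
  congrArg (b (f x)).2 (mfderiv_pullGen_fst hf a)

-- The differential is invertible, so identities between values of sections on the manifold may be
-- checked after pulling back.
omit [IsManifold 𝓘(ℝ, F) ∞ N] in
lemma pullGen_injective {f : G → N} {x : G}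
    (hf : IsLocalDiffeomorphAt 𝓘(ℝ, G) 𝓘(ℝ, F) ∞ f x) {a b : ∀ z : N, GenTangent F z}
    (h : pullGen f a x = pullGen f b x) : a (f x) = b (f x) := by
  refine Prod.ext ?_ ?_
  · rw [← mfderiv_pullGen_fst hf a, ← mfderiv_pullGen_fst hf b, h]
  · ext w
    obtain ⟨e, he⟩ := hf.isInvertible
    have h1 := congrArg (fun p : G × (G →L[ℝ] ℝ) => p.2 (e.symm w)) h
    have h2 : mfderiv 𝓘(ℝ, G) 𝓘(ℝ, F) f x (e.symm w) = w := by
      rw [← he]; exact e.apply_symm_apply w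
    have h3 : ∀ c : ∀ z : N, GenTangent F z, (pullGen f c x).2 (e.symm w) = (c (f x)).2 w :=
      fun c => congrArg (c (f x)).2 h2
    exact (h3 a).symm.trans (h1.trans (h3 b))

variable [FiniteDimensional ℝ G] [FiniteDimensional ℝ F]

omit [FiniteDimensional ℝ F] in
lemma pullGen_mlieBracket {f : G → N} {x : G}
    (hf : IsLocalDiffeomorphAt 𝓘(ℝ, G) 𝓘(ℝ, F) ∞ f x) {a b : ∀ z : N, GenTangent F z}
    (ha : SmoothGenSectionAt a (f x)) (hb : SmoothGenSectionAt b (f x)) :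
    (pullGen f (courantBracket a b) x).1 =
      (fderiv ℝ (pullGen f b) x (pullGen f a x).1).1
        - (fderiv ℝ (pullGen f a) x (pullGen f b x).1).1 := by
  have hM : IsManifold 𝓘(ℝ, F) (minSmoothness ℝ 2) N :=
    IsManifold.of_le (n := ∞) two_le_infty
  have h1 := VectorField.mpullback_mlieBracket (I := 𝓘(ℝ, G)) (I' := 𝓘(ℝ, F)) (n := ∞)
    (f := f) (x₀ := x) (V := fun z => (a z).1) (W := fun z => (b z).1)
    (ha.1.mdifferentiableAt (by simp)) (hb.1.mdifferentiableAt (by simp)) hf.contMDiffAt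
    two_le_infty
  have h2 : ∀ c : ∀ z : N, GenTangent F z, SmoothGenSectionAt c (f x) → ∀ v : G,
      fderiv ℝ (fun y => (pullGen f c y).1) x v = (fderiv ℝ (pullGen f c) x v).1 := by
    intro c hc v
    rw [fderiv.fst ((contDiffAt_pullGen hf hc).differentiableAt (by simp))]
    rfl
  rw [← h2 a ha, ← h2 b hb]
  refine Eq.trans h1 ?_
  rw [← VectorField.mlieBracketWithin_univ, VectorField.mlieBracketWithin_eq_lieBracketWithin]
  change VectorField.lieBracketWithin ℝ (fun y => (pullGen f a y).1 : G → G)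
    (fun y => (pullGen f b y).1 : G → G) univ x = _
  rw [VectorField.lieBracketWithin_univ]
  rfl

omit [FiniteDimensional ℝ F] in
lemma dFun_apply_mfderiv {f : G → N} {x : G}
    (hf : IsLocalDiffeomorphAt 𝓘(ℝ, G) 𝓘(ℝ, F) ∞ f x) {a b : ∀ z : N, GenTangent F z}
    (ha : SmoothGenSectionAt a (f x)) (hb : SmoothGenSectionAt b (f x)) (w : G) :
    dFun (fun z => (b z).2 (a z).1) (f x) (mfderiv 𝓘(ℝ, G) 𝓘(ℝ, F) f x w) =
      (fderiv ℝ (pullGen f b) x w).2 (pullGen f a x).1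
        + (pullGen f b x).2 (fderiv ℝ (pullGen f a) x w).1 := by
  have hg : MDifferentiableAt 𝓘(ℝ, F) 𝓘(ℝ, ℝ) (fun z => (b z).2 (a z).1) (f x) :=
    (SmoothGenSectionAt.contMDiffAt_apply (b := fun z : N => z) (x := f x) hb
      ha.1).mdifferentiableAt (by simp)
  have hc := mfderiv_comp x hg (hf.mdifferentiableAt (by simp))
  have hPa := (contDiffAt_pullGen hf ha).differentiableAt (by simp)
  have hPb := (contDiffAt_pullGen hf hb).differentiableAt (by simp)
  have he : ((fun z => (b z).2 (a z).1) ∘ f) =ᶠ[𝓝 x]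
      fun y => (pullGen f b y).2 (pullGen f a y).1 := by
    filter_upwards [hf.eventually] with y hy using (pullGen_snd_apply_fst hy a b).symm
  have h1 : dFun (fun z => (b z).2 (a z).1) (f x) (mfderiv 𝓘(ℝ, G) 𝓘(ℝ, F) f x w) =
      mfderiv 𝓘(ℝ, G) 𝓘(ℝ, ℝ) ((fun z => (b z).2 (a z).1) ∘ f) x w := by
    rw [hc]; rfl
  rw [h1, he.mfderiv_eq, mfderiv_eq_fderiv, fderiv_clm_apply hPb.snd hPa.fst, fderiv.fst hPa,
    fderiv.snd hPb]
  exact add_comm _ _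

/-- Independence of `dη` of the chart. Differentiating the pulled-back form produces an extra term
containing the second derivative of the coordinate change `κ`; it is symmetric and disappears on
antisymmetrizing. -/
lemma contractExtDeriv_apply_mfderiv {f : G → N} {x : G}
    (hf : IsLocalDiffeomorphAt 𝓘(ℝ, G) 𝓘(ℝ, F) ∞ f x) {a b : ∀ z : N, GenTangent F z}
    (hb : SmoothGenSectionAt b (f x)) (w : G) :
    contractExtDeriv (fun z => (a z).1) (fun z => (b z).2) (f x)
        (mfderiv 𝓘(ℝ, G) 𝓘(ℝ, F) f x w) =
      (fderiv ℝ (pullGen f b) x (pullGen f a x).1).2 w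
        - (fderiv ℝ (pullGen f b) x w).2 (pullGen f a x).1 := by
  set χ := extChartAt 𝓘(ℝ, F) (f x) with hχ
  let κ : G → F := fun y => χ (f y)
  have hmem : f x ∈ χ.source := mem_extChartAt_source (f x)
  have hχx : χ.symm (κ x) = f x := χ.left_inv hmem
  have hχd : ContMDiffAt 𝓘(ℝ, F) 𝓘(ℝ, F) ∞ χ (f x) := contMDiffAt_extChartAt
  have hκ : ContDiffAt ℝ ∞ κ x := (hχd.comp x hf.contMDiffAt).contDiffAt
  have hβ : ContDiffAt ℝ ∞ (oneFormInChart (fun z => (b z).2) (f x)) (κ x) :=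
    (contDiffAt_pullGen (f := χ.symm) (a := b)
      (isLocalDiffeomorphAt_extChartAt_symm (χ.map_source hmem)) (by rwa [hχx])).snd
  have hfcont : ContinuousAt f x := hf.contMDiffAt.continuousAt
  -- The pullback along `f` is the chart expression of the form pulled back along `κ`, since `f =
  -- χ⁻¹ ∘ κ` nearby.
  have hev : (fun y => (pullGen f b y).2) =ᶠ[𝓝 x]
      fun y => (oneFormInChart (fun z => (b z).2) (f x) (κ y)).comp (fderiv ℝ κ y) := by
    filter_upwards [hf.eventually, hfcont.preimage_mem_nhds (extChartAt_source_mem_nhds (I := 𝓘(ℝ, F)) (f x))]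
      with y hy hys
    have hκy : MDifferentiableAt 𝓘(ℝ, G) 𝓘(ℝ, F) κ y :=
      (ContMDiffAt.comp (I' := 𝓘(ℝ, F)) y
        (contMDiffAt_extChartAt' (by simpa [extChartAt_source] using hys))
        hy.contMDiffAt).mdifferentiableAt (n := ∞) (by simp)
    have hsy : MDifferentiableAt 𝓘(ℝ, F) 𝓘(ℝ, F) χ.symm (κ y) :=
      (isLocalDiffeomorphAt_extChartAt_symm (χ.map_source hys)).mdifferentiableAt (by simp)
    have hcomp : (χ.symm ∘ κ) =ᶠ[𝓝 y] f := by
      have hfy : ContinuousAt f y := hy.contMDiffAt.continuousAt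
      filter_upwards [hfy.preimage_mem_nhds
        (extChartAt_source_mem_nhds' hys)] with y' hy' using χ.left_inv hy'
    ext v
    have h1 : tangentMap 𝓘(ℝ, F) 𝓘(ℝ, F) χ.symm (tangentMap 𝓘(ℝ, G) 𝓘(ℝ, F) κ ⟨y, v⟩) =
        tangentMap 𝓘(ℝ, G) 𝓘(ℝ, F) f ⟨y, v⟩ := by
      rw [← tangentMap_comp_at _ hsy hκy]
      refine Bundle.TotalSpace.ext hcomp.self_of_nhds (heq_of_eq ?_)
      change mfderiv 𝓘(ℝ, G) 𝓘(ℝ, F) (χ.symm ∘ κ) y v = mfderiv 𝓘(ℝ, G) 𝓘(ℝ, F) f y v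
      rw [hcomp.mfderiv_eq]
      rfl
    have h2 := congrArg (fun p : TangentBundle 𝓘(ℝ, F) N => (b p.1).2 p.2) h1
    refine h2.symm.trans ?_
    simp only [tangentMap, mfderiv_eq_fderiv]
    rfl
  have hDκ : DifferentiableAt ℝ (fderiv ℝ κ) x :=
    (hκ.fderiv_right (m := ∞) (by simp)).differentiableAt (by simp)
  have hd : ∀ u v : G, (fderiv ℝ (pullGen f b) x u).2 v =
      fderiv ℝ (oneFormInChart (fun z => (b z).2) (f x)) (κ x) (fderiv ℝ κ x u) (fderiv ℝ κ x v)
        + oneFormInChart (fun z => (b z).2) (f x) (κ x) (fderiv ℝ (fderiv ℝ κ) x u v) := by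
    intro u v
    have hPb := (contDiffAt_pullGen hf hb).differentiableAt (by simp)
    have h1 : (fderiv ℝ (pullGen f b) x u).2 = fderiv ℝ (fun y => (pullGen f b y).2) x u := by
      rw [fderiv.snd hPb]; rfl
    have hβκ : HasFDerivAt (fun y => oneFormInChart (fun z => (b z).2) (f x) (κ y))
        ((fderiv ℝ (oneFormInChart (fun z => (b z).2) (f x)) (κ x)).comp (fderiv ℝ κ x)) x :=
      (hβ.differentiableAt (by simp)).hasFDerivAt.comp x
        (hκ.differentiableAt (by simp)).hasFDerivAt
    rw [h1, hev.fderiv_eq, (hβκ.clm_comp hDκ.hasFDerivAt).fderiv]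
    simp [add_comm]
  have hsymm : ∀ u v : G, fderiv ℝ (fderiv ℝ κ) x u v = fderiv ℝ (fderiv ℝ κ) x v u :=
    (hκ.isSymmSndFDerivAt two_le_infty)
  have hφ : ∀ v : G, mfderiv 𝓘(ℝ, F) 𝓘(ℝ, F) χ (f x) (mfderiv 𝓘(ℝ, G) 𝓘(ℝ, F) f x v)
      = fderiv ℝ κ x v := by
    intro v
    rw [← mfderiv_eq_fderiv]
    have := mfderiv_comp x (hχd.mdifferentiableAt (by simp)) (hf.mdifferentiableAt (by simp))
    exact (DFunLike.congr_fun this v).symm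
  rw [hd, hd, hsymm _ w]
  have hX : mfderiv 𝓘(ℝ, F) 𝓘(ℝ, F) χ (f x) (a (f x)).1 = fderiv ℝ κ x (pullGen f a x).1 := by
    rw [← hφ]; exact congrArg _ (mfderiv_pullGen_fst hf a).symm
  change (fderiv ℝ (oneFormInChart (fun z => (b z).2) (f x)) (κ x)
      (mfderiv 𝓘(ℝ, F) 𝓘(ℝ, F) χ (f x) (a (f x)).1))
      (mfderiv 𝓘(ℝ, F) 𝓘(ℝ, F) χ (f x) (mfderiv 𝓘(ℝ, G) 𝓘(ℝ, F) f x w)) -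
    (fderiv ℝ (oneFormInChart (fun z => (b z).2) (f x)) (κ x)
      (mfderiv 𝓘(ℝ, F) 𝓘(ℝ, F) χ (f x) (mfderiv 𝓘(ℝ, G) 𝓘(ℝ, F) f x w)))
      (mfderiv 𝓘(ℝ, F) 𝓘(ℝ, F) χ (f x) (a (f x)).1) = _
  rw [hX, hφ]
  abel

/-- Each Lie derivative contributes a full differential of a contraction, and the last term of the
Courant bracket takes half of it away; this leaves the coefficient `1 / 2` in `jetBracket`. -/
lemma pullGen_courantBracket {f : G → N} {x : G}
    (hf : IsLocalDiffeomorphAt 𝓘(ℝ, G) 𝓘(ℝ, F) ∞ f x) {a b : ∀ z : N, GenTangent F z}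
    (ha : SmoothGenSectionAt a (f x)) (hb : SmoothGenSectionAt b (f x)) :
    pullGen f (courantBracket a b) x = jetBracket (pullGen f a x) (pullGen f b x)
      (fderiv ℝ (pullGen f a) x) (fderiv ℝ (pullGen f b) x) := by
  refine Prod.ext (pullGen_mlieBracket hf ha hb) ?_
  ext w
  rw [jetBracket_snd_apply]
  have hd : ∀ c d : ∀ z : N, GenTangent F z, SmoothGenSectionAt c (f x) →
      SmoothGenSectionAt d (f x) →
      MDifferentiableAt 𝓘(ℝ, F) 𝓘(ℝ, ℝ) (fun z => (d z).2 (c z).1) (f x) := fun c d hc hd =>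
    (SmoothGenSectionAt.contMDiffAt_apply (b := fun z : N => z) (x := f x) hd
      hc.1).mdifferentiableAt (by simp)
  have h0 : dFun (fun z => (a z).2 (b z).1 - (b z).2 (a z).1) (f x)
      = dFun (fun z => (a z).2 (b z).1) (f x) - dFun (fun z => (b z).2 (a z).1) (f x) :=
    mfderiv_sub (hd b a hb ha) (hd a b ha hb)
  set v := mfderiv 𝓘(ℝ, G) 𝓘(ℝ, F) f x w with hv
  have h1 := dFun_apply_mfderiv hf ha hb w
  have h2 := dFun_apply_mfderiv hf hb ha w
  have h3 := contractExtDeriv_apply_mfderiv hf (a := a) hb w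
  have h4 := contractExtDeriv_apply_mfderiv hf (a := b) ha w
  rw [← hv] at h1 h2 h3 h4
  change (contractExtDeriv (fun z => (a z).1) (fun z => (b z).2) (f x) v
      + dFun (fun z => (b z).2 (a z).1) (f x) v)
    - (contractExtDeriv (fun z => (b z).1) (fun z => (a z).2) (f x) v
      + dFun (fun z => (a z).2 (b z).1) (f x) v)
    + (1 / 2 : ℝ) * dFun (fun z => (a z).2 (b z).1 - (b z).2 (a z).1) (f x) v = _
  rw [h0]
  change _ + (1 / 2 : ℝ) * (dFun (fun z => (a z).2 (b z).1) (f x) v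
    - dFun (fun z => (b z).2 (a z).1) (f x) v) = _
  rw [h1, h2, h3, h4]
  ring

end Naturality

/-! ### The bracket of sections of the `+i`-eigenbundle on a vector space -/

section GenPairing

variable {W : Type*} [AddCommGroup W] [Module ℝ W] [TopologicalSpace W]

lemma genPairing_comm (a b : W × (W →L[ℝ] ℝ)) : genPairing a b = genPairing b a := by
  simp only [genPairing]; ring

lemma genPairing_add_left (a b c : W × (W →L[ℝ] ℝ)) :
    genPairing (a + b) c = genPairing a c + genPairing b c := by
  simp [genPairing]; ring

lemma genPairing_sub_left (a b c : W × (W →L[ℝ] ℝ)) :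
    genPairing (a - b) c = genPairing a c - genPairing b c := by
  simp [genPairing]; ring

lemma genPairing_add_right (a b c : W × (W →L[ℝ] ℝ)) :
    genPairing a (b + c) = genPairing a b + genPairing a c := by
  simp [genPairing]; ring

lemma genPairing_sub_right (a b c : W × (W →L[ℝ] ℝ)) :
    genPairing a (b - c) = genPairing a b - genPairing a c := by
  simp [genPairing]; ring

lemma genPairing_neg_left (a c : W × (W →L[ℝ] ℝ)) : genPairing (-a) c = -genPairing a c := by
  simp [genPairing]; ring

lemma genPairing_neg_right (a c : W × (W →L[ℝ] ℝ)) : genPairing a (-c) = -genPairing a c := by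
  simp [genPairing]; ring

end GenPairing

section Eigen

variable {G : Type*} [NormedAddCommGroup G] [NormedSpace ℝ G]
  {S : Type*} [NormedAddCommGroup S] [NormedSpace ℝ S]

lemma jetBracket_fst (h h' : G × (G →L[ℝ] ℝ)) (A A' : G →L[ℝ] G × (G →L[ℝ] ℝ)) :
    (jetBracket h h' A A').1 = (A' h.1 - A h'.1).1 := rfl

/-- With the half-terms written as pairings, orthogonality relations can be applied to them
directly. -/
lemma jetBracket_snd_apply' (h h' : G × (G →L[ℝ] ℝ)) (A A' : G →L[ℝ] G × (G →L[ℝ] ℝ)) (w : G) :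
    (jetBracket h h' A A').2 w =
      (A' h.1 - A h'.1).2 w - (genPairing (A w) h' - genPairing h (A' w)) := by
  rw [jetBracket_snd_apply]; simp [genPairing]; ring

/-- The derivative of `ι v + K v'`, where `v`, `v'` have derivatives `V`, `V'` and `K` has
derivative `Q`. -/
def eigenJet (ι K : S →L[ℝ] G × (G →L[ℝ] ℝ)) (Q : G →L[ℝ] S →L[ℝ] G × (G →L[ℝ] ℝ))
    (V V' : G →L[ℝ] S) (v' : S) : G →L[ℝ] G × (G →L[ℝ] ℝ) :=
  ι.comp V + K.comp V' + Q.flip v'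

lemma eigenJet_apply (ι K : S →L[ℝ] G × (G →L[ℝ] ℝ)) (Q : G →L[ℝ] S →L[ℝ] G × (G →L[ℝ] ℝ))
    (V V' : G →L[ℝ] S) (v' : S) (x : G) :
    eigenJet ι K Q V V' v' x = ι (V x) + K (V' x) + Q x v' := rfl

set_option synthInstance.maxHeartbeats 200000 in
/-- The bracket of two sections `re + i im` of the form `ι (v + i v') - i K (v + i v')`. -/
lemma jetBracket_eigen {ι K : S →L[ℝ] G × (G →L[ℝ] ℝ)}
    {Q : G →L[ℝ] S →L[ℝ] G × (G →L[ℝ] ℝ)}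
    (hιK : ∀ s t, genPairing (ι s) (K t) = 0)
    (hKK : ∀ s t, genPairing (K s) (K t) = genPairing (ι s) (ι t))
    (hιQ : ∀ w s t, genPairing (ι s) (Q w t) = 0) (hQι : ∀ s, Q (ι s).1 = 0)
    (v v' w w' : S) (V V' W W' : G →L[ℝ] S) : ∃ u u' : S,
    jetBracket (ι v + K v') (ι w + K w') (eigenJet ι K Q V V' v') (eigenJet ι K Q W W' w')
      - jetBracket (ι v' - K v) (ι w' - K w) (eigenJet ι K Q V' (-V) (-v))
        (eigenJet ι K Q W' (-W) (-w)) =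
      ι u + K u' + (jetBracket (K v') (K w') (Q.flip v') (Q.flip w')
        - jetBracket (K v) (K w) (Q.flip v) (Q.flip w)) ∧
    jetBracket (ι v + K v') (ι w' - K w) (eigenJet ι K Q V V' v') (eigenJet ι K Q W' (-W) (-w))
      + jetBracket (ι v' - K v) (ι w + K w') (eigenJet ι K Q V' (-V) (-v))
        (eigenJet ι K Q W W' w') =
      ι u' - K u - (jetBracket (K v') (K w) (Q.flip v') (Q.flip w)
        + jetBracket (K v) (K w') (Q.flip v) (Q.flip w')) := by
  have hKι : ∀ s t, genPairing (K t) (ι s) = 0 := fun s t => by rw [genPairing_comm, hιK]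
  have hQι' : ∀ w s t, genPairing (Q w t) (ι s) = 0 := fun w s t => by rw [genPairing_comm, hιQ]
  -- The witness `u + iu'` is the derivative of the component `w + iw'` along the first section
  -- minus that of `v + iv'` along the second. The relation `hQι`, constancy of `K` along the
  -- fibres, removes the derivatives of `K` in vertical directions. By `hιK` and `hKK`, the pairings
  -- free of `Q` cancel between the two brackets of each sum: this is isotropy of the eigenbundle.
  refine ⟨W (ι v + K v').1 - W' (ι v' - K v).1 - (V (ι w + K w').1 - V' (ι w' - K w).1),
    W' (ι v + K v').1 + W (ι v' - K v).1 - (V' (ι w + K w').1 + V (ι w' - K w).1), ?_, ?_⟩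
  · refine Prod.ext ?_ ?_
    · simp only [Prod.fst_add, Prod.fst_sub, jetBracket_fst, eigenJet_apply,
        ContinuousLinearMap.flip_apply, map_add, map_sub, hQι, neg_apply, map_neg,
        Prod.fst_neg, zero_apply, Prod.fst_zero]
      abel
    · ext x
      simp only [Prod.snd_add, Prod.snd_sub, add_apply,
        sub_apply, jetBracket_snd_apply', eigenJet_apply, neg_apply, add_apply, sub_apply, map_neg,
        ContinuousLinearMap.flip_apply, map_add, map_sub, Prod.fst_add, Prod.fst_sub, hQι,
        Prod.snd_neg, zero_apply, Prod.snd_zero, genPairing_add_left, genPairing_add_right, genPairing_sub_left,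
        genPairing_sub_right, hιK, hKK, hιQ, hKι, hQι', genPairing_neg_left, genPairing_neg_right]
      ring
  · refine Prod.ext ?_ ?_
    · simp only [Prod.fst_add, Prod.fst_sub, jetBracket_fst, eigenJet_apply,
        ContinuousLinearMap.flip_apply, map_add, map_sub, hQι, neg_apply, map_neg,
        Prod.fst_neg, zero_apply, Prod.fst_zero]
      abel
    · ext x
      simp only [Prod.snd_add, Prod.snd_sub, add_apply,
        sub_apply, jetBracket_snd_apply', eigenJet_apply, neg_apply, add_apply, sub_apply, map_neg,
        ContinuousLinearMap.flip_apply, map_add, map_sub, Prod.fst_add, Prod.fst_sub, hQι,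
        Prod.snd_neg, zero_apply, Prod.snd_zero, genPairing_add_left, genPairing_add_right, genPairing_sub_left,
        genPairing_sub_right, hιK, hKK, hιQ, hKι, hQι', genPairing_neg_left, genPairing_neg_right]
      ring

end Eigen

/-! ### Transition maps of torus bundles -/

section Torus

variable {n : ℕ}

lemma torusMk_add (ξ η : Fin n → ℝ) : torusMk (ξ + η) = torusMk ξ + torusMk η := rfl

lemma torusMk_zero : torusMk (0 : Fin n → ℝ) = 0 := rfl

lemma torusMk_sub (ξ η : Fin n → ℝ) : torusMk (ξ - η) = torusMk ξ - torusMk η := rfl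

lemma torusMk_nsmul (N : ℕ) (ξ : Fin n → ℝ) : torusMk (N • ξ) = N • torusMk ξ := rfl

lemma torusMk_torusLift (t : StdTorus n) : torusMk (torusLift t) = t :=
  funext fun i => Quotient.out_eq (t i)

lemma torusMk_single_one (i : Fin n) : torusMk (Pi.single i 1 : Fin n → ℝ) = 0 := by
  funext j
  by_cases h : j = i
  · subst h; simp [torusMk]
  · simp [torusMk, Pi.single_eq_of_ne h]

/-- The kernel `ℤⁿ` meets the open unit ball of the sup norm only in `0`. -/
lemma eq_zero_of_torusMk_eq_zero {ξ : Fin n → ℝ} (h : torusMk ξ = 0) (hξ : ‖ξ‖ < 1) : ξ = 0 := by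
  funext i
  have h1 : ((ξ i : ℝ) : UnitAddCircle) = 0 := congrFun h i
  obtain ⟨k, hk⟩ := (AddCircle.coe_eq_zero_iff (1 : ℝ)).1 h1
  have h2 : |ξ i| < 1 := lt_of_le_of_lt (norm_le_pi_norm ξ i) hξ
  rw [← hk] at h2
  have h3 : |(k : ℝ)| < 1 := by simpa using h2
  have h4 : |k| < 1 := by exact_mod_cast h3
  have h5 : k = 0 := Int.abs_lt_one_iff.1 h4
  rw [← hk, h5]; simp

/-- A map of a ball which is additive and differentiable at `0` is linear. -/
lemma eq_fderiv_of_locally_additive {R : Type*} [NormedAddCommGroup R] [NormedSpace ℝ R]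
    {g : R → R} {r : ℝ} (hr : 0 < r)
    (hadd : ∀ ξ η, ‖ξ‖ < r → ‖η‖ < r → g (ξ + η) = g ξ + g η)
    (hd : DifferentiableAt ℝ g 0) {ξ : R} (hξ : ‖ξ‖ < r) : g ξ = fderiv ℝ g 0 ξ := by
  have h0 : g 0 = 0 := by simpa using hadd 0 0 (by simpa) (by simpa)
  -- Additivity gives `g η = 2 ^ k • g (η / 2 ^ k)`. As `k` grows the argument tends to `0`, where
  -- `g` agrees with its derivative up to `o(‖η‖ / 2 ^ k)`, and the factor `2 ^ k` leaves an error
  -- tending to `0`.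
  have hhalf : ∀ k : ℕ, ∀ η : R, ‖η‖ < r → g η = (2 : ℝ) ^ k • g ((2 : ℝ)⁻¹ ^ k • η) := by
    intro k
    induction k with
    | zero => intro η _; simp
    | succ k ih =>
      intro η hη
      have h1 : ‖(2 : ℝ)⁻¹ ^ (k + 1) • η‖ < r := by
        rw [norm_smul]
        refine lt_of_le_of_lt (mul_le_of_le_one_left (norm_nonneg _) ?_) hη
        rw [norm_pow]
        exact pow_le_one₀ (norm_nonneg _) (by norm_num)
      rw [ih η hη, pow_succ, mul_smul]
      congr 1
      rw [two_smul, ← hadd _ _ h1 h1, ← two_smul ℝ, smul_smul]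
      congr 2
      rw [pow_succ]; ring
  have hlim : Filter.Tendsto (fun k : ℕ => (2 : ℝ)⁻¹ ^ k • ξ) Filter.atTop (𝓝 0) := by
    have : Filter.Tendsto (fun k : ℕ => (2 : ℝ)⁻¹ ^ k) Filter.atTop (𝓝 0) :=
      tendsto_pow_atTop_nhds_zero_of_lt_one (by norm_num) (by norm_num)
    simpa using this.smul_const ξ
  have ho := hasFDerivAt_iff_isLittleO_nhds_zero.1 hd.hasFDerivAt
  simp only [zero_add, h0, sub_zero] at ho
  rw [← sub_eq_zero, ← norm_le_zero_iff]
  refine le_of_forall_pos_le_add fun ε hε => ?_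
  have hc : 0 < ε / (‖ξ‖ + 1) := by positivity
  obtain ⟨k, hk⟩ := (hlim.eventually (ho.def hc)).exists
  have h2 : g ξ - fderiv ℝ g 0 ξ =
      (2 : ℝ) ^ k • (g ((2 : ℝ)⁻¹ ^ k • ξ) - fderiv ℝ g 0 ((2 : ℝ)⁻¹ ^ k • ξ)) := by
    rw [smul_sub, ← hhalf k ξ hξ, map_smul, smul_smul, ← mul_pow]; norm_num
  rw [h2, norm_smul, norm_pow]
  calc ‖(2 : ℝ)‖ ^ k * _ ≤ ‖(2 : ℝ)‖ ^ k * (ε / (‖ξ‖ + 1) * ‖(2 : ℝ)⁻¹ ^ k • ξ‖) := by gcongr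
    _ = ε / (‖ξ‖ + 1) * ‖ξ‖ := by
        rw [norm_smul, norm_pow, norm_inv, inv_pow]
        have : ‖(2 : ℝ)‖ ^ k ≠ 0 := pow_ne_zero _ (norm_ne_zero_iff.2 two_ne_zero)
        field_simp
    _ ≤ 0 + ε := by
        rw [zero_add, div_mul_eq_mul_div, div_le_iff₀ (by positivity)]
        nlinarith [norm_nonneg ξ]

end Torus

namespace TorusBundle

variable {n : ℕ} {E : Type*} [NormedAddCommGroup E] [NormedSpace ℝ E]
  {F : Type*} [NormedAddCommGroup F] [NormedSpace ℝ F]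
  {M : Type*} [TopologicalSpace M] [ChartedSpace E M]
  {Z : Type*} [TopologicalSpace Z] [ChartedSpace F Z]
  (B : TorusBundle n E F M Z) {e e' : Trivialization (StdTorus n) B.proj}

variable {B}

lemma apply_param {m : M} (hm : m ∈ e.baseSet) (ξ : Fin n → ℝ) :
    e (B.param e (m, ξ)) = (m, torusMk ξ) :=
  e.apply_symm_apply' hm

lemma param_eq_of_torusMk_eq {m : M} {ξ η : Fin n → ℝ} (h : torusMk ξ = torusMk η) :
    B.param e (m, ξ) = B.param e (m, η) := by
  simp only [param, h]

lemma param_eq_iff {m : M} (hm : m ∈ e.baseSet) (hm' : m ∈ e'.baseSet) {ξ ξ' : Fin n → ℝ} :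
    B.param e (m, ξ) = B.param e' (m, ξ') ↔ (e' (B.param e (m, ξ))).2 = torusMk ξ' := by
  constructor
  · intro h; rw [h, apply_param hm']
  · intro h
    have hs : B.param e (m, ξ) ∈ e'.source := by
      rw [e'.mem_source, B.proj_param hm]; exact hm'
    have h1 : e' (B.param e (m, ξ)) = (m, torusMk ξ') := by
      refine Prod.ext ?_ h
      rw [e'.coe_fst hs, B.proj_param hm]
    have h2 := e'.toOpenPartialHomeomorph.left_inv hs
    rw [← h2]
    exact congrArg _ h1

lemma exists_param_eq {z : Z} (hz : B.proj z ∈ e.baseSet) :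
    B.param e (B.proj z, torusLift (e z).2) = z := by
  have hs : z ∈ e.source := e.mem_source.2 hz
  have h2 := e.toOpenPartialHomeomorph.left_inv hs
  refine Eq.trans ?_ h2
  rw [param, torusMk_torusLift]
  congr 1
  exact Prod.ext (e.coe_fst hs).symm rfl

lemma transition_param_add (he : e ∈ B.atlas) (he' : e' ∈ B.atlas) {m : M} (hm : m ∈ e.baseSet)
    (hm' : m ∈ e'.baseSet) (ξ η : Fin n → ℝ) :
    (e' (B.param e (m, ξ + η))).2 = (e' (B.param e (m, ξ))).2 + (e' (B.param e (m, η))).2 :=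
  B.transition_add e he e' he' m ⟨hm, hm'⟩ (torusMk ξ) (torusMk η)

lemma transition_param_zero (he : e ∈ B.atlas) (he' : e' ∈ B.atlas) {m : M} (hm : m ∈ e.baseSet)
    (hm' : m ∈ e'.baseSet) : (e' (B.param e (m, 0))).2 = 0 := by
  rw [B.param_zero he hm, B.triv_zero e' he' m hm']

lemma transition_param_nsmul (he : e ∈ B.atlas) (he' : e' ∈ B.atlas) {m : M} (hm : m ∈ e.baseSet)
    (hm' : m ∈ e'.baseSet) (N : ℕ) (ξ : Fin n → ℝ) :
    (e' (B.param e (m, N • ξ))).2 = N • (e' (B.param e (m, ξ))).2 := by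
  induction N with
  | zero => simp [transition_param_zero he he' hm hm']
  | succ N ih => rw [succ_nsmul, succ_nsmul, transition_param_add he he' hm hm', ih]

lemma isLocalDiffeomorphAt_param (he : e ∈ B.atlas) {m : M} (hm : m ∈ e.baseSet)
    (ξ : Fin n → ℝ) :
    IsLocalDiffeomorphAt (𝓘(ℝ, E).prod 𝓘(ℝ, Fin n → ℝ)) 𝓘(ℝ, F) ∞ (B.param e) (m, ξ) :=
  B.isLocalDiffeomorphOn e he ⟨(m, ξ), hm, mem_univ _⟩

/-- Near the zero section a change of trivialization lifts to a map of the covering spaces. -/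
lemma exists_local_lift (he : e ∈ B.atlas) (he' : e' ∈ B.atlas) {m₀ : M} (hm : m₀ ∈ e.baseSet)
    (hm' : m₀ ∈ e'.baseSet) : ∃ γ : M × (Fin n → ℝ) → (Fin n → ℝ), ∃ W, IsOpen W ∧ m₀ ∈ W ∧
      W ⊆ e.baseSet ∩ e'.baseSet ∧ ∃ r > 0, ∀ m ∈ W, ∀ ξ, ‖ξ‖ < r →
        ‖γ (m, ξ)‖ < 1 / 4 ∧ (e' (B.param e (m, ξ))).2 = torusMk (γ (m, ξ)) ∧
        ContinuousAt γ (m, ξ) ∧ DifferentiableAt ℝ (fun η => γ (m, η)) ξ := by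
  have hD := isLocalDiffeomorphAt_param he' hm' 0
  set Θ := hD.localInverse with hΘ
  have hz : B.param e (m₀, 0) = B.param e' (m₀, 0) := by
    rw [B.param_zero he hm, B.param_zero he' hm']
  -- A branch of the fibre coordinate of `e'` near the zero section, which both parametrizations
  -- place at `ξ = 0`.
  let γ : M × (Fin n → ℝ) → (Fin n → ℝ) := fun x => (Θ (B.param e x)).2
  have hΘ0 : Θ (B.param e (m₀, 0)) = (m₀, 0) := by
    rw [hz]; exact hD.localInverse_left_inv hD.localInverse_mem_target
  have hsrc0 : B.param e (m₀, 0) ∈ Θ.source := by rw [hz]; exact hD.localInverse_mem_source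
  have hpc : ContinuousAt (B.param e) (m₀, 0) :=
    (isLocalDiffeomorphAt_param he hm 0).contMDiffAt.continuousAt
  have hΘc : ∀ z ∈ Θ.source, ContMDiffAt 𝓘(ℝ, F) (𝓘(ℝ, E).prod 𝓘(ℝ, Fin n → ℝ)) ∞ Θ z :=
    fun z hz => hD.localInverse_contMDiffOn.contMDiffAt (Θ.open_source.mem_nhds hz)
  have hcc : ContinuousAt (fun x => Θ (B.param e x)) (m₀, 0) :=
    ContinuousAt.comp (hΘc _ hsrc0).continuousAt hpc
  have hev : ∀ᶠ x : M × (Fin n → ℝ) in 𝓝 (m₀, 0), B.param e x ∈ Θ.source ∧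
      (Θ (B.param e x)).1 ∈ e'.baseSet ∧ ‖γ x‖ < 1 / 4 := by
    refine (hpc.eventually (Θ.open_source.mem_nhds hsrc0)).and (Filter.Eventually.and ?_ ?_)
    · refine hcc.eventually (p := fun y => y.1 ∈ e'.baseSet) ?_
      beta_reduce
      rw [hΘ0]
      exact continuousAt_fst.eventually (e'.open_baseSet.mem_nhds hm')
    -- The bound `1 / 4` keeps a combination of three values of `γ` inside the unit ball, where the
    -- only lattice point is `0`.
    · have h1 : ContinuousAt (fun x => ‖γ x‖) (m₀, 0) := hcc.snd.norm
      refine h1.eventually (p := fun y => y < 1 / 4) (Iio_mem_nhds ?_)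
      simp [γ, hΘ0]
  rw [nhds_prod_eq] at hev
  obtain ⟨pa, hpa, pb, hpb, hab⟩ := Filter.eventually_prod_iff.1 hev
  obtain ⟨r, hr, hrb⟩ := Metric.eventually_nhds_iff.1 hpb
  obtain ⟨W, hW, hWo, hWm⟩ := eventually_nhds_iff.1
    (hpa.and (((e.open_baseSet.inter e'.open_baseSet).mem_nhds ⟨hm, hm'⟩)))
  refine ⟨γ, W, hWo, hWm, fun m h => (hW m h).2, r, hr, fun m hmW ξ hξ => ?_⟩
  have hme := (hW m hmW).2
  obtain ⟨h1, h2, h3⟩ := hab (hW m hmW).1 (hrb (by simpa using hξ))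
  have hce : ContMDiffAt (𝓘(ℝ, E).prod 𝓘(ℝ, Fin n → ℝ)) (𝓘(ℝ, E).prod 𝓘(ℝ, Fin n → ℝ)) ∞
      (fun x => Θ (B.param e x)) (m, ξ) :=
    ContMDiffAt.comp (m, ξ) (hΘc _ h1) (isLocalDiffeomorphAt_param he hme.1 ξ).contMDiffAt
  refine ⟨h3, ?_, hce.continuousAt.snd, ?_⟩
  · have h4 : B.param e' (Θ (B.param e (m, ξ))) = B.param e (m, ξ) := hD.localInverse_right_inv h1
    have h5 : (Θ (B.param e (m, ξ))).1 = m := by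
      have h6 := B.proj_param h2 (Θ (B.param e (m, ξ))).2
      rw [Prod.mk.eta, h4, B.proj_param hme.1] at h6
      exact h6.symm
    refine (param_eq_iff hme.1 hme.2).1 ?_
    rw [← h4]
    congr 1
    exact Prod.ext h5 rfl
  · have h6 : ContMDiffAt 𝓘(ℝ, Fin n → ℝ) 𝓘(ℝ, Fin n → ℝ) ∞ (fun η => γ (m, η)) ξ :=
      (ContMDiffAt.snd hce).comp ξ (contMDiffAt_const.prodMk contMDiffAt_id)
    exact h6.contDiffAt.differentiableAt (by simp)

/-- Changes of trivialization are locally constant linear maps of the covering spaces. -/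
lemma exists_transition (he : e ∈ B.atlas) (he' : e' ∈ B.atlas) {m₀ : M} (hm : m₀ ∈ e.baseSet)
    (hm' : m₀ ∈ e'.baseSet) : ∃ A : (Fin n → ℝ) →L[ℝ] (Fin n → ℝ), ∀ᶠ m in 𝓝 m₀,
      m ∈ e.baseSet ∧ m ∈ e'.baseSet ∧ ∀ ξ, (e' (B.param e (m, ξ))).2 = torusMk (A ξ) := by
  obtain ⟨γ, W, hWo, hWm, hWb, r, hr, h⟩ := exists_local_lift he he' hm hm'
  let A : M → (Fin n → ℝ) →L[ℝ] (Fin n → ℝ) := fun m => fderiv ℝ (fun η => γ (m, η)) 0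
  -- On the ball of radius `r / 2` the sum `ξ + η` stays in the domain of the lift. The defect of
  -- additivity lies in `ℤⁿ` and has norm less than `3 / 4`, so it vanishes.
  have hA : ∀ m ∈ W, ∀ ξ, ‖ξ‖ < r / 2 → γ (m, ξ) = A m ξ := by
    intro m hmW ξ hξ
    refine eq_fderiv_of_locally_additive (g := fun η => γ (m, η)) (r := r / 2) (by positivity) ?_
      (h m hmW 0 (by simpa)).2.2.2 hξ
    intro ξ η hξ hη
    obtain ⟨a1, a2, -, -⟩ := h m hmW ξ (by linarith)
    obtain ⟨b1, b2, -, -⟩ := h m hmW η (by linarith)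
    obtain ⟨c1, c2, -, -⟩ := h m hmW (ξ + η) (lt_of_le_of_lt (norm_add_le _ _) (by linarith))
    rw [← sub_eq_zero]
    refine eq_zero_of_torusMk_eq_zero ?_ ?_
    · rw [torusMk_sub, torusMk_add, ← a2, ← b2, ← c2,
        transition_param_add he he' (hWb hmW).1 (hWb hmW).2, sub_self]
    · refine lt_of_le_of_lt (norm_sub_le _ _) ?_
      have := norm_add_le (γ (m, ξ)) (γ (m, η))
      linarith
  -- Each vector is an integer multiple of a small one, so the homomorphism property extends the
  -- linear formula from a small ball to all of `ℝⁿ`.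
  have hN : ∀ ξ : Fin n → ℝ, ∃ N : ℕ, N ≠ 0 ∧ ‖(N : ℝ)⁻¹ • ξ‖ < r / 2 := by
    intro ξ
    obtain ⟨N, hN⟩ := exists_nat_gt (‖ξ‖ / (r / 2))
    have hN0 : (0 : ℝ) < N := lt_of_le_of_lt (by positivity) hN
    refine ⟨N, by exact_mod_cast hN0.ne', ?_⟩
    rw [norm_smul, norm_inv, Real.norm_natCast, inv_mul_lt_iff₀ hN0]
    rwa [div_lt_iff₀ (by positivity)] at hN
  have hT : ∀ m ∈ W, ∀ ξ, (e' (B.param e (m, ξ))).2 = torusMk (A m ξ) := by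
    intro m hmW ξ
    obtain ⟨N, hN0, hNr⟩ := hN ξ
    have h1 : ξ = N • ((N : ℝ)⁻¹ • ξ) := by
      rw [← Nat.cast_smul_eq_nsmul ℝ, smul_smul, mul_inv_cancel₀ (by exact_mod_cast hN0), one_smul]
    conv_lhs => rw [h1]
    conv_rhs => rw [h1]
    rw [transition_param_nsmul he he' (hWb hmW).1 (hWb hmW).2, map_nsmul, torusMk_nsmul,
      (h m hmW _ (by linarith)).2.1, hA m hmW _ hNr]
  refine ⟨A m₀, ?_⟩
  have hcont : ∀ (N : ℕ) (g : M → Fin n → ℝ), ContinuousAt g m₀ →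
      ContinuousAt (fun m => ‖(N : ℝ) • (g m - g m₀)‖) m₀ := fun N g hg => by
    fun_prop
  -- The vectors `A m eᵢ` lie in the lattice `ℤⁿ` and depend continuously on `m` at `m₀`, hence are
  -- constant near `m₀`. Continuity is known only for the lift at the small vector `η = eᵢ / N`, and
  -- is multiplied by `N`.
  have hloc : ∀ i : Fin n, ∀ᶠ m in 𝓝 m₀, A m (Pi.single i 1) = A m₀ (Pi.single i 1) := by
    intro i
    obtain ⟨N, hN0, hNr⟩ := hN (Pi.single i 1)
    set η : Fin n → ℝ := (N : ℝ)⁻¹ • Pi.single i 1 with hη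
    have h1 : (Pi.single i 1 : Fin n → ℝ) = (N : ℝ) • η := by
      rw [hη, smul_smul, mul_inv_cancel₀ (by exact_mod_cast hN0), one_smul]
    have hc : ContinuousAt (fun m => ‖(N : ℝ) • (γ (m, η) - γ (m₀, η))‖) m₀ := by
      have : ContinuousAt (fun m => γ (m, η)) m₀ :=
        ContinuousAt.comp (f := fun m => (m, η)) (h m₀ hWm η (by linarith)).2.2.1 (by fun_prop)
      exact hcont N _ this
    have hc1 := hc.eventually (p := fun y => y < 1) (Iio_mem_nhds (by simp))
    filter_upwards [hWo.mem_nhds hWm, hc1] with m hmW hm1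
    rw [hA m hmW η hNr, hA m₀ hWm η hNr, smul_sub, ← map_smul, ← map_smul, ← h1] at hm1
    rw [← sub_eq_zero]
    refine eq_zero_of_torusMk_eq_zero ?_ hm1
    have h2 : ∀ m ∈ W, torusMk (A m (Pi.single i 1)) = 0 := by
      intro m hmW
      rw [← hT m hmW, param_eq_of_torusMk_eq ((torusMk_single_one i).trans torusMk_zero.symm),
        transition_param_zero he he' (hWb hmW).1 (hWb hmW).2]
    rw [torusMk_sub, h2 m hmW, h2 m₀ hWm, sub_self]
  filter_upwards [hWo.mem_nhds hWm, Filter.eventually_all.2 hloc] with m hmW hmA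
  have h3 : A m = A m₀ := by
    refine ContinuousLinearMap.coe_injective ((Pi.basisFun ℝ (Fin n)).ext fun i => ?_)
    simpa using hmA i
  exact ⟨(hWb hmW).1, (hWb hmW).2, fun ξ => by rw [hT m hmW, h3]⟩

end TorusBundle

/-! ### Frames and flat sections -/

namespace TorusBundle

variable {n : ℕ} {E : Type*} [NormedAddCommGroup E] [NormedSpace ℝ E]
  {F : Type*} [NormedAddCommGroup F] [NormedSpace ℝ F]
  {M : Type*} [TopologicalSpace M] [ChartedSpace E M]
  {Z : Type*} [TopologicalSpace Z] [ChartedSpace F Z]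
  {B : TorusBundle n E F M Z} {e e' : Trivialization (StdTorus n) B.proj}

/-- Chain rule for `(m, ξ) ↦ (m, A ξ + k)`; as `A` and `k` do not depend on `m`, horizontal vectors
acquire no vertical component. Both sides are read in `F`, since their base points agree only
propositionally. -/
lemma dParam_eq_of_eventually (he' : e' ∈ B.atlas) {m : M} (hm' : m ∈ e'.baseSet)
    {A : (Fin n → ℝ) →L[ℝ] (Fin n → ℝ)} {ξ k : Fin n → ℝ}
    (h : ∀ᶠ x : M × (Fin n → ℝ) in 𝓝 (m, ξ), B.param e x = B.param e' (x.1, A x.2 + k))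
    (v : E) (s : Fin n → ℝ) :
    (B.dParam e m ξ (v, s) : F) = (B.dParam e' m (A ξ + k) (v, A s) : F) := by
  have h1 : HasMFDerivAt (𝓘(ℝ, E).prod 𝓘(ℝ, Fin n → ℝ)) 𝓘(ℝ, Fin n → ℝ)
      (fun x : M × (Fin n → ℝ) => A x.2 + k) (m, ξ)
      (A.comp (ContinuousLinearMap.snd ℝ E (Fin n → ℝ))) :=
    HasMFDerivAt.comp (I' := 𝓘(ℝ, Fin n → ℝ)) (g := fun ξ => A ξ + k) (m, ξ)
      ((A.hasFDerivAt (x := ξ)).add_const k).hasMFDerivAt (hasMFDerivAt_snd (m, ξ))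
  have h2 := (hasMFDerivAt_fst (I := 𝓘(ℝ, E)) (I' := 𝓘(ℝ, Fin n → ℝ)) (m, ξ)).prodMk h1
  have h3 := (isLocalDiffeomorphAt_param he' hm' (A ξ + k)).mdifferentiableAt (by simp)
  have h4 := HasMFDerivAt.comp (m, ξ) h3.hasMFDerivAt h2
  have h5 : (B.param e) =ᶠ[𝓝 (m, ξ)] (B.param e' ∘ fun x => (x.1, A x.2 + k)) := h
  have h6 := h5.mfderiv_eq (I := 𝓘(ℝ, E).prod 𝓘(ℝ, Fin n → ℝ)) (I' := 𝓘(ℝ, F))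
  rw [h4.mfderiv] at h6
  exact DFunLike.congr_fun h6 ((v, s) : E × (Fin n → ℝ))

/-- Changes of trivialization act on the differentials of the parametrizations by locally constant
linear maps. -/
lemma exists_dParam_transition (he : e ∈ B.atlas) (he' : e' ∈ B.atlas) {m₀ : M}
    (hm : m₀ ∈ e.baseSet) (hm' : m₀ ∈ e'.baseSet) :
    ∃ A : (Fin n → ℝ) →L[ℝ] (Fin n → ℝ), ∀ᶠ m in 𝓝 m₀, m ∈ e.baseSet ∧ m ∈ e'.baseSet ∧
      ∀ ξ ξ', B.param e (m, ξ) = B.param e' (m, ξ') → ∀ (v : E) (s : Fin n → ℝ),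
        (B.dParam e m ξ (v, s) : F) = (B.dParam e' m ξ' (v, A s) : F) := by
  obtain ⟨A, hA⟩ := exists_transition he he' hm hm'
  refine ⟨A, ?_⟩
  -- The relation is needed on a neighbourhood of `m`, because it is about to be differentiated.
  filter_upwards [eventually_eventually_nhds.2 hA] with m hev
  obtain ⟨h1, h2, h3⟩ := hev.self_of_nhds
  refine ⟨h1, h2, fun ξ ξ' hξ v s => ?_⟩
  -- Two lifts of the same point differ, after applying `A`, by a lattice vector; translation by it
  -- does not change the parametrized point.
  have hk : torusMk (ξ' - A ξ) = 0 := by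
    rw [torusMk_sub, ← h3, (param_eq_iff h1 h2).1 hξ, sub_self]
  have h4 := dParam_eq_of_eventually (e := e) (A := A) (ξ := ξ) (k := ξ' - A ξ) he' h2 ?_ v s
  · rwa [add_sub_cancel] at h4
  · have h5 : ∀ᶠ x : M × (Fin n → ℝ) in 𝓝 (m, ξ), x.1 ∈ e.baseSet ∧ x.1 ∈ e'.baseSet ∧
        ∀ ξ, (e' (B.param e (x.1, ξ))).2 = torusMk (A ξ) :=
      continuousAt_fst.eventually (p := fun m => m ∈ e.baseSet ∧ m ∈ e'.baseSet ∧
        ∀ ξ, (e' (B.param e (m, ξ))).2 = torusMk (A ξ)) hev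
    filter_upwards [h5] with x hx
    exact (param_eq_iff hx.1 hx.2.1).2 (by rw [hx.2.2, torusMk_add, hk, add_zero])

lemma isInvertible_dParam (he : e ∈ B.atlas) {m : M} (hm : m ∈ e.baseSet) (ξ : Fin n → ℝ) :
    (B.dParam e m ξ).IsInvertible :=
  (isLocalDiffeomorphAt_param he hm ξ).isInvertible

lemma mfderiv_proj_dParam_apply (he : e ∈ B.atlas) {m : M}
    (hm : m ∈ e.baseSet) (ξ η : Fin n → ℝ) (v : E) :
    (mfderiv 𝓘(ℝ, F) 𝓘(ℝ, E) B.proj (B.param e (m, ξ)) (B.dParam e m ξ (v, η)) : E) = v := by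
  have hΦ := (isLocalDiffeomorphAt_param he hm ξ).mdifferentiableAt (by simp)
  have hp : MDifferentiableAt 𝓘(ℝ, F) 𝓘(ℝ, E) B.proj (B.param e (m, ξ)) :=
    B.contMDiff_proj.mdifferentiableAt (by simp)
  have hc := mfderiv_comp (m, ξ) hp hΦ
  have he' : (B.proj ∘ B.param e) =ᶠ[𝓝 (m, ξ)] Prod.fst := by
    filter_upwards [(e.open_baseSet.prod isOpen_univ).mem_nhds
      (show (m, ξ) ∈ e.baseSet ×ˢ univ from ⟨hm, mem_univ _⟩)] with x hx
    exact B.proj_param hx.1 x.2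
  rw [he'.mfderiv_eq, mfderiv_fst] at hc
  exact (DFunLike.congr_fun hc ((v, η) : E × (Fin n → ℝ))).symm

/-- The frame of `V` at `m` given by a local trivialization whose base contains `m`. -/
def frameOfMem (he : e ∈ B.atlas) {m : M} (hm : m ∈ e.baseSet) : (Fin n → ℝ) →L[ℝ] B.V m :=
  (((B.dParam e m 0).comp (ContinuousLinearMap.inr ℝ _ _) :
    (Fin n → ℝ) →L[ℝ] TangentSpace 𝓘(ℝ, F) (B.zero m))).codRestrict (B.V m) (fun η => by
      have h1 := B.mfderiv_proj_dParam he hm 0 η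
      rw [B.param_zero he hm] at h1
      exact h1)

open Classical in
/-- The frame of `V` at `m` given by a local trivialization. -/
def frameOf (e : Trivialization (StdTorus n) B.proj) (m : M) : (Fin n → ℝ) →L[ℝ] B.V m :=
  if h : e ∈ B.atlas ∧ m ∈ e.baseSet then frameOfMem h.1 h.2 else 0

lemma frameOf_eq (he : e ∈ B.atlas) {m : M} (hm : m ∈ e.baseSet) :
    frameOf e m = frameOfMem he hm := dif_pos ⟨he, hm⟩

lemma coe_frameOf (he : e ∈ B.atlas) {m : M} (hm : m ∈ e.baseSet) (s : Fin n → ℝ) :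
    ((frameOf e m s).1 : F) = B.dParam e m 0 (0, s) := by
  rw [frameOf_eq he hm]; rfl

lemma frame_eq_frameOf (m : M) : B.frame m = frameOf (B.trivAt m) m := by
  rw [frameOf_eq (B.trivAt_mem_atlas m) (B.mem_baseSet_trivAt m)]; rfl

/-- The components of a vector in `V_m`, as a linear map. -/
def coordL (e : Trivialization (StdTorus n) B.proj) (m : M) : B.V m →L[ℝ] (Fin n → ℝ) :=
  ((ContinuousLinearMap.snd ℝ E (Fin n → ℝ)).comp
    ((B.dParam e m 0).inverse : F →L[ℝ] E × (Fin n → ℝ))).comp ((B.V m).subtypeL : B.V m →L[ℝ] F)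

lemma coord_frameOf (he : e ∈ B.atlas) {m : M} (hm : m ∈ e.baseSet) (s : Fin n → ℝ) :
    B.coord e m (frameOf e m s) = s := by
  have h := (isInvertible_dParam he hm 0).inverse_apply_self ((0, s) : E × (Fin n → ℝ))
  have h2 := coe_frameOf he hm s
  unfold coord
  exact (congrArg (fun u : F => ((B.dParam e m 0).inverse u).2) h2).trans (congrArg Prod.snd h)

lemma frameOf_coord (he : e ∈ B.atlas) {m : M} (hm : m ∈ e.baseSet) (u : B.V m) :
    frameOf e m (B.coord e m u) = u := by
  have h := (isInvertible_dParam he hm 0).self_apply_inverse (u.1 : F)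
  have h1 := mfderiv_proj_dParam_apply he hm 0 (B.coord e m u) ((B.dParam e m 0).inverse (u.1 : F)).1
  -- The base component of a vector in these coordinates is its image under `dp`, and `u` is
  -- vertical.
  have h3 : ((B.dParam e m 0).inverse (u.1 : F)).1 = (0 : E) := by
    refine h1.symm.trans ?_
    have h4 := u.2
    have h5 : B.dParam e m 0 (((B.dParam e m 0).inverse (u.1 : F)).1, B.coord e m u) = (u.1 : F) := h
    rw [h5]
    have h6 := B.param_zero he hm
    have h7 : ∀ z, z = B.zero m → mfderiv 𝓘(ℝ, F) 𝓘(ℝ, E) B.proj z (u.1 : F) = (0 : E) := by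
      rintro z rfl; exact h4
    exact h7 _ h6
  refine Subtype.ext ?_
  refine (coe_frameOf he hm _).trans ?_
  refine Eq.trans ?_ h
  exact congrArg (B.dParam e m 0) (Prod.ext h3.symm rfl)

lemma isInvertible_frame (m : M) : (B.frame m).IsInvertible := by
  have he := B.trivAt_mem_atlas m
  have hm := B.mem_baseSet_trivAt m
  refine ⟨ContinuousLinearEquiv.equivOfInverse (B.frame m) (coordL (B.trivAt m) m) ?_ ?_, rfl⟩
  · intro s; rw [frame_eq_frameOf]; exact coord_frameOf he hm s
  · intro u; rw [frame_eq_frameOf]; exact frameOf_coord he hm u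

lemma inverse_frame_apply (m : M) (u : B.V m) :
    (B.frame m).inverse u = B.coord (B.trivAt m) m u := by
  conv_lhs => rw [← frameOf_coord (B.trivAt_mem_atlas m) (B.mem_baseSet_trivAt m) u,
    ← frame_eq_frameOf]
  exact (isInvertible_frame m).inverse_apply_self _

/-- The frames given by two trivializations differ by a locally constant matrix. -/
lemma exists_frameOf_transition (he : e ∈ B.atlas) (he' : e' ∈ B.atlas) {m₀ : M}
    (hm : m₀ ∈ e.baseSet) (hm' : m₀ ∈ e'.baseSet) :
    ∃ A : (Fin n → ℝ) →L[ℝ] (Fin n → ℝ), ∀ᶠ m in 𝓝 m₀, ∀ u, B.coord e' m u = A (B.coord e m u) := by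
  obtain ⟨A, hA⟩ := exists_dParam_transition he he' hm hm'
  refine ⟨A, ?_⟩
  filter_upwards [hA] with m hmA u
  obtain ⟨h1, h2, h3⟩ := hmA
  have h4 : frameOf e m (B.coord e m u) = frameOf e' m (A (B.coord e m u)) := by
    refine Subtype.ext ?_
    refine (coe_frameOf he h1 _).trans (Eq.trans ?_ (coe_frameOf he' h2 _).symm)
    exact h3 0 0 (by rw [B.param_zero he h1, B.param_zero he' h2]) 0 _
  rw [← coord_frameOf he' h2 (A (B.coord e m u)), ← h4, frameOf_coord he h1]

end TorusBundle

/-! ### Smooth and flat sections of `V` and `V^∨` in local frames. -/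

namespace TorusBundle

variable {n : ℕ} {E : Type*} [NormedAddCommGroup E] [NormedSpace ℝ E]
  {F : Type*} [NormedAddCommGroup F] [NormedSpace ℝ F]
  {M : Type*} [TopologicalSpace M] [ChartedSpace E M] [IsManifold 𝓘(ℝ, E) ∞ M]
  {Z : Type*} [TopologicalSpace Z] [ChartedSpace F Z] [IsManifold 𝓘(ℝ, F) ∞ Z]
  {B : TorusBundle n E F M Z} {e e' : Trivialization (StdTorus n) B.proj}

omit [IsManifold 𝓘(ℝ, E) ∞ M] in
/-- The components of a smooth section of `V` are smooth. -/
lemma contMDiffAt_coord (he : e ∈ B.atlas) {U : Set M} (hU : IsOpen U) {σ : ∀ m, B.V m}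
    (hσ : B.SmoothVOn U σ) {m : M} (hmU : m ∈ U) (hm : m ∈ e.baseSet) :
    ContMDiffAt 𝓘(ℝ, E) 𝓘(ℝ, Fin n → ℝ) ∞ (fun m' => B.coord e m' (σ m')) m := by
  have hD := isLocalDiffeomorphAt_param he hm 0
  -- The fibre coordinate on `Z` near the zero section; the components of a vertical vector there
  -- are its image under `dq`.
  let q : Z → (Fin n → ℝ) := fun z => (hD.localInverse z).2
  have hq : ContMDiffOn 𝓘(ℝ, F) 𝓘(ℝ, Fin n → ℝ) ∞ q hD.localInverse.source :=
    contMDiff_snd.comp_contMDiffOn hD.localInverse_contMDiffOn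
  have hsrc : B.zero m ∈ hD.localInverse.source := by
    have := hD.localInverse_mem_source
    rwa [B.param_zero he hm] at this
  have hz : ContinuousAt B.zero m := B.contMDiff_zero.continuous.continuousAt
  have h1 : ContMDiffAt 𝓘(ℝ, E) 𝓘(ℝ, Fin n → ℝ).tangent ∞
      (fun m' => tangentMap 𝓘(ℝ, F) 𝓘(ℝ, Fin n → ℝ) q ⟨B.zero m', (σ m').1⟩) m :=
    ContMDiffAt.comp m (contMDiffAt_tangentMap hD.localInverse.open_source hq
      (p := ⟨B.zero m, (σ m).1⟩) hsrc) (hσ.contMDiffAt (hU.mem_nhds hmU))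
  have h2 := (contMDiff_snd_tangentBundle_modelSpace (n := ∞) (Fin n → ℝ)
    𝓘(ℝ, Fin n → ℝ)).contMDiffAt.comp m h1
  refine h2.congr_of_eventuallyEq ?_
  have ht : ∀ᶠ m' in 𝓝 m, (m', (0 : Fin n → ℝ)) ∈ hD.localInverse.target :=
    (Continuous.prodMk_left (0 : Fin n → ℝ)).continuousAt.eventually
      (hD.localInverse.open_target.mem_nhds hD.localInverse_mem_target)
  filter_upwards [e.open_baseSet.mem_nhds hm,
    hz.preimage_mem_nhds (hD.localInverse.open_source.mem_nhds hsrc), ht] with m' hm' hs' ht'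
  have hpz := B.param_zero he hm'
  have hqd : MDifferentiableAt 𝓘(ℝ, F) 𝓘(ℝ, Fin n → ℝ) q (B.param e (m', 0)) := by
    rw [hpz]
    exact (hq.contMDiffAt (hD.localInverse.open_source.mem_nhds hs')).mdifferentiableAt (by simp)
  have hc := mfderiv_comp (m', (0 : Fin n → ℝ)) hqd
    ((isLocalDiffeomorphAt_param he hm' 0).mdifferentiableAt (by simp))
  have heq : (q ∘ B.param e) =ᶠ[𝓝 (m', 0)] Prod.snd := by
    filter_upwards [hD.localInverse.open_target.mem_nhds ht'] with x hx
    exact congrArg Prod.snd (hD.localInverse_left_inv hx)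
  rw [heq.mfderiv_eq, mfderiv_snd] at hc
  have h3 := DFunLike.congr_fun hc ((0, B.coord e m' (σ m')) : E × (Fin n → ℝ))
  have h4 : (B.dParam e m' 0 ((0, B.coord e m' (σ m')) : E × (Fin n → ℝ)) : F) = (σ m').1 := by
    exact (coe_frameOf he hm' _).symm.trans (congrArg Subtype.val (frameOf_coord he hm' (σ m')))
  have h5 : ∀ z, z = B.zero m' → (mfderiv 𝓘(ℝ, F) 𝓘(ℝ, Fin n → ℝ) q z ((σ m').1 : F) : Fin n → ℝ)
      = mfderiv 𝓘(ℝ, F) 𝓘(ℝ, Fin n → ℝ) q (B.zero m') (σ m').1 := by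
    rintro z rfl; rfl
  refine Eq.trans h3 (Eq.trans ?_ (h5 _ hpz))
  exact congrArg (mfderiv 𝓘(ℝ, F) 𝓘(ℝ, Fin n → ℝ) q (B.param e (m', 0))) h4

/-- The frame is the image, under the tangent map of the parametrization, of the smooth section `(0,
s)` along `ξ = 0`. -/
lemma smoothVOn_frameOf (he : e ∈ B.atlas) (s : Fin n → ℝ) :
    B.SmoothVOn e.baseSet (fun m => frameOf e m s) := by
  intro m hm
  refine ContMDiffAt.contMDiffWithinAt ?_
  have h0 : ContMDiff 𝓘(ℝ, E) 𝓘(ℝ, E).tangent ∞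
      (fun m : M => (⟨m, 0⟩ : TangentBundle 𝓘(ℝ, E) M)) :=
    Bundle.contMDiff_zeroSection ℝ (TangentSpace 𝓘(ℝ, E) : M → Type _)
  have h1 : ContMDiff 𝓘(ℝ, E) 𝓘(ℝ, Fin n → ℝ).tangent ∞
      (fun _ : M => (⟨0, s⟩ : TangentBundle 𝓘(ℝ, Fin n → ℝ) (Fin n → ℝ))) := contMDiff_const
  have h2 : ContMDiff 𝓘(ℝ, E) (𝓘(ℝ, E).prod 𝓘(ℝ, Fin n → ℝ)).tangent ∞
      (fun m : M => (⟨(m, 0), (0, s)⟩ :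
        TangentBundle (𝓘(ℝ, E).prod 𝓘(ℝ, Fin n → ℝ)) (M × (Fin n → ℝ)))) :=
    contMDiff_equivTangentBundleProd_symm.comp (h0.prodMk h1)
  have h3 := ContMDiffAt.comp m ((isLocalDiffeomorphAt_param he hm 0).contMDiffAt_tangentMap
    (p := ⟨(m, 0), (0, s)⟩)) h2.contMDiffAt
  refine h3.congr_of_eventuallyEq ?_
  filter_upwards [e.open_baseSet.mem_nhds hm] with m' hm'
  exact Bundle.TotalSpace.ext (B.param_zero he hm').symm (heq_of_eq (coe_frameOf he hm' s))

-- The trivialization chosen in `gaussManin` depends on `m` in an uncontrolled way. Since frames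
-- differ by locally constant matrices, flatness can be tested in one fixed trivialization.
omit [IsManifold 𝓘(ℝ, E) ∞ M] in
lemma gaussManin_eq_zero_iff (he : e ∈ B.atlas) {U : Set M} (hU : IsOpen U) {σ : ∀ m, B.V m}
    (hσ : B.SmoothVOn U σ) {m : M} (hmU : m ∈ U) (hm : m ∈ e.baseSet) :
    B.gaussManin σ m = 0 ↔
      mfderiv 𝓘(ℝ, E) 𝓘(ℝ, Fin n → ℝ) (fun m' => B.coord e m' (σ m')) m = 0 := by
  have key : ∀ e ∈ B.atlas, ∀ e' ∈ B.atlas, m ∈ e.baseSet → m ∈ e'.baseSet →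
      mfderiv 𝓘(ℝ, E) 𝓘(ℝ, Fin n → ℝ) (fun m' => B.coord e m' (σ m')) m = 0 →
      mfderiv 𝓘(ℝ, E) 𝓘(ℝ, Fin n → ℝ) (fun m' => B.coord e' m' (σ m')) m = 0 := by
    intro e he e' he' hm hm' h
    obtain ⟨A, hA⟩ := exists_frameOf_transition he he' hm hm'
    have hev : (fun m' => B.coord e' m' (σ m')) =ᶠ[𝓝 m]
        (A ∘ fun m' => B.coord e m' (σ m')) := by
      filter_upwards [hA] with m' hm' using hm' (σ m')
    have hd := (contMDiffAt_coord he hU hσ hmU hm).mdifferentiableAt (by simp)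
    rw [hev.mfderiv_eq, mfderiv_comp m
      ((A.differentiableAt (x := B.coord e m (σ m))).mdifferentiableAt) hd, h,
      ContinuousLinearMap.comp_zero]
    rfl
  have he' := B.trivAt_mem_atlas m
  have hm' := B.mem_baseSet_trivAt m
  have h1 : B.gaussManin σ m = 0 ↔
      mfderiv 𝓘(ℝ, E) 𝓘(ℝ, Fin n → ℝ) (fun m' => B.coord (B.trivAt m) m' (σ m')) m = 0 := by
    constructor
    · intro h
      ext1 v
      have h2 := DFunLike.congr_fun h v
      have h3 := congrArg (B.frame m).inverse h2
      have h4 := (isInvertible_frame (B := B) m).inverse_apply_self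
        (mfderiv 𝓘(ℝ, E) 𝓘(ℝ, Fin n → ℝ) (fun m' => B.coord (B.trivAt m) m' (σ m')) m v)
      have h5 := h4.symm.trans (h3.trans (map_zero _))
      exact h5
    · intro h
      unfold gaussManin
      rw [h]
      exact ContinuousLinearMap.comp_zero _
  rw [h1]
  exact ⟨key _ he' _ he hm' hm, key _ he _ he' hm hm'⟩

lemma isFlatOn_frameOf (he : e ∈ B.atlas) (s : Fin n → ℝ) :
    B.IsFlatOn e.baseSet (fun m => frameOf e m s) := by
  refine ⟨smoothVOn_frameOf he s, fun m hm => ?_⟩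
  rw [gaussManin_eq_zero_iff he e.open_baseSet (smoothVOn_frameOf he s) hm hm]
  have hev : (fun m' => B.coord e m' (frameOf e m' s)) =ᶠ[𝓝 m] fun _ => s := by
    filter_upwards [e.open_baseSet.mem_nhds hm] with m' hm' using coord_frameOf he hm' s
  rw [hev.mfderiv_eq]
  exact mfderiv_const

/-- Read in a chart, the function has zero derivative on a ball, which is connected. -/
lemma eventually_eq_of_mfderiv_eq_zero {F' : Type*} [NormedAddCommGroup F'] [NormedSpace ℝ F']
    {c : M → F'} {m : M}
    (hd : ∀ᶠ m' in 𝓝 m, MDifferentiableAt 𝓘(ℝ, E) 𝓘(ℝ, F') c m' ∧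
      mfderiv 𝓘(ℝ, E) 𝓘(ℝ, F') c m' = 0) : ∀ᶠ m' in 𝓝 m, c m' = c m := by
  set χ := extChartAt 𝓘(ℝ, E) m with hχ
  have hmem : m ∈ χ.source := mem_extChartAt_source m
  have hT : {u | u ∈ χ.target ∧ (MDifferentiableAt 𝓘(ℝ, E) 𝓘(ℝ, F') c (χ.symm u) ∧
      mfderiv 𝓘(ℝ, E) 𝓘(ℝ, F') c (χ.symm u) = 0)} ∈ 𝓝 (χ m) := by
    have hd' : ∀ᶠ m' in 𝓝 (χ.symm (χ m)), MDifferentiableAt 𝓘(ℝ, E) 𝓘(ℝ, F') c m' ∧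
        mfderiv 𝓘(ℝ, E) 𝓘(ℝ, F') c m' = 0 := by rwa [extChartAt_to_inv]
    exact Filter.inter_mem (extChartAt_target_mem_nhds m)
      ((continuousAt_extChartAt_symm (I := 𝓘(ℝ, E)) m).eventually hd')
  obtain ⟨r, hr, hball⟩ := Metric.mem_nhds_iff.1 hT
  have hder : ∀ u ∈ Metric.ball (χ m) r, HasFDerivAt (c ∘ χ.symm) (0 : E →L[ℝ] F') u := by
    intro u hu
    obtain ⟨h1, h2, h3⟩ := hball hu
    have h4 : MDifferentiableAt 𝓘(ℝ, E) 𝓘(ℝ, E) χ.symm u :=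
      (isLocalDiffeomorphAt_extChartAt_symm h1).mdifferentiableAt (by simp)
    have h5 := HasMFDerivAt.comp u h2.hasMFDerivAt h4.hasMFDerivAt
    rw [h3] at h5
    have h6 := h5.hasFDerivAt
    exact h6
  have hconst : ∀ u ∈ Metric.ball (χ m) r, (c ∘ χ.symm) u = (c ∘ χ.symm) (χ m) := fun u hu =>
    Metric.isOpen_ball.is_const_of_fderiv_eq_zero (convex_ball _ _).isPreconnected
      (fun u hu => (hder u hu).differentiableAt.differentiableWithinAt)
      (fun u hu => (hder u hu).fderiv) hu (Metric.mem_ball_self hr)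
  filter_upwards [(continuousAt_extChartAt (I := 𝓘(ℝ, E)) m).preimage_mem_nhds
    (Metric.ball_mem_nhds _ hr), extChartAt_source_mem_nhds (I := 𝓘(ℝ, E)) m] with m' h1 h2
  have h3 := hconst _ h1
  simp only [Function.comp_apply] at h3
  rwa [← hχ, χ.left_inv h2, χ.left_inv hmem] at h3

/-- The components of a flat section are locally constant. -/
lemma IsFlatOn.eventually_coord_eq (he : e ∈ B.atlas) {U : Set M} (hU : IsOpen U)
    {σ : ∀ m, B.V m} (hσ : B.IsFlatOn U σ) {m : M} (hmU : m ∈ U) (hm : m ∈ e.baseSet) :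
    ∀ᶠ m' in 𝓝 m, B.coord e m' (σ m') = B.coord e m (σ m) := by
  refine eventually_eq_of_mfderiv_eq_zero (E := E) (c := fun m' => B.coord e m' (σ m')) ?_
  filter_upwards [hU.mem_nhds hmU, e.open_baseSet.mem_nhds hm] with m' hm'U hm'
  exact ⟨(contMDiffAt_coord he hU hσ.1 hm'U hm').mdifferentiableAt (by simp),
    (gaussManin_eq_zero_iff he hU hσ.1 hm'U hm').1 (hσ.2 m' hm'U)⟩

/-- The flat section of `V^∨` with components `φ`. -/
def dualFrameOf (e : Trivialization (StdTorus n) B.proj) (φ : (Fin n → ℝ) →L[ℝ] ℝ) (m : M) :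
    B.V m →L[ℝ] ℝ := φ.comp (coordL e m)

omit [IsManifold 𝓘(ℝ, E) ∞ M] in
lemma smoothVDualOn_dualFrameOf (he : e ∈ B.atlas) (φ : (Fin n → ℝ) →L[ℝ] ℝ) :
    B.SmoothVDualOn e.baseSet (dualFrameOf e φ) := by
  intro U' hU' hoU' σ hσ m hm
  have h1 := contMDiffAt_coord he hoU' hσ hm (hU' hm)
  exact (φ.contDiff.contMDiff.contMDiffAt.comp m h1).contMDiffWithinAt

lemma isFlatDualOn_dualFrameOf (he : e ∈ B.atlas) (φ : (Fin n → ℝ) →L[ℝ] ℝ) :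
    B.IsFlatDualOn e.baseSet (dualFrameOf e φ) := by
  intro U' hU' hoU' σ hσ m hm
  filter_upwards [IsFlatOn.eventually_coord_eq he hoU' hσ hm (hU' hm)] with m' hm'
  exact congrArg φ hm'

lemma IsFlatOn.eventually_eq_frameOf (he : e ∈ B.atlas) {U : Set M} (hU : IsOpen U)
    {σ : ∀ m, B.V m} (hσ : B.IsFlatOn U σ) {m : M} (hmU : m ∈ U) (hm : m ∈ e.baseSet) :
    ∃ s, ∀ᶠ m' in 𝓝 m, σ m' = frameOf e m' s := by
  refine ⟨B.coord e m (σ m), ?_⟩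
  filter_upwards [IsFlatOn.eventually_coord_eq he hU hσ hmU hm, e.open_baseSet.mem_nhds hm]
    with m' h1 h2
  rw [← h1, frameOf_coord he h2]

/-- It is enough to pair with the finitely many flat frame sections, on each of which the values are
locally constant. -/
lemma IsFlatDualOn.eventually_eq_dualFrameOf (he : e ∈ B.atlas) {U : Set M} (hU : IsOpen U)
    {θ : ∀ m, B.V m →L[ℝ] ℝ} (hθ : B.IsFlatDualOn U θ) {m : M} (hmU : m ∈ U)
    (hm : m ∈ e.baseSet) : ∃ φ, ∀ᶠ m' in 𝓝 m, θ m' = dualFrameOf e φ m' := by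
  refine ⟨(θ m).comp (frameOf e m), ?_⟩
  have h1 : ∀ i : Fin n, ∀ᶠ m' in 𝓝 m, θ m' (frameOf e m' (Pi.single i 1)) =
      θ m (frameOf e m (Pi.single i 1)) := by
    intro i
    have hf := isFlatOn_frameOf he (Pi.single i (1 : ℝ))
    have hsub : B.IsFlatOn (U ∩ e.baseSet) (fun m => frameOf e m (Pi.single i 1)) :=
      ⟨hf.1.mono inter_subset_right, fun m' hm' => hf.2 m' hm'.2⟩
    exact hθ (U ∩ e.baseSet) inter_subset_left (hU.inter e.open_baseSet) _ hsub m ⟨hmU, hm⟩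
  filter_upwards [Filter.eventually_all.2 h1, e.open_baseSet.mem_nhds hm] with m' h2 h3
  have h4 : (θ m').comp (frameOf e m') = (θ m).comp (frameOf e m) := by
    refine ContinuousLinearMap.coe_injective ((Pi.basisFun ℝ (Fin n)).ext fun i => ?_)
    simpa using h2 i
  ext u
  rw [dualFrameOf, ← h4]
  exact congrArg (θ m') (frameOf_coord he h3 u).symm

end TorusBundle

/-! ### The flat model -/

section Apply

variable {E G S T : Type*} [NormedAddCommGroup E] [NormedSpace ℝ E]
  [NormedAddCommGroup G] [NormedSpace ℝ G] [NormedAddCommGroup S] [NormedSpace ℝ S]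
  [NormedAddCommGroup T] [NormedSpace ℝ T] {K : E → S →L[ℝ] T}

lemma hasFDerivAt_clm_comp_apply {p : G →L[ℝ] E} {v : G → S} {x : G}
    (hK : DifferentiableAt ℝ K (p x)) (hv : DifferentiableAt ℝ v x) :
    HasFDerivAt (fun x' => K (p x') (v x'))
      ((K (p x)).comp (fderiv ℝ v x) + ((fderiv ℝ K (p x)).comp p).flip (v x)) x :=
  (hK.hasFDerivAt.comp x p.hasFDerivAt).clm_apply hv.hasFDerivAt

lemma hasFDerivAt_clm_apply_const {S' : Type*} [NormedAddCommGroup S'] [NormedSpace ℝ S']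
    {y : E} (hK : DifferentiableAt ℝ K y) (ρ : T →L[ℝ] S') (t : S) :
    HasFDerivAt (fun y => ρ (K y t)) (ρ.comp ((fderiv ℝ K y).flip t)) y :=
  (ρ.comp (ContinuousLinearMap.apply ℝ T t)).hasFDerivAt.comp y hK.hasFDerivAt

end Apply

/-! ### Adapted structures on a vector space that depend only on base coordinates. -/

section Adapted

variable {E : Type*} [NormedAddCommGroup E] [NormedSpace ℝ E]
  {G : Type*} [NormedAddCommGroup G] [NormedSpace ℝ G]
  {S : Type*} [NormedAddCommGroup S] [NormedSpace ℝ S]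

/-- An adapted generalized complex structure `J` on a vector space `G` with respect to a subspace
`ι S` of `G ⊕ G^∨` with projection `ρ`; `K` is the restriction of `J` to this subspace. -/
structure IsFlatAdapted (ι : S →L[ℝ] G × (G →L[ℝ] ℝ)) (ρ : G × (G →L[ℝ] ℝ) →L[ℝ] S)
    (J : (G × (G →L[ℝ] ℝ)) →ₗ[ℝ] (G × (G →L[ℝ] ℝ)))
    (K : S →L[ℝ] G × (G →L[ℝ] ℝ)) : Prop where
  proj_incl : ∀ c, ρ (ι c) = c
  genPairing_incl : ∀ c h, ρ h = 0 → genPairing (ι c) h = 0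
  sq : ∀ h, J (J h) = -h
  apply_incl : ∀ c, J (ι c) = K c
  proj_apply : ∀ c, ρ (K c) = 0
  exists_eq : ∀ h, ρ h = 0 → ∃ c, K c = h
  genPairing_apply : ∀ a b, genPairing (J a) (J b) = genPairing a b

variable {ι : S →L[ℝ] G × (G →L[ℝ] ℝ)} {ρ : G × (G →L[ℝ] ℝ) →L[ℝ] S} {p : G →L[ℝ] E}

section Point

variable {J : (G × (G →L[ℝ] ℝ)) →ₗ[ℝ] (G × (G →L[ℝ] ℝ))}
  {K : S →L[ℝ] G × (G →L[ℝ] ℝ)}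

lemma IsFlatAdapted.apply_K (hJ : IsFlatAdapted ι ρ J K) (c : S) :
    J (K c) = -ι c := by
  rw [← hJ.apply_incl, hJ.sq]

/-- The `+i`-eigenspace is the graph of `-iK` over the complexification of `S`, so its elements are
determined by their vertical parts `ρ re` and `ρ im`. One of the two eigenvalue equations suffices,
as `J² = -1` gives the other. -/
lemma IsFlatAdapted.eq_of_eigen (hJ : IsFlatAdapted ι ρ J K)
    {re im : G × (G →L[ℝ] ℝ)} (h2 : J im = re) :
    re = ι (ρ re) + K (ρ im) ∧
      im = ι (ρ im) - K (ρ re) := by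
  obtain ⟨c, hc⟩ := hJ.exists_eq (im - ι (ρ im))
    (by rw [map_sub, hJ.proj_incl, sub_self])
  have him : im = ι (ρ im) + K c := by rw [hc]; abel
  have hre : re = K (ρ im) - ι c := by
    rw [← h2]
    conv_lhs => rw [him]
    rw [map_add, hJ.apply_incl, hJ.apply_K, sub_eq_add_neg]
  have hp : ρ re = -c := by
    rw [hre, map_sub, hJ.proj_apply, hJ.proj_incl, zero_sub]
  rw [hp]
  constructor
  · rw [hre, map_neg]; abel
  · conv_lhs => rw [him]
    rw [map_neg]; abel

end Point

variable {K : E → S →L[ℝ] G × (G →L[ℝ] ℝ)}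
  {J : E → (G × (G →L[ℝ] ℝ)) →ₗ[ℝ] (G × (G →L[ℝ] ℝ))}

set_option synthInstance.maxHeartbeats 400000 in
lemma fderiv_eigen {x : G} (hK : DifferentiableAt ℝ K (p x))
    {f : G → G × (G →L[ℝ] ℝ)} {v v' : G → S}
    (hv : DifferentiableAt ℝ v x) (hv' : DifferentiableAt ℝ v' x)
    (hf : f =ᶠ[𝓝 x] fun x' => ι (v x') + K (p x') (v' x')) :
    fderiv ℝ f x = eigenJet ι (K (p x))
      ((fderiv ℝ K (p x)).comp p) (fderiv ℝ v x) (fderiv ℝ v' x)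
      (v' x) := by
  have h2 := (ι.hasFDerivAt.comp x hv.hasFDerivAt).add
    (hasFDerivAt_clm_comp_apply (T := G × (G →L[ℝ] ℝ)) hK hv')
  rw [hf.fderiv_eq]
  refine h2.fderiv.trans ?_
  exact (add_assoc (ι.comp (fderiv ℝ v x)) ((K (p x)).comp (fderiv ℝ v' x))
    (((fderiv ℝ K (p x)).comp p).flip (v' x))).symm

set_option synthInstance.maxHeartbeats 400000 in
/-- The bracket of two sections of the `+i`-eigenbundle in the flat model. -/
lemma exists_bracket_eq {x : G} (hp : ∀ c, p (ι c).1 = 0)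
    (hK : DifferentiableAt ℝ K (p x))
    (hJ : ∀ᶠ y in 𝓝 (p x), IsFlatAdapted ι ρ (J y) (K y))
    {re im re' im' : G → G × (G →L[ℝ] ℝ)}
    (hre : DifferentiableAt ℝ re x) (him : DifferentiableAt ℝ im x)
    (hre' : DifferentiableAt ℝ re' x) (him' : DifferentiableAt ℝ im' x)
    (h : ∀ᶠ x' in 𝓝 x, J (p x') (im x') = re x') (h' : ∀ᶠ x' in 𝓝 x, J (p x') (im' x') = re' x') :
    let β := fun c d => jetBracket (K (p x) c) (K (p x) d)
      (((fderiv ℝ K (p x)).comp p).flip c)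
      (((fderiv ℝ K (p x)).comp p).flip d)
    ∃ u u' : S,
    jetBracket (re x) (re' x) (fderiv ℝ re x) (fderiv ℝ re' x)
      - jetBracket (im x) (im' x) (fderiv ℝ im x) (fderiv ℝ im' x) =
      ι u + K (p x) u' +
        (β (ρ (im x)) (ρ (im' x))
          - β (ρ (re x)) (ρ (re' x))) ∧
    jetBracket (re x) (im' x) (fderiv ℝ re x) (fderiv ℝ im' x)
      + jetBracket (im x) (re' x) (fderiv ℝ im x) (fderiv ℝ re' x) =
      ι u' - K (p x) u -
        (β (ρ (im x)) (ρ (re' x))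
          + β (ρ (re x)) (ρ (im' x))) := by
  intro β
  have hJx := hJ.self_of_nhds
  have hJ' : ∀ᶠ x' : G in 𝓝 x, IsFlatAdapted ι ρ (J (p x')) (K (p x')) :=
    p.continuous.continuousAt.eventually hJ
  have key : ∀ re im : G → G × (G →L[ℝ] ℝ), DifferentiableAt ℝ re x →
      DifferentiableAt ℝ im x → (∀ᶠ x' in 𝓝 x, J (p x') (im x') = re x') →
      re x = ι (ρ (re x)) + K (p x) (ρ (im x)) ∧
      im x = ι (ρ (im x)) - K (p x) (ρ (re x)) ∧
      fderiv ℝ re x = eigenJet ι (K (p x))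
        ((fderiv ℝ K (p x)).comp p)
        (ρ.comp (fderiv ℝ re x)) (ρ.comp (fderiv ℝ im x))
        (ρ (im x)) ∧
      fderiv ℝ im x = eigenJet ι (K (p x))
        ((fderiv ℝ K (p x)).comp p)
        (ρ.comp (fderiv ℝ im x)) (-(ρ.comp (fderiv ℝ re x)))
        (-(ρ (re x))) := by
    intro re im hre him h
    have h1 := hJx.eq_of_eigen h.self_of_nhds
    have hpr : HasFDerivAt (fun x' => ρ (re x'))
        (ρ.comp (fderiv ℝ re x)) x :=
      ρ.hasFDerivAt.comp x hre.hasFDerivAt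
    have hpi : HasFDerivAt (fun x' => ρ (im x'))
        (ρ.comp (fderiv ℝ im x)) x :=
      ρ.hasFDerivAt.comp x him.hasFDerivAt
    refine ⟨h1.1, h1.2, ?_, ?_⟩
    · rw [← hpr.fderiv, ← hpi.fderiv]
      refine fderiv_eigen hK hpr.differentiableAt hpi.differentiableAt ?_
      filter_upwards [hJ', h] with x' hx' h'x' using (hx'.eq_of_eigen h'x').1
    -- The imaginary part has the same shape as the real part, with the pair of components `(v, v')`
    -- replaced by `(v', -v)`.
    · rw [← hpr.neg.fderiv, ← hpi.fderiv]
      refine fderiv_eigen hK hpi.differentiableAt hpr.neg.differentiableAt ?_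
      filter_upwards [hJ', h] with x' hx' h'x'
      rw [Pi.neg_apply, map_neg, ← sub_eq_add_neg]
      exact (hx'.eq_of_eigen h'x').2
  obtain ⟨a1, a2, a3, a4⟩ := key re im hre him h
  obtain ⟨b1, b2, b3, b4⟩ := key re' im' hre' him' h'
  -- Derivatives of `K` remain horizontal, by differentiating `ρ ∘ K = 0`; they are therefore
  -- orthogonal to the image of `ι`.
  have hQ : ∀ w t, ρ
      (((fderiv ℝ K (p x)).comp p) w t) = 0 := by
    intro w t
    have h1 := hasFDerivAt_clm_apply_const (T := G × (G →L[ℝ] ℝ)) hK ρ t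
    have h2 : (fun y => ρ (K y t)) =ᶠ[𝓝 (p x)] fun _ => 0 := by
      filter_upwards [hJ] with y hy using hy.proj_apply t
    have h3 := h1.fderiv
    rw [h2.fderiv_eq, fderiv_const_apply] at h3
    exact (DFunLike.congr_fun h3 (p w)).symm
  have hE := jetBracket_eigen (ι := ι) (K := K (p x))
    (Q := (fderiv ℝ K (p x)).comp p)
    (fun s t => hJx.genPairing_incl _ _ (hJx.proj_apply t))
    (fun s t => by rw [← hJx.apply_incl, ← hJx.apply_incl, hJx.genPairing_apply])
    (fun w s t => hJx.genPairing_incl _ _ (hQ w t))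
    (fun s => by simp [hp])
    (ρ (re x)) (ρ (im x)) (ρ (re' x)) (ρ (im' x))
    (ρ.comp (fderiv ℝ re x)) (ρ.comp (fderiv ℝ im x))
    (ρ.comp (fderiv ℝ re' x)) (ρ.comp (fderiv ℝ im' x))
  rwa [← a1, ← a2, ← a3, ← a4, ← b1, ← b2, ← b3, ← b4] at hE

end Adapted

/-! ### Vertical and horizontal parts of `(E ⊕ R) ⊕ (E ⊕ R)^∨`. -/

section FlatModel

variable {E : Type*} [NormedAddCommGroup E] [NormedSpace ℝ E]
  {R : Type*} [NormedAddCommGroup R] [NormedSpace ℝ R]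

variable (E R) in
/-- The inclusion of `R ⊕ R^∨` into `(E ⊕ R) ⊕ (E ⊕ R)^∨`. -/
def fibreIncl : R × (R →L[ℝ] ℝ) →L[ℝ] (E × R) × (E × R →L[ℝ] ℝ) :=
  ((ContinuousLinearMap.inr ℝ E R).comp (ContinuousLinearMap.fst ℝ _ _)).prod
    (((ContinuousLinearMap.compL ℝ (E × R) R ℝ).flip (ContinuousLinearMap.snd ℝ E R)).comp
      (ContinuousLinearMap.snd ℝ _ _))

variable (E R) in
/-- The projection of `(E ⊕ R) ⊕ (E ⊕ R)^∨` to `R ⊕ R^∨`. -/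
def fibreProj : (E × R) × (E × R →L[ℝ] ℝ) →L[ℝ] R × (R →L[ℝ] ℝ) :=
  ((ContinuousLinearMap.snd ℝ E R).comp (ContinuousLinearMap.fst ℝ _ _)).prod
    (((ContinuousLinearMap.compL ℝ R (E × R) ℝ).flip (ContinuousLinearMap.inr ℝ E R)).comp
      (ContinuousLinearMap.snd ℝ _ _))

variable (E R) in
/-- The inclusion of `E ⊕ E^∨` into `(E ⊕ R) ⊕ (E ⊕ R)^∨`. -/
def baseIncl : E × (E →L[ℝ] ℝ) →L[ℝ] (E × R) × (E × R →L[ℝ] ℝ) :=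
  ((ContinuousLinearMap.inl ℝ E R).comp (ContinuousLinearMap.fst ℝ _ _)).prod
    (((ContinuousLinearMap.compL ℝ (E × R) E ℝ).flip (ContinuousLinearMap.fst ℝ E R)).comp
      (ContinuousLinearMap.snd ℝ _ _))

lemma fibreIncl_apply (c : R × (R →L[ℝ] ℝ)) :
    fibreIncl E R c = ((0, c.1), c.2.comp (ContinuousLinearMap.snd ℝ E R)) := rfl

lemma fibreProj_apply (h : (E × R) × (E × R →L[ℝ] ℝ)) :
    fibreProj E R h = (h.1.2, h.2.comp (ContinuousLinearMap.inr ℝ E R)) := rfl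

lemma baseIncl_apply (c : E × (E →L[ℝ] ℝ)) :
    baseIncl E R c = ((c.1, 0), c.2.comp (ContinuousLinearMap.fst ℝ E R)) := rfl

lemma fibreProj_fibreIncl (c : R × (R →L[ℝ] ℝ)) : fibreProj E R (fibreIncl E R c) = c := by
  refine Prod.ext rfl ?_
  ext s; simp [fibreProj_apply, fibreIncl_apply]

lemma fibreProj_baseIncl (c : E × (E →L[ℝ] ℝ)) : fibreProj E R (baseIncl E R c) = 0 := by
  refine Prod.ext rfl ?_
  ext s; simp [fibreProj_apply, baseIncl_apply]

lemma baseIncl_injective : Function.Injective (baseIncl E R) := by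
  intro c d h
  have h1 := congrArg (fun p => p.1.1) h
  have h2 := fun v : E => congrArg (fun p => p.2 (v, (0 : R))) h
  refine Prod.ext h1 ?_
  ext v
  exact h2 v

lemma genPairing_fibreIncl {c : R × (R →L[ℝ] ℝ)} {h : (E × R) × (E × R →L[ℝ] ℝ)}
    (hh : fibreProj E R h = 0) : genPairing (fibreIncl E R c) h = 0 := by
  have h1 : h.1.2 = 0 := congrArg Prod.fst hh
  have h2 : h.2 (0, c.1) = 0 := DFunLike.congr_fun (congrArg Prod.snd hh) c.1
  simp [genPairing, fibreIncl_apply, h1, h2]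

/-- Sections lifted from `E` are constant along `R` and have no components there, so their bracket
is the lift of the bracket on `E`. -/
lemma jetBracket_baseIncl (h h' : E × (E →L[ℝ] ℝ)) (A A' : E →L[ℝ] E × (E →L[ℝ] ℝ)) :
    jetBracket (baseIncl E R h) (baseIncl E R h')
      (((baseIncl E R).comp A).comp (ContinuousLinearMap.fst ℝ E R))
      (((baseIncl E R).comp A').comp (ContinuousLinearMap.fst ℝ E R)) =
    baseIncl E R (jetBracket h h' A A') := by
  refine Prod.ext ?_ ?_
  · simp [jetBracket, baseIncl_apply]
  · refine ContinuousLinearMap.ext fun w => ?_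
    simp only [jetBracket_snd_apply, baseIncl_apply, ContinuousLinearMap.comp_apply,
      ContinuousLinearMap.coe_fst']

end FlatModel

/-! ### The splitting in local coordinates -/

namespace TorusBundle

section Split

variable {n : ℕ} {E : Type*} [NormedAddCommGroup E] [NormedSpace ℝ E]
  {F : Type*} [NormedAddCommGroup F] [NormedSpace ℝ F]
  {M : Type*} [TopologicalSpace M] [ChartedSpace E M]
  {Z : Type*} [TopologicalSpace Z] [ChartedSpace F Z]
  {B : TorusBundle n E F M Z} {e e' : Trivialization (StdTorus n) B.proj}

/-- The vertical coordinates of a point are coordinates in the trivialization at its base point. -/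
lemma param_vertCoord (z : Z) : B.param (B.trivAt (B.proj z)) (B.proj z, B.vertCoord z) = z :=
  exists_param_eq (B.mem_baseSet_trivAt _)

lemma split_apply_eq (z : Z) (u : B.V (B.proj z)) (v : E) :
    (B.split z (u, v) : F) = B.dParam (B.trivAt (B.proj z)) (B.proj z) (B.vertCoord z)
      (v, B.coord (B.trivAt (B.proj z)) (B.proj z) u) := by
  have h : (B.split z (u, v) : F) = (B.dParamAt z ((0, (B.frame (B.proj z)).inverse u)) : F)
      + B.dParamAt z (v, 0) := rfl
  rw [inverse_frame_apply] at h
  refine h.trans ((map_add (B.dParamAt z) _ _).symm.trans ?_)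
  refine congrArg (B.dParamAt z) ?_
  exact Prod.ext (zero_add v) (add_zero _)

lemma unsplit_dParamAt (z : Z) (v : E) (s : Fin n → ℝ) :
    B.unsplit z (B.dParamAt z (v, s)) = (B.frame (B.proj z) s, v) := by
  refine Prod.ext ?_ ?_
  · have h := (isInvertible_dParam (B.trivAt_mem_atlas (B.proj z)) (B.mem_baseSet_trivAt (B.proj z))
      (B.vertCoord z)).inverse_apply_self (v, s)
    exact congrArg (fun x : E × (Fin n → ℝ) => B.frame (B.proj z) x.2) h
  · have h := mfderiv_proj_dParam_apply (B.trivAt_mem_atlas (B.proj z))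
      (B.mem_baseSet_trivAt (B.proj z)) (B.vertCoord z) s v
    have h7 : ∀ z', z' = z → ∀ w : F, (mfderiv 𝓘(ℝ, F) 𝓘(ℝ, E) B.proj z' w : E) =
        mfderiv 𝓘(ℝ, F) 𝓘(ℝ, E) B.proj z w := by
      rintro z' rfl w; rfl
    exact (h7 _ (param_vertCoord z) _).symm.trans h

lemma unsplit_split (z : Z) (w : B.VT (B.proj z)) : B.unsplit z (B.split z w) = w := by
  have h := split_apply_eq z w.1 w.2
  refine (congrArg (B.unsplit z) h).trans ((unsplit_dParamAt z _ _).trans ?_)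
  rw [frame_eq_frameOf, frameOf_coord (B.trivAt_mem_atlas _) (B.mem_baseSet_trivAt _)]
  rfl

lemma split_unsplit (z : Z) (w : TangentSpace 𝓘(ℝ, F) z) : B.split z (B.unsplit z w) = w := by
  obtain ⟨x, rfl⟩ : ∃ x : E × (Fin n → ℝ), B.dParamAt z x = w :=
    ⟨_, (isInvertible_dParam (B.trivAt_mem_atlas (B.proj z)) (B.mem_baseSet_trivAt (B.proj z))
      (B.vertCoord z)).self_apply_inverse w⟩
  refine (congrArg (B.split z) (unsplit_dParamAt z x.1 x.2)).trans ?_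
  refine (split_apply_eq (B := B) z _ x.1).trans ?_
  have h : B.coord (B.trivAt (B.proj z)) (B.proj z) (B.frame (B.proj z) x.2) = x.2 := by
    rw [frame_eq_frameOf, coord_frameOf (B.trivAt_mem_atlas _) (B.mem_baseSet_trivAt _)]
  exact congrArg (B.dParamAt z) (Prod.ext rfl h)

lemma toBase_fromBase (z : Z) (w : B.GenVT (B.proj z)) : B.toBase z (B.fromBase z w) = w := by
  refine Prod.ext (unsplit_split z w.1) ?_
  refine ContinuousLinearMap.ext fun u => ?_
  exact congrArg w.2 (unsplit_split z u)

lemma fromBase_toBase (z : Z) (a : GenTangent F z) : B.fromBase z (B.toBase z a) = a := by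
  refine Prod.ext (split_unsplit z a.1) ?_
  refine ContinuousLinearMap.ext fun u => ?_
  exact congrArg a.2 (split_unsplit z u)

/-- The splitting in the coordinates given by any trivialization. -/
lemma split_frameOf (he : e ∈ B.atlas) {z : Z} {m : M} (hm : m ∈ e.baseSet) {ξ : Fin n → ℝ}
    (hz : B.param e (m, ξ) = z) (v : E) (s : Fin n → ℝ) :
    (B.split z (frameOf e (B.proj z) s, v) : F) = B.dParam e m ξ (v, s) := by
  obtain rfl : B.proj z = m := by rw [← hz]; exact B.proj_param hm ξ
  have he' := B.trivAt_mem_atlas (B.proj z)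
  have hm' := B.mem_baseSet_trivAt (B.proj z)
  -- The same matrix `A` compares the two trivializations at the zero section, where the frames of
  -- `V` live, and at `z`, where the tangent vectors live.
  obtain ⟨A, hA⟩ := exists_dParam_transition he he' hm hm'
  obtain ⟨-, -, h3⟩ := hA.self_of_nhds
  have h4 : frameOf e (B.proj z) s = frameOf (B.trivAt (B.proj z)) (B.proj z) (A s) := by
    refine Subtype.ext ?_
    refine (coe_frameOf he hm _).trans (Eq.trans ?_ (coe_frameOf he' hm' _).symm)
    exact h3 0 0 (by rw [B.param_zero he hm, B.param_zero he' hm']) 0 _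
  refine (split_apply_eq z _ _).trans ?_
  rw [h4, coord_frameOf he' hm']
  exact (h3 ξ (B.vertCoord z) (hz.trans (param_vertCoord z).symm) v s).symm

end Split

/-! ### Components in a frame of `V ⊕ T_M`. -/

section ChartFrame

variable {n : ℕ} {E : Type*} [NormedAddCommGroup E] [NormedSpace ℝ E]
  {F : Type*} [NormedAddCommGroup F] [NormedSpace ℝ F]
  {M : Type*} [TopologicalSpace M] [ChartedSpace E M]
  {Z : Type*} [TopologicalSpace Z] [ChartedSpace F Z]
  {B : TorusBundle n E F M Z} {e : Trivialization (StdTorus n) B.proj} {D : E →L[ℝ] E} {m : M}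

/-- The frame of `V ⊕ T_M` at `m` given by the frame of `V` of a local trivialization and a frame
`D` of `T_M`. -/
def chartFrame (e : Trivialization (StdTorus n) B.proj) (D : E →L[ℝ] E) (m : M) :
    E × (Fin n → ℝ) →L[ℝ] B.VT m :=
  ((frameOf e m).comp (ContinuousLinearMap.snd ℝ E _)).prod (D.comp (ContinuousLinearMap.fst ℝ E _))

/-- The components of a vector of `V ⊕ T_M` in the frame `chartFrame`. -/
def chartCoord (e : Trivialization (StdTorus n) B.proj) (D : E →L[ℝ] E) (m : M) :
    B.VT m →L[ℝ] E × (Fin n → ℝ) :=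
  (D.inverse.comp (ContinuousLinearMap.snd ℝ _ E)).prod
    ((coordL e m).comp (ContinuousLinearMap.fst ℝ _ E))

lemma chartFrame_chartCoord (he : e ∈ B.atlas) (hm : m ∈ e.baseSet) (hD : D.IsInvertible)
    (w : B.VT m) : chartFrame e D m (chartCoord e D m w) = w :=
  Prod.ext (frameOf_coord he hm w.1) (hD.self_apply_inverse (w.2 : E))

lemma chartCoord_chartFrame (he : e ∈ B.atlas) (hm : m ∈ e.baseSet) (hD : D.IsInvertible)
    (x : E × (Fin n → ℝ)) : chartCoord e D m (chartFrame e D m x) = x :=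
  Prod.ext (hD.inverse_apply_self x.1) (coord_frameOf he hm x.2)

/-- The components of an element of `(V ⊕ T_M) ⊕ (V ⊕ T_M)^∨`. -/
def genCoord (e : Trivialization (StdTorus n) B.proj) (D : E →L[ℝ] E) (m : M) :
    B.GenVT m →ₗ[ℝ] (E × (Fin n → ℝ)) × (E × (Fin n → ℝ) →L[ℝ] ℝ) where
  toFun a := (chartCoord e D m a.1, a.2.comp (chartFrame e D m))
  map_add' a b := by
    refine Prod.ext (map_add _ _ _) ?_
    ext <;> simp
  map_smul' c a := by
    refine Prod.ext (map_smul _ _ _) ?_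
    ext <;> simp

/-- The element of `(V ⊕ T_M) ⊕ (V ⊕ T_M)^∨` with given components. -/
def genFrame (e : Trivialization (StdTorus n) B.proj) (D : E →L[ℝ] E) (m : M) :
    (E × (Fin n → ℝ)) × (E × (Fin n → ℝ) →L[ℝ] ℝ) →ₗ[ℝ] B.GenVT m where
  toFun a := (chartFrame e D m a.1, a.2.comp (chartCoord e D m))
  map_add' a b := by
    refine Prod.ext (map_add _ _ _) ?_
    ext <;> simp
  map_smul' c a := by
    refine Prod.ext (map_smul _ _ _) ?_
    ext <;> simp

lemma genFrame_genCoord (he : e ∈ B.atlas) (hm : m ∈ e.baseSet) (hD : D.IsInvertible)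
    (a : B.GenVT m) : genFrame e D m (genCoord e D m a) = a := by
  refine Prod.ext (chartFrame_chartCoord he hm hD a.1) (ContinuousLinearMap.ext fun w => ?_)
  exact congrArg a.2 (chartFrame_chartCoord he hm hD w)

lemma genCoord_genFrame (he : e ∈ B.atlas) (hm : m ∈ e.baseSet) (hD : D.IsInvertible)
    (a : (E × (Fin n → ℝ)) × (E × (Fin n → ℝ) →L[ℝ] ℝ)) :
    genCoord e D m (genFrame e D m a) = a := by
  refine Prod.ext (chartCoord_chartFrame he hm hD a.1) (ContinuousLinearMap.ext fun w => ?_)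
  exact congrArg a.2 (chartCoord_chartFrame he hm hD w)

lemma genPairing_genCoord (he : e ∈ B.atlas) (hm : m ∈ e.baseSet) (hD : D.IsInvertible)
    (a b : B.GenVT m) :
    genPairing (genCoord e D m a) (genCoord e D m b) = genPairing a b := by
  have h : ∀ a b : B.GenVT m, (genCoord e D m a).2 (genCoord e D m b).1 = a.2 b.1 := fun a b =>
    congrArg a.2 (chartFrame_chartCoord he hm hD b.1)
  simp only [genPairing, h]

/-- Constant vertical components correspond to flat sections of `V ⊕ V^∨`. -/
lemma genFrame_fibreIncl (c : (Fin n → ℝ) × ((Fin n → ℝ) →L[ℝ] ℝ)) :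
    genFrame e D m (fibreIncl E _ c) = B.ofV m (frameOf e m c.1) (dualFrameOf e c.2 m) :=
  Prod.ext (Prod.ext rfl (map_zero D)) rfl

lemma genCoord_of_mem_genT {a : B.GenVT m} (ha : a ∈ B.genT m) :
    genCoord e D m a = baseIncl E _ (D.inverse (B.toT m a).1, (B.toT m a).2.comp D) := by
  obtain ⟨h1, h2⟩ := ha
  refine Prod.ext (Prod.ext rfl ?_) (ContinuousLinearMap.ext fun w => ?_)
  · change coordL e m a.1.1 = 0
    rw [h1, map_zero]
  · change a.2 (frameOf e m w.2, D w.1) = a.2 (0, D w.1)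
    have h3 : ∀ (u : B.V m) (v : TangentSpace 𝓘(ℝ, E) m), a.2 (u, v) = a.2 (0, v) := by
      intro u v
      have h4 : ((u, v) : B.VT m) = (0, v) + (u, 0) := by simp
      rw [h4, map_add, h2, add_zero]
    exact h3 _ _

lemma genFrame_mem_genT {h : (E × (Fin n → ℝ)) × (E × (Fin n → ℝ) →L[ℝ] ℝ)}
    (hh : fibreProj E _ h = 0) : genFrame e D m h ∈ B.genT m := by
  have h1 : h.1.2 = 0 := congrArg Prod.fst hh
  refine ⟨?_, fun u => ?_⟩
  · change frameOf e m h.1.2 = 0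
    rw [h1, map_zero]
  · change h.2 (D.inverse 0, coordL e m u) = 0
    rw [map_zero]
    exact DFunLike.congr_fun (congrArg Prod.snd hh) (coordL e m u)

lemma exists_eq_ofV (he : e ∈ B.atlas) (hm : m ∈ e.baseSet) {a : B.GenVT m}
    (ha : a ∈ B.genV m) : ∃ c : (Fin n → ℝ) × ((Fin n → ℝ) →L[ℝ] ℝ),
      B.ofV m (frameOf e m c.1) (dualFrameOf e c.2 m) = a := by
  obtain ⟨h1, h2⟩ := ha
  refine ⟨(B.coord e m a.1.1, (a.2.comp (ContinuousLinearMap.inl ℝ _ _)).comp (frameOf e m)), ?_⟩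
  refine Prod.ext (Prod.ext (frameOf_coord he hm _) h1.symm) (ContinuousLinearMap.ext fun w => ?_)
  change a.2 (frameOf e m (B.coord e m w.1), 0) = a.2 w
  rw [frameOf_coord he hm]
  have h3 : w = (w.1, 0) + (0, w.2) := by simp
  conv_rhs => rw [h3, map_add, h2, add_zero]

lemma ofV_mem_genV (u : B.V m) (θ : B.V m →L[ℝ] ℝ) : B.ofV m u θ ∈ B.genV m :=
  ⟨rfl, fun _ => map_zero θ⟩

end ChartFrame

end TorusBundle

/-! ### Semi-flat structures in local coordinates -/

namespace TorusBundle

section CoordParam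

variable {n : ℕ} {E : Type*} [NormedAddCommGroup E] [NormedSpace ℝ E]
  {F : Type*} [NormedAddCommGroup F] [NormedSpace ℝ F]
  {M : Type*} [TopologicalSpace M] [ChartedSpace E M] [IsManifold 𝓘(ℝ, E) ∞ M]
  {Z : Type*} [TopologicalSpace Z] [ChartedSpace F Z]
  {B : TorusBundle n E F M Z} {e : Trivialization (StdTorus n) B.proj} {m₀ : M}

lemma isLocalDiffeomorphAt_extChartAt_symm_prod {R : Type*} [NormedAddCommGroup R]
    [NormedSpace ℝ R] {x : E × R} (hx : x.1 ∈ (extChartAt 𝓘(ℝ, E) m₀).target) :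
    IsLocalDiffeomorphAt 𝓘(ℝ, E × R) (𝓘(ℝ, E).prod 𝓘(ℝ, R)) ∞
      (fun x : E × R => ((extChartAt 𝓘(ℝ, E) m₀).symm x.1, x.2)) x :=
  ⟨{ toPartialEquiv := (extChartAt 𝓘(ℝ, E) m₀).symm.prod (PartialEquiv.refl R)
     open_source := (isOpen_extChartAt_target m₀).prod isOpen_univ
     open_target := (isOpen_extChartAt_source m₀).prod isOpen_univ
     contMDiffOn_toFun :=
       ((contMDiffOn_extChartAt_symm m₀).comp contDiff_fst.contMDiff.contMDiffOn
         fun _ hx => hx.1).prodMk contDiff_snd.contMDiff.contMDiffOn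
     contMDiffOn_invFun := by
       have h : ContMDiffOn 𝓘(ℝ, E) 𝓘(ℝ, E) ∞ (extChartAt 𝓘(ℝ, E) m₀)
           (extChartAt 𝓘(ℝ, E) m₀).source := by
         simpa [extChartAt_source] using contMDiffOn_extChartAt (I := 𝓘(ℝ, E)) (x := m₀) (n := ∞)
       exact (h.comp contMDiffOn_fst fun _ hx => hx.1).prodMk_space contMDiffOn_snd },
    ⟨hx, mem_univ _⟩, fun _ _ => rfl⟩

/-- The parametrization of `Z` by the vector space `E × ℝⁿ` given by a local trivialization and a
chart of `M`. -/
def coordParam (e : Trivialization (StdTorus n) B.proj) (m₀ : M) (x : E × (Fin n → ℝ)) : Z :=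
  B.param e ((extChartAt 𝓘(ℝ, E) m₀).symm x.1, x.2)

omit [IsManifold 𝓘(ℝ, E) ∞ M] in
lemma proj_coordParam {x : E × (Fin n → ℝ)}
    (hm : (extChartAt 𝓘(ℝ, E) m₀).symm x.1 ∈ e.baseSet) :
    B.proj (coordParam e m₀ x) = (extChartAt 𝓘(ℝ, E) m₀).symm x.1 :=
  B.proj_param hm _

lemma isLocalDiffeomorphAt_coordParam (he : e ∈ B.atlas) {x : E × (Fin n → ℝ)}
    (hx : x.1 ∈ (extChartAt 𝓘(ℝ, E) m₀).target)
    (hm : (extChartAt 𝓘(ℝ, E) m₀).symm x.1 ∈ e.baseSet) :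
    IsLocalDiffeomorphAt 𝓘(ℝ, E × (Fin n → ℝ)) 𝓘(ℝ, F) ∞ (coordParam e m₀) x :=
  IsLocalDiffeomorphAt.comp _ _ (isLocalDiffeomorphAt_extChartAt_symm_prod hx)
    (isLocalDiffeomorphAt_param he hm x.2)

/-- The differential of the inverse of the chart at `m₀`. -/
def chartDeriv (m₀ : M) (u : E) : E →L[ℝ] E :=
  mfderiv 𝓘(ℝ, E) 𝓘(ℝ, E) (extChartAt 𝓘(ℝ, E) m₀).symm u

lemma isInvertible_chartDeriv {u : E} (hu : u ∈ (extChartAt 𝓘(ℝ, E) m₀).target) :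
    (chartDeriv m₀ u).IsInvertible :=
  (isLocalDiffeomorphAt_extChartAt_symm hu).isInvertible

lemma mfderiv_coordParam_apply (he : e ∈ B.atlas) {x : E × (Fin n → ℝ)}
    (hx : x.1 ∈ (extChartAt 𝓘(ℝ, E) m₀).target)
    (hm : (extChartAt 𝓘(ℝ, E) m₀).symm x.1 ∈ e.baseSet) (v : E) (s : Fin n → ℝ) :
    (mfderiv 𝓘(ℝ, E × (Fin n → ℝ)) 𝓘(ℝ, F) (coordParam (B := B) e m₀) x (v, s) : F) =
      B.dParam e ((extChartAt 𝓘(ℝ, E) m₀).symm x.1) x.2 (chartDeriv m₀ x.1 v, s) := by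
  have h1 : HasMFDerivAt 𝓘(ℝ, E × (Fin n → ℝ)) 𝓘(ℝ, E)
      ((extChartAt 𝓘(ℝ, E) m₀).symm ∘ Prod.fst) x
      ((chartDeriv m₀ x.1).comp (ContinuousLinearMap.fst ℝ E (Fin n → ℝ))) :=
    HasMFDerivAt.comp x
      ((isLocalDiffeomorphAt_extChartAt_symm hx).mdifferentiableAt (by simp)).hasMFDerivAt
      (ContinuousLinearMap.fst ℝ E (Fin n → ℝ)).hasMFDerivAt
  have h2 := h1.prodMk (ContinuousLinearMap.snd ℝ E (Fin n → ℝ)).hasMFDerivAt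
  have h3 := HasMFDerivAt.comp (g := B.param e) x
    ((isLocalDiffeomorphAt_param he hm x.2).mdifferentiableAt (by simp)).hasMFDerivAt h2
  exact DFunLike.congr_fun h3.mfderiv ((v, s) : E × (Fin n → ℝ))

/-- In these coordinates the Gauss–Manin splitting `(j, α)` is the product splitting of `E × ℝⁿ`. -/
lemma split_chartFrame (he : e ∈ B.atlas) {x : E × (Fin n → ℝ)}
    (hx : x.1 ∈ (extChartAt 𝓘(ℝ, E) m₀).target)
    (hm : (extChartAt 𝓘(ℝ, E) m₀).symm x.1 ∈ e.baseSet) (w : E × (Fin n → ℝ)) :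
    B.split (coordParam e m₀ x) (chartFrame e (chartDeriv m₀ x.1) (B.proj (coordParam e m₀ x)) w) =
      mfderiv 𝓘(ℝ, E × (Fin n → ℝ)) 𝓘(ℝ, F) (coordParam e m₀) x w :=
  (split_frameOf he hm rfl _ _).trans (mfderiv_coordParam_apply he hx hm w.1 w.2).symm

/-- The pullback to `E × ℝⁿ` of a section given in the splitting. -/
lemma pullGen_fromBase (he : e ∈ B.atlas) {x : E × (Fin n → ℝ)}
    (hx : x.1 ∈ (extChartAt 𝓘(ℝ, E) m₀).target)
    (hm : (extChartAt 𝓘(ℝ, E) m₀).symm x.1 ∈ e.baseSet) (w : ∀ z, B.GenVT (B.proj z)) :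
    pullGen (coordParam e m₀) (fun z => B.fromBase z (w z)) x =
      genCoord e (chartDeriv m₀ x.1) (B.proj (coordParam e m₀ x)) (w (coordParam e m₀ x)) := by
  have hm' : B.proj (coordParam e m₀ x) ∈ e.baseSet := by rwa [proj_coordParam hm]
  refine Prod.ext ?_ (ContinuousLinearMap.ext fun u => ?_)
  · have h1 := split_chartFrame he hx hm (chartCoord e (chartDeriv m₀ x.1) _
      (w (coordParam e m₀ x)).1)
    rw [chartFrame_chartCoord he hm' (isInvertible_chartDeriv hx)] at h1
    refine (congrArg (mfderiv 𝓘(ℝ, E × (Fin n → ℝ)) 𝓘(ℝ, F)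
      (coordParam (B := B) e m₀) x).inverse h1).trans ?_
    exact (isLocalDiffeomorphAt_coordParam he hx hm).isInvertible.inverse_apply_self _
  · have h1 := congrArg (B.unsplit (coordParam e m₀ x)) (split_chartFrame he hx hm u)
    rw [unsplit_split] at h1
    exact congrArg (w (coordParam e m₀ x)).2 h1.symm

variable [IsManifold 𝓘(ℝ, F) ∞ Z]

/-- An adapted structure in the coordinates given by a local trivialization and a chart. -/
def AdaptedGACS.coordJ (J : B.AdaptedGACS) (e : Trivialization (StdTorus n) B.proj) (m₀ : M)
    (u : E) : (E × (Fin n → ℝ)) × (E × (Fin n → ℝ) →L[ℝ] ℝ) →ₗ[ℝ]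
      (E × (Fin n → ℝ)) × (E × (Fin n → ℝ) →L[ℝ] ℝ) :=
  genCoord e (chartDeriv m₀ u) ((extChartAt 𝓘(ℝ, E) m₀).symm u) ∘ₗ
    J.J ((extChartAt 𝓘(ℝ, E) m₀).symm u) ∘ₗ
      genFrame e (chartDeriv m₀ u) ((extChartAt 𝓘(ℝ, E) m₀).symm u)

/-- The coordinate form of the structure involves `x.1` only: semi-flatness is invariance along the
fibres. -/
lemma pullGen_semiFlat (J : B.AdaptedGACS) (he : e ∈ B.atlas) {x : E × (Fin n → ℝ)}
    (hx : x.1 ∈ (extChartAt 𝓘(ℝ, E) m₀).target)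
    (hm : (extChartAt 𝓘(ℝ, E) m₀).symm x.1 ∈ e.baseSet) (a : ∀ z : Z, GenTangent F z) :
    pullGen (coordParam e m₀) (fun z => J.semiFlat z (a z)) x =
      J.coordJ e m₀ x.1 (pullGen (coordParam e m₀) a x) := by
  have hm' : B.proj (coordParam e m₀ x) ∈ e.baseSet := by rwa [proj_coordParam hm]
  have h1 := pullGen_fromBase he hx hm (fun z => J.J (B.proj z) (B.toBase z (a z)))
  have h2 := pullGen_fromBase he hx hm (fun z => B.toBase z (a z))
  simp only [fromBase_toBase] at h2
  refine h1.trans ?_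
  rw [h2, AdaptedGACS.coordJ, ← proj_coordParam hm]
  simp only [LinearMap.comp_apply]
  rw [genFrame_genCoord he hm' (isInvertible_chartDeriv hx)]

end CoordParam

/-! ### The restriction of an adapted structure to the vertical directions. -/

section Model

variable {n : ℕ} {E : Type*} [NormedAddCommGroup E] [NormedSpace ℝ E] [FiniteDimensional ℝ E]
  {F : Type*} [NormedAddCommGroup F] [NormedSpace ℝ F]
  {M : Type*} [TopologicalSpace M] [ChartedSpace E M] [IsManifold 𝓘(ℝ, E) ∞ M]
  {Z : Type*} [TopologicalSpace Z] [ChartedSpace F Z] [IsManifold 𝓘(ℝ, F) ∞ Z]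
  {B : TorusBundle n E F M Z} {e : Trivialization (StdTorus n) B.proj} {m₀ : M}

namespace AdaptedGACS

/-- The section `J c` of `T_M ⊕ T_M^∨`, for a section `c` of `V ⊕ V^∨` with constant components
in the frame of a local trivialization. -/
def imageConst (J : B.AdaptedGACS) (e : Trivialization (StdTorus n) B.proj)
    (c : (Fin n → ℝ) × ((Fin n → ℝ) →L[ℝ] ℝ)) : ∀ m : M, GenTangent E m :=
  J.image (fun m => frameOf e m c.1) (dualFrameOf e c.2)

/-- The restriction of `coordJ` to the vertical directions. -/
def coordK (J : B.AdaptedGACS) (e : Trivialization (StdTorus n) B.proj) (m₀ : M) (u : E) :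
    (Fin n → ℝ) × ((Fin n → ℝ) →L[ℝ] ℝ) →L[ℝ]
      (E × (Fin n → ℝ)) × (E × (Fin n → ℝ) →L[ℝ] ℝ) :=
  (J.coordJ e m₀ u ∘ₗ (fibreIncl E (Fin n → ℝ)).toLinearMap).toContinuousLinearMap

omit [FiniteDimensional ℝ E] in
lemma coordK_apply (J : B.AdaptedGACS) (u : E) (c : (Fin n → ℝ) × ((Fin n → ℝ) →L[ℝ] ℝ)) :
    J.coordK e m₀ u c = J.coordJ e m₀ u (fibreIncl E (Fin n → ℝ) c) := rfl

omit [FiniteDimensional ℝ E] in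
lemma mem_genT_of_mem_genV (J : B.AdaptedGACS) {m : M} {a : B.GenVT m} (ha : a ∈ B.genV m) :
    J.J m a ∈ B.genT m := by
  rw [← J.adapted m]; exact Submodule.mem_map_of_mem ha

-- By adaptedness the image is purely horizontal, and its horizontal components are the chart
-- expression of the section `J c` of `T_M ⊕ T_M^∨`. Both smoothness of `coordK` and its brackets
-- are read off from this.
omit [FiniteDimensional ℝ E] in
lemma coordK_eq (J : B.AdaptedGACS) (u : E) (c : (Fin n → ℝ) × ((Fin n → ℝ) →L[ℝ] ℝ)) :
    J.coordK e m₀ u c =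
      baseIncl E _ (pullGen (extChartAt 𝓘(ℝ, E) m₀).symm (J.imageConst e c) u) := by
  rw [coordK_apply, coordJ, LinearMap.comp_apply, LinearMap.comp_apply, genFrame_fibreIncl]
  exact genCoord_of_mem_genT (J.mem_genT_of_mem_genV (ofV_mem_genV _ _))

omit [FiniteDimensional ℝ E] in
lemma isFlatAdapted (J : B.AdaptedGACS) (he : e ∈ B.atlas) {u : E}
    (hu : u ∈ (extChartAt 𝓘(ℝ, E) m₀).target)
    (hm : (extChartAt 𝓘(ℝ, E) m₀).symm u ∈ e.baseSet) :
    IsFlatAdapted (fibreIncl E (Fin n → ℝ)) (fibreProj E (Fin n → ℝ)) (J.coordJ e m₀ u)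
      (J.coordK e m₀ u) := by
  have hD := isInvertible_chartDeriv hu
  have hJ := J.isGenComplex ((extChartAt 𝓘(ℝ, E) m₀).symm u)
  refine ⟨fibreProj_fibreIncl, fun c h hh => genPairing_fibreIncl hh, fun h => ?_,
    fun c => rfl, fun c => ?_, fun h hh => ?_, fun a b => ?_⟩
  · simp only [coordJ, LinearMap.comp_apply]
    rw [genFrame_genCoord he hm hD, hJ.1, map_neg, genCoord_genFrame he hm hD]
  · rw [coordK_eq, fibreProj_baseIncl]
  · have h1 := genFrame_mem_genT (e := e) (D := chartDeriv m₀ u)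
      (m := (extChartAt 𝓘(ℝ, E) m₀).symm u) hh
    rw [← J.adapted] at h1
    obtain ⟨a, ha, h2⟩ := h1
    obtain ⟨c, rfl⟩ := exists_eq_ofV he hm ha
    refine ⟨c, ?_⟩
    rw [coordK_apply, coordJ, LinearMap.comp_apply, LinearMap.comp_apply, genFrame_fibreIncl, h2,
      genCoord_genFrame he hm hD]
  · simp only [coordJ, LinearMap.comp_apply]
    rw [genPairing_genCoord he hm hD, hJ.2, ← genPairing_genCoord he hm hD,
      genCoord_genFrame he hm hD, genCoord_genFrame he hm hD]

lemma smoothGenSectionAt_zero (m : M) :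
    SmoothGenSectionAt (fun m : M => (0 : GenTangent E m)) m := by
  have h := smoothGenSectionAt_of_contDiffAt_pullGen (a := fun m : M => (0 : GenTangent E m))
    (isLocalDiffeomorphAt_extChartAt_symm (mem_extChartAt_target (I := 𝓘(ℝ, E)) m)) (by
      have : pullGen (extChartAt 𝓘(ℝ, E) m).symm (fun m : M => (0 : GenTangent E m)) =
          fun _ => 0 := by
        funext y
        exact Prod.ext (map_zero _) (ContinuousLinearMap.zero_comp _)
      rw [this]
      exact contDiffAt_const)
  rwa [extChartAt_to_inv] at h

lemma smoothGenSectionAt_imageConst (J : B.AdaptedGACS) (he : e ∈ B.atlas) {m : M}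
    (hm : m ∈ e.baseSet) (c : (Fin n → ℝ) × ((Fin n → ℝ) →L[ℝ] ℝ)) :
    SmoothGenSectionAt (J.imageConst e c) m := by
  refine (J.smooth e.baseSet e.open_baseSet
    (fun m => B.ofV m (frameOf e m c.1) (dualFrameOf e c.2 m)) ⟨smoothVOn_frameOf he c.1,
      smoothVDualOn_dualFrameOf he c.2, smoothGenSectionOn_of_forall fun m _ => ?_⟩).2.2.at
        e.open_baseSet hm
  have h : (fun m => B.toT m (B.ofV m (frameOf e m c.1) (dualFrameOf e c.2 m))) =
      fun m => 0 := by
    funext m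
    refine Prod.ext rfl (ContinuousLinearMap.ext fun v => ?_)
    exact map_zero (dualFrameOf e c.2 m)
  rw [h]
  exact smoothGenSectionAt_zero m

lemma contDiffAt_coordK (J : B.AdaptedGACS) (he : e ∈ B.atlas) {u : E}
    (hu : u ∈ (extChartAt 𝓘(ℝ, E) m₀).target)
    (hm : (extChartAt 𝓘(ℝ, E) m₀).symm u ∈ e.baseSet) :
    ContDiffAt ℝ ∞ (J.coordK e m₀) u := by
  refine contDiffAt_clm_of_apply fun c => ?_
  simp only [coordK_eq]
  exact (baseIncl E (Fin n → ℝ)).contDiff.contDiffAt.comp u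
    (contDiffAt_pullGen (isLocalDiffeomorphAt_extChartAt_symm hu)
      (J.smoothGenSectionAt_imageConst he hm c))

end AdaptedGACS

end Model

end TorusBundle

/-! ### Linearity of the pullback and locality of the bracket. -/

section Pull

variable {G : Type*} [NormedAddCommGroup G] [NormedSpace ℝ G]
  {F : Type*} [NormedAddCommGroup F] [NormedSpace ℝ F]
  {N : Type*} [TopologicalSpace N] [ChartedSpace F N]

lemma pullGen_add (f : G → N) (a b : ∀ z : N, GenTangent F z) (x : G) :
    pullGen f (fun z => a z + b z) x = pullGen f a x + pullGen f b x :=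
  Prod.ext (map_add _ _ _) (ContinuousLinearMap.add_comp _ _ _)

lemma pullGen_sub (f : G → N) (a b : ∀ z : N, GenTangent F z) (x : G) :
    pullGen f (fun z => a z - b z) x = pullGen f a x - pullGen f b x :=
  Prod.ext (map_sub _ _ _) (ContinuousLinearMap.sub_comp _ _ _)

lemma pullGen_neg (f : G → N) (a : ∀ z : N, GenTangent F z) (x : G) :
    pullGen f (fun z => -a z) x = -pullGen f a x :=
  Prod.ext (map_neg _ _) (ContinuousLinearMap.neg_comp _ _)

lemma pullGen_zero (f : G → N) (x : G) :
    pullGen f (fun z : N => (0 : GenTangent F z)) x = 0 :=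
  Prod.ext (map_zero _) (ContinuousLinearMap.zero_comp _)

section Zero

variable {S : Type*} [NormedAddCommGroup S] [NormedSpace ℝ S] (K : S →L[ℝ] G × (G →L[ℝ] ℝ))
  (Q : G →L[ℝ] S →L[ℝ] G × (G →L[ℝ] ℝ))

/-- The values and derivatives here are those of a section `K · 0`, which vanishes identically. -/
lemma jetBracket_flip_zero_left (h' : G × (G →L[ℝ] ℝ)) (A' : G →L[ℝ] G × (G →L[ℝ] ℝ)) :
    jetBracket (K 0) h' (Q.flip 0) A' = 0 := by
  have hK : K 0 = 0 := map_zero K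
  have hQ : ∀ w, Q.flip 0 w = 0 := fun w => map_zero (Q w)
  refine Prod.ext ?_ (ContinuousLinearMap.ext fun w => ?_)
  · rw [jetBracket_fst, hQ, hK]; simp
  · rw [jetBracket_snd_apply, hQ, hQ, hK]; simp

lemma jetBracket_flip_zero_right (h : G × (G →L[ℝ] ℝ)) (A : G →L[ℝ] G × (G →L[ℝ] ℝ)) :
    jetBracket h (K 0) A (Q.flip 0) = 0 := by
  have hK : K 0 = 0 := map_zero K
  have hQ : ∀ w, Q.flip 0 w = 0 := fun w => map_zero (Q w)
  refine Prod.ext ?_ (ContinuousLinearMap.ext fun w => ?_)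
  · rw [jetBracket_fst, hQ, hK]; simp
  · rw [jetBracket_snd_apply, hQ, hQ, hK]; simp

end Zero

lemma SmoothGenSectionAt.congr {a b : ∀ z : N, GenTangent F z} [IsManifold 𝓘(ℝ, F) ∞ N] {z : N}
    (ha : SmoothGenSectionAt a z) (h : ∀ᶠ z' in 𝓝 z, b z' = a z') : SmoothGenSectionAt b z := by
  refine ⟨ha.1.congr_of_eventuallyEq ?_, ha.2.congr_of_eventuallyEq ?_⟩ <;>
  · filter_upwards [h] with z' hz'
    rw [hz']

/-- The Courant bracket of smooth sections is a local operator. -/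
lemma courantBracket_congr [FiniteDimensional ℝ F] [IsManifold 𝓘(ℝ, F) ∞ N]
    {a b a' b' : ∀ z : N, GenTangent F z} {z : N} (ha : SmoothGenSectionAt a z)
    (hb : SmoothGenSectionAt b z) (h : ∀ᶠ z' in 𝓝 z, a' z' = a z')
    (h' : ∀ᶠ z' in 𝓝 z, b' z' = b z') : courantBracket a' b' z = courantBracket a b z := by
  have hz := extChartAt_to_inv (I := 𝓘(ℝ, F)) z
  have hf := isLocalDiffeomorphAt_extChartAt_symm (mem_extChartAt_target (I := 𝓘(ℝ, F)) z)
  have key : ∀ {c c' : ∀ z : N, GenTangent F z}, (∀ᶠ z' in 𝓝 z, c' z' = c z') →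
      pullGen (extChartAt 𝓘(ℝ, F) z).symm c' =ᶠ[𝓝 (extChartAt 𝓘(ℝ, F) z z)]
        pullGen (extChartAt 𝓘(ℝ, F) z).symm c := by
    intro c c' hc
    rw [← hz] at hc
    filter_upwards [hf.contMDiffAt.continuousAt.eventually hc] with y hy
    rw [pullGen, pullGen, hy]
  have h1 := pullGen_courantBracket hf (a := a) (b := b) (by rwa [hz]) (by rwa [hz])
  have h2 := pullGen_courantBracket hf (a := a') (b := b') (by rw [hz]; exact ha.congr h)
    (by rw [hz]; exact hb.congr h')
  rw [(key h).fderiv_eq, (key h').fderiv_eq, (key h).eq_of_nhds, (key h').eq_of_nhds, ← h1] at h2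
  have h3 := pullGen_injective hf h2
  rwa [hz] at h3

end Pull

/-! ### The two implications. -/

namespace TorusBundle

variable {n : ℕ} {E : Type*} [NormedAddCommGroup E] [NormedSpace ℝ E] [FiniteDimensional ℝ E]
  {F : Type*} [NormedAddCommGroup F] [NormedSpace ℝ F]
  {M : Type*} [TopologicalSpace M] [ChartedSpace E M] [IsManifold 𝓘(ℝ, E) ∞ M]
  {Z : Type*} [TopologicalSpace Z] [ChartedSpace F Z] [IsManifold 𝓘(ℝ, F) ∞ Z]
  {B : TorusBundle n E F M Z} {e : Trivialization (StdTorus n) B.proj} {m₀ : M}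

namespace AdaptedGACS

/-- This identifies the obstruction term in `exists_bracket_eq` with the Courant bracket on `M` of
the images of two flat sections. -/
lemma jetBracket_coordK (J : B.AdaptedGACS) (he : e ∈ B.atlas) {u : E}
    (hu : u ∈ (extChartAt 𝓘(ℝ, E) m₀).target)
    (hm : (extChartAt 𝓘(ℝ, E) m₀).symm u ∈ e.baseSet)
    (c d : (Fin n → ℝ) × ((Fin n → ℝ) →L[ℝ] ℝ)) :
    jetBracket (J.coordK e m₀ u c) (J.coordK e m₀ u d)
      (((fderiv ℝ (J.coordK e m₀) u).comp (ContinuousLinearMap.fst ℝ E (Fin n → ℝ))).flip c)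
      (((fderiv ℝ (J.coordK e m₀) u).comp (ContinuousLinearMap.fst ℝ E (Fin n → ℝ))).flip d) =
    baseIncl E _ (pullGen (extChartAt 𝓘(ℝ, E) m₀).symm
      (courantBracket (J.imageConst e c) (J.imageConst e d)) u) := by
  have hf := isLocalDiffeomorphAt_extChartAt_symm hu
  have hs := fun c => J.smoothGenSectionAt_imageConst he hm c
  have hd : ∀ c, ((fderiv ℝ (J.coordK e m₀) u).comp
      (ContinuousLinearMap.fst ℝ E (Fin n → ℝ))).flip c = ((baseIncl E _).comp
      (fderiv ℝ (pullGen (extChartAt 𝓘(ℝ, E) m₀).symm (J.imageConst e c)) u)).comp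
        (ContinuousLinearMap.fst ℝ E (Fin n → ℝ)) := by
    intro c
    have h1 := hasFDerivAt_clm_apply_const
      (T := (E × (Fin n → ℝ)) × (E × (Fin n → ℝ) →L[ℝ] ℝ))
      ((J.contDiffAt_coordK he hu hm).differentiableAt (by simp))
      (ContinuousLinearMap.id ℝ _) c
    have h2 := (baseIncl E (Fin n → ℝ)).hasFDerivAt.comp u
      ((contDiffAt_pullGen hf (hs c)).differentiableAt (by simp)).hasFDerivAt
    have h3 : (fun y => ContinuousLinearMap.id ℝ _ (J.coordK e m₀ y c)) =
        baseIncl E (Fin n → ℝ) ∘ pullGen (extChartAt 𝓘(ℝ, E) m₀).symm (J.imageConst e c) := by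
      funext y
      exact J.coordK_eq y c
    rw [h3] at h1
    have h4 := h1.unique h2
    rw [← h4]
    rfl
  rw [pullGen_courantBracket hf (hs c) (hs d), ← jetBracket_baseIncl, hd, hd, coordK_eq, coordK_eq]

omit [FiniteDimensional ℝ E] in
lemma inPlusEigenbundle_semiFlat_iff (J : B.AdaptedGACS) (he : e ∈ B.atlas)
    {x : E × (Fin n → ℝ)} (hx : x.1 ∈ (extChartAt 𝓘(ℝ, E) m₀).target)
    (hm : (extChartAt 𝓘(ℝ, E) m₀).symm x.1 ∈ e.baseSet) (a : ComplexGenSection F Z) :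
    InPlusEigenbundle J.semiFlat a (coordParam e m₀ x) ↔
      J.coordJ e m₀ x.1 (pullGen (coordParam e m₀) a.re x) = -pullGen (coordParam e m₀) a.im x ∧
      J.coordJ e m₀ x.1 (pullGen (coordParam e m₀) a.im x) = pullGen (coordParam e m₀) a.re x := by
  have hf := isLocalDiffeomorphAt_coordParam he hx hm
  rw [← pullGen_semiFlat J he hx hm, ← pullGen_semiFlat J he hx hm, ← pullGen_neg]
  constructor
  · rintro ⟨h1, h2⟩
    constructor
    · rw [pullGen, h1, pullGen]
    · rw [pullGen, h2, pullGen]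
  · rintro ⟨h1, h2⟩
    exact ⟨pullGen_injective hf h1, pullGen_injective hf h2⟩

omit [FiniteDimensional ℝ E] in
lemma semiFlat_semiFlat (J : B.AdaptedGACS) (z : Z) (a : GenTangent F z) :
    J.semiFlat z (J.semiFlat z a) = -a := by
  simp only [semiFlat, LinearMap.comp_apply, toBase_fromBase, (J.isGenComplex (B.proj z)).1,
    map_neg, fromBase_toBase]

variable [FiniteDimensional ℝ F]

/-- The bracket of sections of the `+i`-eigenbundle of a semi-flat structure, in local
coordinates. -/
lemma exists_pullGen_complexCourantBracket_eq (J : B.AdaptedGACS) (he : e ∈ B.atlas)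
    {x : E × (Fin n → ℝ)} (hx : x.1 ∈ (extChartAt 𝓘(ℝ, E) m₀).target)
    (hm : (extChartAt 𝓘(ℝ, E) m₀).symm x.1 ∈ e.baseSet) {U : Set Z} (hU : IsOpen U)
    (hxU : coordParam e m₀ x ∈ U) {a b : ComplexGenSection F Z}
    (ha : IsSectionOfPlusEigenbundle J.semiFlat U a)
    (hb : IsSectionOfPlusEigenbundle J.semiFlat U b) :
    let β := fun c d : (Fin n → ℝ) × ((Fin n → ℝ) →L[ℝ] ℝ) =>
      jetBracket (J.coordK e m₀ x.1 c) (J.coordK e m₀ x.1 d)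
      (((fderiv ℝ (J.coordK e m₀) x.1).comp (ContinuousLinearMap.fst ℝ E (Fin n → ℝ))).flip c)
      (((fderiv ℝ (J.coordK e m₀) x.1).comp (ContinuousLinearMap.fst ℝ E (Fin n → ℝ))).flip d)
    let P := fun s : ∀ z, GenTangent F z => fibreProj E (Fin n → ℝ) (pullGen (coordParam e m₀) s x)
    ∃ u u' : (Fin n → ℝ) × ((Fin n → ℝ) →L[ℝ] ℝ),
      pullGen (coordParam e m₀) (complexCourantBracket a b).re x =
        fibreIncl E _ u + J.coordK e m₀ x.1 u' + (β (P a.im) (P b.im) - β (P a.re) (P b.re)) ∧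
      pullGen (coordParam e m₀) (complexCourantBracket a b).im x =
        fibreIncl E _ u' - J.coordK e m₀ x.1 u - (β (P a.im) (P b.re) + β (P a.re) (P b.im)) := by
  intro β P
  have hf := isLocalDiffeomorphAt_coordParam he hx hm
  have hevE : ∀ᶠ u in 𝓝 x.1, u ∈ (extChartAt 𝓘(ℝ, E) m₀).target ∧
      (extChartAt 𝓘(ℝ, E) m₀).symm u ∈ e.baseSet :=
    ((isOpen_extChartAt_target m₀).mem_nhds hx |> Filter.Eventually.and <|
      (isLocalDiffeomorphAt_extChartAt_symm hx).contMDiffAt.continuousAt.preimage_mem_nhds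
        (e.open_baseSet.mem_nhds hm))
  have hev : ∀ᶠ y in 𝓝 x, (y.1 ∈ (extChartAt 𝓘(ℝ, E) m₀).target ∧
      (extChartAt 𝓘(ℝ, E) m₀).symm y.1 ∈ e.baseSet) ∧ coordParam e m₀ y ∈ U :=
    (continuous_fst.continuousAt.eventually hevE).and
      (hf.contMDiffAt.continuousAt.preimage_mem_nhds (hU.mem_nhds hxU))
  have sm : ∀ {s : ∀ z, GenTangent F z}, SmoothGenSectionOn U s →
      DifferentiableAt ℝ (pullGen (coordParam e m₀) s) x := fun hs =>
    (contDiffAt_pullGen hf (hs.at hU hxU)).differentiableAt (by simp)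
  have eig : ∀ {a : ComplexGenSection F Z}, IsSectionOfPlusEigenbundle J.semiFlat U a →
      ∀ᶠ y in 𝓝 x, J.coordJ e m₀ (ContinuousLinearMap.fst ℝ E (Fin n → ℝ) y)
        (pullGen (coordParam e m₀) a.im y) = pullGen (coordParam e m₀) a.re y := by
    intro a ha
    filter_upwards [hev] with y hy
    exact ((J.inPlusEigenbundle_semiFlat_iff he hy.1.1 hy.1.2 a).1 (ha.2.2 _ hy.2)).2
  obtain ⟨u, u', h1, h2⟩ := exists_bracket_eq (p := ContinuousLinearMap.fst ℝ E (Fin n → ℝ))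
    (ι := fibreIncl E (Fin n → ℝ)) (ρ := fibreProj E (Fin n → ℝ)) (K := J.coordK e m₀)
    (J := J.coordJ e m₀) (x := x) (fun _ => rfl)
    ((J.contDiffAt_coordK he hx hm).differentiableAt (by simp))
    (by filter_upwards [hevE] with y hy using J.isFlatAdapted he hy.1 hy.2)
    (sm ha.1) (sm ha.2.1) (sm hb.1) (sm hb.2.1) (eig ha) (eig hb)
  have br : ∀ {s t : ∀ z, GenTangent F z}, SmoothGenSectionOn U s → SmoothGenSectionOn U t →
      pullGen (coordParam e m₀) (courantBracket s t) x =
        jetBracket (pullGen (coordParam e m₀) s x) (pullGen (coordParam e m₀) t x)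
          (fderiv ℝ (pullGen (coordParam e m₀) s) x) (fderiv ℝ (pullGen (coordParam e m₀) t) x) :=
    fun hs ht => pullGen_courantBracket hf (hs.at hU hxU) (ht.at hU hxU)
  refine ⟨u, u', ?_, ?_⟩
  · rw [← br ha.1 hb.1, ← br ha.2.1 hb.2.1] at h1
    exact (pullGen_sub _ _ _ _).trans h1
  · rw [← br ha.1 hb.2.1, ← br ha.2.1 hb.1] at h2
    exact (pullGen_add _ _ _ _).trans h2

/-- Once the obstruction vanishes, the bracket has the form `ι (u + iu') - iK (u + iu')`, and every
such vector lies in the eigenbundle. -/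
theorem isIntegrableGen_of_bracketsVanish (J : B.AdaptedGACS) (h : J.BracketsVanish) :
    IsIntegrableGen J.semiFlat := by
  intro U hU a b ha hb z hz
  have he := B.trivAt_mem_atlas (B.proj z)
  have hm := B.mem_baseSet_trivAt (B.proj z)
  have hinv := extChartAt_to_inv (I := 𝓘(ℝ, E)) (B.proj z)
  set e := B.trivAt (B.proj z) with hedef
  obtain ⟨x, hxz, hx⟩ : ∃ x : E × (Fin n → ℝ), coordParam e (B.proj z) x = z ∧
      x.1 = extChartAt 𝓘(ℝ, E) (B.proj z) (B.proj z) := by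
    refine ⟨(extChartAt 𝓘(ℝ, E) (B.proj z) (B.proj z), B.vertCoord z), ?_, rfl⟩
    rw [coordParam, hinv]
    exact param_vertCoord z
  have hx1 : x.1 ∈ (extChartAt 𝓘(ℝ, E) (B.proj z)).target := by
    rw [hx]; exact mem_extChartAt_target _
  have hx2 : (extChartAt 𝓘(ℝ, E) (B.proj z)).symm x.1 ∈ e.baseSet := by
    rw [hx, hinv]; exact hm
  obtain ⟨u, u', h1, h2⟩ := J.exists_pullGen_complexCourantBracket_eq he hx1 hx2 hU
    (by rwa [hxz]) ha hb
  have hβ : ∀ c d, pullGen (extChartAt 𝓘(ℝ, E) (B.proj z)).symm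
      (courantBracket (J.imageConst e c) (J.imageConst e d)) x.1 = 0 := by
    intro c d
    have h3 := h e.baseSet e.open_baseSet _ _ _ _ (isFlatOn_frameOf he c.1)
      (isFlatDualOn_dualFrameOf he c.2) (isFlatOn_frameOf he d.1) (isFlatDualOn_dualFrameOf he d.2)
      _ hx2
    rw [← pullGen_zero (F := E) (N := M) (extChartAt 𝓘(ℝ, E) (B.proj z)).symm x.1, pullGen, pullGen]
    rw [imageConst, imageConst, h3]
  simp only [J.jetBracket_coordK he hx1 hx2, hβ, map_zero, sub_zero, add_zero] at h1 h2
  have hJ := J.isFlatAdapted he hx1 hx2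
  rw [← hxz, J.inPlusEigenbundle_semiFlat_iff he hx1 hx2 (complexCourantBracket a b), h1, h2, map_add, map_sub,
    hJ.apply_incl, hJ.apply_incl, hJ.apply_K, hJ.apply_K]
  constructor <;> abel

/-- The section `c - i J c` of the `+i`-eigenbundle, for a section `c` of `V ⊕ V^∨` with constant
components in the frame of a local trivialization. -/
def eigenSection (J : B.AdaptedGACS) (e : Trivialization (StdTorus n) B.proj)
    (c : (Fin n → ℝ) × ((Fin n → ℝ) →L[ℝ] ℝ)) : ComplexGenSection F Z where
  re z := B.fromBase z (B.ofV (B.proj z) (frameOf e (B.proj z) c.1) (dualFrameOf e c.2 (B.proj z)))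
  im z := -J.semiFlat z
    (B.fromBase z (B.ofV (B.proj z) (frameOf e (B.proj z) c.1) (dualFrameOf e c.2 (B.proj z))))

omit [FiniteDimensional ℝ E] [FiniteDimensional ℝ F] in
lemma pullGen_eigenSection_re (J : B.AdaptedGACS) (he : e ∈ B.atlas)
    {x : E × (Fin n → ℝ)} (hx : x.1 ∈ (extChartAt 𝓘(ℝ, E) m₀).target)
    (hm : (extChartAt 𝓘(ℝ, E) m₀).symm x.1 ∈ e.baseSet)
    (c : (Fin n → ℝ) × ((Fin n → ℝ) →L[ℝ] ℝ)) :
    pullGen (coordParam e m₀) (J.eigenSection e c).re x = fibreIncl E _ c := by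
  refine (pullGen_fromBase he hx hm
    (fun z => B.ofV (B.proj z) (frameOf e (B.proj z) c.1) (dualFrameOf e c.2 (B.proj z)))).trans ?_
  rw [← genFrame_fibreIncl (D := chartDeriv m₀ x.1)]
  refine genCoord_genFrame he ?_ (isInvertible_chartDeriv hx) _
  rwa [proj_coordParam hm]

omit [FiniteDimensional ℝ F] [FiniteDimensional ℝ E] in
lemma pullGen_eigenSection_im (J : B.AdaptedGACS) (he : e ∈ B.atlas)
    {x : E × (Fin n → ℝ)} (hx : x.1 ∈ (extChartAt 𝓘(ℝ, E) m₀).target)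
    (hm : (extChartAt 𝓘(ℝ, E) m₀).symm x.1 ∈ e.baseSet)
    (c : (Fin n → ℝ) × ((Fin n → ℝ) →L[ℝ] ℝ)) :
    pullGen (coordParam e m₀) (J.eigenSection e c).im x = -J.coordK e m₀ x.1 c := by
  rw [coordK_apply, ← J.pullGen_eigenSection_re he hx hm c, ← pullGen_semiFlat J he hx hm,
    ← pullGen_neg]
  rfl

lemma isSection_eigenSection (J : B.AdaptedGACS) (he : e ∈ B.atlas)
    (c : (Fin n → ℝ) × ((Fin n → ℝ) →L[ℝ] ℝ)) :
    IsSectionOfPlusEigenbundle J.semiFlat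
      (B.proj ⁻¹' (e.baseSet ∩ (extChartAt 𝓘(ℝ, E) m₀).source)) (J.eigenSection e c) := by
  -- Smoothness on `Z` is checked in coordinates, where the real part is the constant `ι c` and the
  -- imaginary part is `-K c`.
  have key : ∀ s : ∀ z, GenTangent F z, (∀ x : E × (Fin n → ℝ),
      x.1 ∈ (extChartAt 𝓘(ℝ, E) m₀).target → (extChartAt 𝓘(ℝ, E) m₀).symm x.1 ∈ e.baseSet →
        ContDiffAt ℝ ∞ (pullGen (coordParam e m₀) s) x) →
      SmoothGenSectionOn (B.proj ⁻¹' (e.baseSet ∩ (extChartAt 𝓘(ℝ, E) m₀).source)) s := by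
    intro s hs
    refine smoothGenSectionOn_of_forall fun z hz => ?_
    have hinv := (extChartAt 𝓘(ℝ, E) m₀).left_inv hz.2
    have hx1 := (extChartAt 𝓘(ℝ, E) m₀).map_source hz.2
    have hx2 : (extChartAt 𝓘(ℝ, E) m₀).symm (extChartAt 𝓘(ℝ, E) m₀ (B.proj z)) ∈ e.baseSet := by
      rw [hinv]; exact hz.1
    have h := smoothGenSectionAt_of_contDiffAt_pullGen
      (x := (extChartAt 𝓘(ℝ, E) m₀ (B.proj z), torusLift (e z).2))
      (isLocalDiffeomorphAt_coordParam he hx1 hx2) (hs _ hx1 hx2)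
    have hz' : coordParam e m₀ (extChartAt 𝓘(ℝ, E) m₀ (B.proj z), torusLift (e z).2) = z := by
      rw [coordParam, hinv]
      exact exists_param_eq hz.1
    rwa [hz'] at h
  have hev : ∀ x : E × (Fin n → ℝ), x.1 ∈ (extChartAt 𝓘(ℝ, E) m₀).target →
      (extChartAt 𝓘(ℝ, E) m₀).symm x.1 ∈ e.baseSet → ∀ᶠ y in 𝓝 x,
        y.1 ∈ (extChartAt 𝓘(ℝ, E) m₀).target ∧ (extChartAt 𝓘(ℝ, E) m₀).symm y.1 ∈ e.baseSet := by
    intro x hx hm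
    exact continuous_fst.continuousAt.eventually
      (Filter.inter_mem ((isOpen_extChartAt_target m₀).mem_nhds hx)
        ((isLocalDiffeomorphAt_extChartAt_symm hx).contMDiffAt.continuousAt.preimage_mem_nhds
          (e.open_baseSet.mem_nhds hm)))
  refine ⟨key _ fun x hx hm => ?_, key _ fun x hx hm => ?_, fun z _ => ⟨?_, ?_⟩⟩
  · refine (contDiffAt_const (c := fibreIncl E (Fin n → ℝ) c)).congr_of_eventuallyEq ?_
    filter_upwards [hev x hx hm] with y hy using J.pullGen_eigenSection_re he hy.1 hy.2 c
  · have h1 : ContDiffAt ℝ ∞ (fun y : E × (Fin n → ℝ) => J.coordK e m₀ y.1 c) x := by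
      simp only [coordK_eq]
      exact (baseIncl E (Fin n → ℝ)).contDiff.contDiffAt.comp x
        ((contDiffAt_pullGen (isLocalDiffeomorphAt_extChartAt_symm hx)
          (J.smoothGenSectionAt_imageConst he hm c)).comp x contDiffAt_fst)
    refine h1.neg.congr_of_eventuallyEq ?_
    filter_upwards [hev x hx hm] with y hy using J.pullGen_eigenSection_im he hy.1 hy.2 c
  · exact (neg_neg _).symm
  · exact (map_neg _ _).trans ((congrArg Neg.neg (J.semiFlat_semiFlat z _)).trans (neg_neg _))

/-- Integrability is applied to the sections `ι c - iK c` and `ι d - iK d`, whose vertical parts are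
real and constant. Up to an element of the eigenbundle, their bracket is the real vector `-[K c, K
d]`, and the eigenbundle contains no nonzero real vector. -/
lemma courantBracket_imageConst_eq_zero (J : B.AdaptedGACS) (h : IsIntegrableGen J.semiFlat)
    (he : e ∈ B.atlas) {m : M} (hm : m ∈ e.baseSet)
    (c d : (Fin n → ℝ) × ((Fin n → ℝ) →L[ℝ] ℝ)) :
    courantBracket (J.imageConst e c) (J.imageConst e d) m = 0 := by
  have hinv := extChartAt_to_inv (I := 𝓘(ℝ, E)) m
  have hx1 := mem_extChartAt_target (I := 𝓘(ℝ, E)) m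
  have hx2 : (extChartAt 𝓘(ℝ, E) m).symm (extChartAt 𝓘(ℝ, E) m m) ∈ e.baseSet := by
    rw [hinv]; exact hm
  -- Any point of the fibre over `m` would do, as the obstruction depends only on the base
  -- coordinate.
  obtain ⟨x, hx⟩ : ∃ x : E × (Fin n → ℝ), x.1 = extChartAt 𝓘(ℝ, E) m m := ⟨(_, 0), rfl⟩
  rw [← hx] at hx1 hx2 hinv
  have hU' : IsOpen (B.proj ⁻¹' (e.baseSet ∩ (extChartAt 𝓘(ℝ, E) m).source)) :=
    (e.open_baseSet.inter (isOpen_extChartAt_source m)).preimage B.contMDiff_proj.continuous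
  have hxU : coordParam e m x ∈ B.proj ⁻¹' (e.baseSet ∩ (extChartAt 𝓘(ℝ, E) m).source) := by
    rw [mem_preimage, proj_coordParam hx2, hinv]
    exact ⟨hm, mem_extChartAt_source m⟩
  have hc := J.isSection_eigenSection (m₀ := m) he c
  have hd := J.isSection_eigenSection (m₀ := m) he d
  obtain ⟨u, u', h1, h2⟩ := J.exists_pullGen_complexCourantBracket_eq he hx1 hx2 hU' hxU hc hd
  have h3 := ((J.inPlusEigenbundle_semiFlat_iff he hx1 hx2 _).1 (h _ hU' _ _ hc hd _ hxU)).2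
  have hJ := J.isFlatAdapted he hx1 hx2
  simp only [J.pullGen_eigenSection_re he hx1 hx2, J.pullGen_eigenSection_im he hx1 hx2,
    fibreProj_fibreIncl, map_neg, hJ.proj_apply, neg_zero] at h1 h2
  rw [jetBracket_flip_zero_left, J.jetBracket_coordK he hx1 hx2] at h1
  rw [jetBracket_flip_zero_left, jetBracket_flip_zero_right] at h2
  -- The equation `J im = re` reads `K u' + ι u = ι u + K u' - β`, where `β` is the obstruction, so
  -- `β = 0`.
  rw [h1, h2, map_sub, map_sub, hJ.apply_incl, hJ.apply_K, add_zero, map_zero, zero_sub, sub_zero,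
    sub_neg_eq_add, add_comm, left_eq_add, neg_eq_zero] at h3
  rw [← map_zero (baseIncl E (Fin n → ℝ)),
    ← pullGen_zero (F := E) (N := M) (extChartAt 𝓘(ℝ, E) m).symm x.1] at h3
  have h5 := pullGen_injective (isLocalDiffeomorphAt_extChartAt_symm hx1) (baseIncl_injective h3)
  rwa [hinv] at h5

/-- The bracket is local, and near each point flat sections have constant components in a
trivialization, which reduces the claim to `imageConst`. -/
theorem bracketsVanish_of_isIntegrableGen (J : B.AdaptedGACS) (h : IsIntegrableGen J.semiFlat) :
    J.BracketsVanish := by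
  intro U hU σ σ' θ θ' hσ hθ hσ' hθ' m hmU
  have he := B.trivAt_mem_atlas m
  have hm := B.mem_baseSet_trivAt m
  obtain ⟨s, hs⟩ := hσ.eventually_eq_frameOf he hU hmU hm
  obtain ⟨s', hs'⟩ := hσ'.eventually_eq_frameOf he hU hmU hm
  obtain ⟨φ, hφ⟩ := hθ.eventually_eq_dualFrameOf he hU hmU hm
  obtain ⟨φ', hφ'⟩ := hθ'.eventually_eq_dualFrameOf he hU hmU hm
  rw [courantBracket_congr (J.smoothGenSectionAt_imageConst he hm (s, φ))
    (J.smoothGenSectionAt_imageConst he hm (s', φ'))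
    (by filter_upwards [hs, hφ] with m' h1 h2; rw [image, h1, h2]; rfl)
    (by filter_upwards [hs', hφ'] with m' h1 h2; rw [image, h1, h2]; rfl)]
  exact J.courantBracket_imageConst_eq_zero h he hm _ _

end AdaptedGACS

end TorusBundle

end

theorem mainTheorem3 {n : ℕ}
    {E : Type*} [NormedAddCommGroup E] [NormedSpace ℝ E] [FiniteDimensional ℝ E]
    (hE : Module.finrank ℝ E = n)
    {F : Type*} [NormedAddCommGroup F] [NormedSpace ℝ F] [FiniteDimensional ℝ F]
    {M : Type*} [TopologicalSpace M] [ChartedSpace E M] [IsManifold 𝓘(ℝ, E) ∞ M]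
    {Z : Type*} [TopologicalSpace Z] [ChartedSpace F Z] [IsManifold 𝓘(ℝ, F) ∞ Z]
    (B : TorusBundle n E F M Z) (J : B.AdaptedGACS) :
    IsIntegrableGen J.semiFlat ↔ J.BracketsVanish :=
  ⟨J.bracketsVanish_of_isIntegrableGen, J.isIntegrableGen_of_bracketsVanish⟩
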